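/- Let $n\ge 1$ and $k\ge 3$ be integers, $\sigma>0$, and let $\mathcal C=\{(\sigma s\,\nu,s)\mid \nu\in\mathbf S^{n-1},\ s>0\}\subset\mathbb R^{n+1}$ be the rotationally symmetric cone of slope $\sigma$. Let $f$ be a function on a set $\Omega\subset\mathbb R^n$ closed under permutations of the coordinates and under homotheties $\lambda\mapsto\varrho\lambda$, $\varrho>0$, and let $f$ be symmetric and homogeneous of degree one on $\Omega$. Write $c=f(1,\dots,1,0)$. Let $\mathcal K\subset\Omega$ be a bounded open neighborhood of $(1,\dots,1,0)$ on which $f$ is of class $C^{k+1}$, with $\|f\|_{C^{k+1}(\mathcal K)}<\infty$ and $\partial_i f>0$ for $i=1,\dots,n$. Then there are $R\ge 1$, depending only on $n,k,\sigma,\mathcal K$ and (an upper bound for) $\|f\|_{C^{k+1}(\mathcal K)}$, and a function $\mathring u\in C^k_0[R,\infty)$ (that is, $\mathring u$ is $C^k$ on $[R,\infty)$ and $\partial_s^j\mathring u(s)\to0$ as $s\to\infty$ for $0\le j\le k$), such that $$r(s)=\sigma s+\frac{c}{\sigma s}+\mathring u(s)>0\qquad(s\ge R)$$ and the hypersurface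 $\Sigma=\{(r(s)\nu,s)\mid\nu\in\mathbf S^{n-1},\ s\in[R,\infty)\}$, oriented by the unit normal $N=(-\nu,r')/\sqrt{1+r'^2}$, has the following properties. 1. $\Sigma$ is an $f$ self-shrinker: it is a properly embedded $C^k$ hypersurface with boundary, and at each point $X\in\Sigma$ the principal curvatures $\kappa=(\kappa_1,\dots,\kappa_n)$ lie in $\Omega$ and $f(\kappa)+\tfrac12X\cdot N=0$. 2. $\Sigma$ is $C^k$ asymptotic to $\mathcal C$ at infinity: $\varrho\Sigma\to\mathcal C$ in $C^k_{\mathrm{loc}}(\mathbb R^{n+1}\setminus\{0\})$ as $\varrho\searrow0$. 3. For $t\in[-1,0)$, $$\Sigma_t:=\sqrt{-t}\,\Sigma=\Big\{\Big(\Big(\sigma s-t\,\frac{c}{\sigma s}+\mathring u_t(s)\Big)\nu,\,s\Big)\ \Big|\ \nu\in\mathbf S^{n-1},\ s\in[\sqrt{-t}R,\infty)\Big\},\qquad \mathring u_t(s)=\sqrt{-t}\,\mathring u\Big(\frac{s}{\sqrt{-t}}\Big),$$ and $\{\Sigma_t\}_{-1\le t<0}$ is an $f$ curvature flow, $(\partial_tX_t)^\perp=f(\kappa)N$.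 4. There is a constant $C$, depending only on $n,k,\sigma$ and (an upper bound for) $\|f\|_{C^k(\mathcal K)}$, such that for all $t\in[-1,0)$ $$\sum_{j=0}^{k-1}\big\|s^{j+3}\,\partial_s^j\mathring u_t\big\|_{L^\infty[\sqrt{-t}R,\infty)}\le C\,(-t)^2,\qquad \big\|s^{k+1}\,\partial_s^k\mathring u_t\big\|_{L^\infty[\sqrt{-t}R,\infty)}\le C\,(-t).$$ -/

import Mathlib

open Set Filter Topology MeasureTheory
open scoped NNReal ENNReal Pointwise

/-- The ambient Euclidean space `ℝⁿ⁺¹`. -/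
abbrev Amb (n : ℕ) : Type := EuclideanSpace ℝ (Fin (n + 1))

/-- The point `(x, s)` of `ℝⁿ⁺¹`, for `x ∈ ℝⁿ` and `s ∈ ℝ`. -/
noncomputable def point {n : ℕ} (x : EuclideanSpace ℝ (Fin n)) (s : ℝ) : Amb n :=
  WithLp.toLp 2 (Fin.snoc (α := fun _ => ℝ) (fun i => x i) s)

/-- The first `n` coordinates `x` of a point `X = (x, s)` of `ℝⁿ⁺¹`. -/
noncomputable def horizontal {n : ℕ} (X : Amb n) : EuclideanSpace ℝ (Fin n) :=
  WithLp.toLp 2 (fun i => X i.castSucc)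

/-- The last coordinate `s` of a point `X = (x, s)` of `ℝⁿ⁺¹`. -/
def height {n : ℕ} (X : Amb n) : ℝ := X (Fin.last n)

/-! ### The curvature function -/

/-- The vector `(1, …, 1, 0)` of `ℝⁿ`. -/
def oneZero (n : ℕ) : Fin n → ℝ := fun i => if (i : ℕ) + 1 = n then 0 else 1

/-- The norm `‖f‖_{C^m(K)}`: the supremum over `K` of all derivatives of order at most `m`
(possibly `∞`). -/
noncomputable def cNorm {n : ℕ} (m : ℕ) (f : (Fin n → ℝ) → ℝ) (K : Set (Fin n → ℝ)) : ℝ≥0∞ :=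
  ⨆ j ∈ Iic m, ⨆ x ∈ K, ‖iteratedFDeriv ℝ j f x‖ₑ

/-- `f` is a curvature function with domain of definition `Ω` (the values of `f` off `Ω` are
irrelevant): `Ω` is closed under permutations of the coordinates and under homotheties, and `f` is
symmetric and homogeneous of degree one on `Ω`. -/
structure IsCurvatureFunction {n : ℕ} (Ω : Set (Fin n → ℝ)) (f : (Fin n → ℝ) → ℝ) : Prop where
  perm_mem : ∀ x ∈ Ω, ∀ π : Equiv.Perm (Fin n), x ∘ π ∈ Ω
  smul_mem : ∀ x ∈ Ω, ∀ ρ : ℝ, 0 < ρ → ρ • x ∈ Ω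
  symm : ∀ x ∈ Ω, ∀ π : Equiv.Perm (Fin n), f (x ∘ π) = f x
  homog : ∀ x ∈ Ω, ∀ ρ : ℝ, 0 < ρ → f (ρ • x) = ρ * f x

/-! ### Hypersurfaces of `ℝⁿ⁺¹` and their principal curvatures -/

/-- `S` is a properly embedded `C^m` hypersurface of `ℝⁿ⁺¹`, possibly with boundary (`m ≥ 1`): it is
closed, and near each of its points it is either a regular zero set `{g = 0}`, or (at a boundary
point) a half `{g = 0, h ≥ 0}` of such a zero set, `g` and `h` having independent differentials. -/
structure IsHypersurface {n : ℕ} (m : ℕ) (S : Set (Amb n)) : Prop where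
  isClosed : IsClosed S
  local_eq : ∀ X ∈ S, ∃ U : Set (Amb n), IsOpen U ∧ X ∈ U ∧
    ((∃ g : Amb n → ℝ, ContDiffOn ℝ m g U ∧ fderiv ℝ g X ≠ 0 ∧
        S ∩ U = {Y | Y ∈ U ∧ g Y = 0}) ∨
     (∃ g h : Amb n → ℝ, ContDiffOn ℝ m g U ∧ ContDiffOn ℝ m h U ∧
        LinearIndependent ℝ ![fderiv ℝ g X, fderiv ℝ h X] ∧ h X = 0 ∧
        S ∩ U = {Y | Y ∈ U ∧ g Y = 0 ∧ 0 ≤ h Y}))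

/-- The tangent space of `S` at `X`, as a linear subspace of `ℝⁿ⁺¹`. At a boundary point of a
hypersurface the tangent cone is a half space, whose span is the full tangent space. -/
def tangentSpaceAt {n : ℕ} (S : Set (Amb n)) (X : Amb n) : Submodule ℝ (Amb n) :=
  Submodule.span ℝ (tangentConeAt ℝ S X)

/-- `N` is a continuous unit normal field along `S`. -/
structure IsUnitNormal {n : ℕ} (S : Set (Amb n)) (N : Amb n → Amb n) : Prop where
  continuousOn : ContinuousOn N S
  norm_eq_one : ∀ X ∈ S, ‖N X‖ = 1
  orthogonal : ∀ X ∈ S, ∀ v ∈ tangentSpaceAt S X, inner ℝ v (N X) = 0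

/-- `κ` lists the principal curvatures, with multiplicity, of `S` at `X` with respect to the unit
normal `N`: the eigenvalues of the shape operator `-dN` on the tangent space, for an orthonormal
basis of principal vectors. (The unit sphere with its inward normal has `κ = (1, …, 1)`.) -/
def HasPrincipalCurvatures {n : ℕ} (S : Set (Amb n)) (N : Amb n → Amb n) (X : Amb n)
    (κ : Fin n → ℝ) : Prop :=
  ∃ (e : Fin n → Amb n) (W : Amb n →L[ℝ] Amb n), Orthonormal ℝ e ∧
    Submodule.span ℝ (Set.range e) = tangentSpaceAt S X ∧
    HasFDerivWithinAt N W S X ∧ ∀ i, W (e i) = -(κ i • e i)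

/-- `S`, oriented by `N`, is a (`C^m`) `f` self-shrinker: `f(κ) + ½ X·N = 0` at each point `X`,
where in particular the principal curvatures lie in the domain `Ω` of `f`. -/
structure IsSelfShrinker {n : ℕ} (m : ℕ) (Ω : Set (Fin n → ℝ)) (f : (Fin n → ℝ) → ℝ)
    (S : Set (Amb n)) (N : Amb n → Amb n) : Prop where
  isHypersurface : IsHypersurface m S
  isUnitNormal : IsUnitNormal S N
  equation : ∀ X ∈ S, ∃ κ : Fin n → ℝ, HasPrincipalCurvatures S N X κ ∧ κ ∈ Ω ∧
    f κ + (1 / 2) * inner ℝ X (N X) = 0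

/-- The hypersurfaces `S t`, `t ∈ I`, oriented by `N t`, move by the `f` curvature flow
`(∂ₜ X)^⊥ = f(κ) N`: they have a `C¹` family of bijective parametrizations `Φ (t, ·) : M → S t`
whose velocity has normal component `f(κ)`. -/
structure IsCurvatureFlow {n : ℕ} (m : ℕ) (Ω : Set (Fin n → ℝ)) (f : (Fin n → ℝ) → ℝ)
    (I : Set ℝ) (S : ℝ → Set (Amb n)) (N : ℝ → Amb n → Amb n) : Prop where
  isHypersurface : ∀ t ∈ I, IsHypersurface m (S t)
  isUnitNormal : ∀ t ∈ I, IsUnitNormal (S t) (N t)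
  equation : ∃ (M : Set (Amb n)) (Φ : ℝ × Amb n → Amb n), IsHypersurface m M ∧
    ContDiffOn ℝ 1 Φ (I ×ˢ M) ∧
    ∀ t ∈ I, BijOn (fun x => Φ (t, x)) M (S t) ∧
      ∀ x ∈ M, ∃ (V : Amb n) (κ : Fin n → ℝ),
        HasDerivWithinAt (fun τ => Φ (τ, x)) V I t ∧
        HasPrincipalCurvatures (S t) (N t) (Φ (t, x)) κ ∧ κ ∈ Ω ∧
        inner ℝ V (N t (Φ (t, x))) = f κ

/-- `S` is `C^m` asymptotic to the cone `C` at infinity: `ϱ S → C` in `C^m_loc` (away from the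
vertex `0`) as `ϱ ↘ 0`. Around every point `P ≠ 0` (on `C` or not) the sets `C` and `ϱ S` are the
zero sets of functions `g` and `G ϱ`, where `g` has only regular zeros and `G ϱ → g` in `C^m`. -/
def IsAsymptoticTo {n : ℕ} (m : ℕ) (S C : Set (Amb n)) : Prop :=
  ∀ P : Amb n, P ≠ 0 → ∃ (U : Set (Amb n)) (g : Amb n → ℝ) (G : ℝ → Amb n → ℝ),
    IsOpen U ∧ P ∈ U ∧ ContDiffOn ℝ m g U ∧
    (∀ Y ∈ U, g Y = 0 → fderiv ℝ g Y ≠ 0) ∧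
    C ∩ U = {Y | Y ∈ U ∧ g Y = 0} ∧
    (∀ᶠ ϱ in 𝓝[>] (0 : ℝ), ContDiffOn ℝ m (G ϱ) U ∧
      (ϱ • S) ∩ U = {Y | Y ∈ U ∧ G ϱ Y = 0}) ∧
    ∀ j ≤ m, TendstoUniformlyOn (fun ϱ => iteratedFDeriv ℝ j (G ϱ)) (iteratedFDeriv ℝ j g)
      (𝓝[>] (0 : ℝ)) U

/-! ### Hypersurfaces of revolution -/

/-- The hypersurface of revolution `{(r(s) ν, s) | ν ∈ Sⁿ⁻¹, s ∈ J}`. -/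
def revolution (n : ℕ) (r : ℝ → ℝ) (J : Set ℝ) : Set (Amb n) :=
  {X | ∃ ν ∈ Metric.sphere (0 : EuclideanSpace ℝ (Fin n)) 1, ∃ s ∈ J,
    X = point (r s • ν) s}

/-- The cone `{(σ s ν, s) | ν ∈ Sⁿ⁻¹, s > 0}`. -/
def rotCone (n : ℕ) (σ : ℝ) : Set (Amb n) := revolution n (fun s => σ * s) (Ioi 0)

/-- The unit normal `(-ν, r'(s)) / √(1 + r'(s)²)` at the point `(r(s) ν, s)` (`r > 0`), for a radius
function `r` on `[a, ∞)`; here `ν` is recovered from a point `(x, s)` as `x / |x|`. -/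
noncomputable def revNormal {n : ℕ} (r : ℝ → ℝ) (a : ℝ) (X : Amb n) : Amb n :=
  (Real.sqrt (1 + derivWithin r (Ici a) (height X) ^ 2))⁻¹ •
    point (-(‖horizontal X‖⁻¹ • horizontal X)) (derivWithin r (Ici a) (height X))

/-- The radius function `r(s) = σ s + c / (σ s) + u(s)`. -/
noncomputable def radius (σ c : ℝ) (u : ℝ → ℝ) (s : ℝ) : ℝ := σ * s + c / (σ * s) + u s

/-- The rescaled function `u_t(s) = √(-t) u(s / √(-t))`. -/
noncomputable def rescaled (u : ℝ → ℝ) (t s : ℝ) : ℝ := Real.sqrt (-t) * u (s / Real.sqrt (-t))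

/-- `u ∈ C₀^m[a, ∞)`: `u` is `C^m` on `[a, ∞)`, and it tends to zero at infinity together with its
derivatives of order at most `m`. -/
def MemCZero (m : ℕ) (a : ℝ) (u : ℝ → ℝ) : Prop :=
  ContDiffOn ℝ m u (Ici a) ∧
    ∀ j ≤ m, Tendsto (iteratedDerivWithin j u (Ici a)) atTop (𝓝 0)

/-- The weighted norm `‖s^p ∂_s^j u‖_{L^∞[a, ∞)}`. -/
noncomputable def weightedNorm (p j : ℕ) (a : ℝ) (u : ℝ → ℝ) : ℝ≥0∞ :=
  eLpNorm (fun s => s ^ p * iteratedDerivWithin j u (Ici a) s) ∞ (volume.restrict (Ici a))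

/-!
A hypersurface of revolution with radius function `r` has principal curvatures proportional to
`(1, …, 1, y)`, where `y = -r r'' / (1 + r'²)`. Since `f` is homogeneous of degree one, the
self-shrinker equation becomes `F(y) = r (r - s r') / 2` with `F(v) = f(1, …, 1, v)`. In the
variable `x = 1 / s²`, with `Q = r² / s²`, this is the *profile system*

* `Q' = 2 F(y)`,
* `4 x² F'(y) y' = 4 x² F(y)² / Q - 2 x F(y) - (1 + (Q - 2 x F(y))² / Q) y`,

where the second equation is the definition of `y`. The end of the cone is the singular point
`x = 0`, with `Q = σ²` and `y = 0`.

*Existence.* Because `F' > 0`, the coefficient of `y` pushes solutions towards `y = 0` as `x`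
increases, and the lines `y = ± (2 M + 1) x` are barriers on an interval whose length does not
depend on a lower bound for `F'`. The solutions that start from `(σ², 0)` at `x = a` therefore
exist on a common interval (`exists_isBarrierSolution`). Comparing two of them through `F(y)`
rather than `y`, again without a lower bound for `F'`, shows that they differ by `O(a)`
(`IsBarrierSolution.abs_sub_le`), so that they converge as `a ↘ 0`
(`exists_isBarrierSolution_zero`).

*Estimates.* The decay has to be uniform over all `f` with a given upper bound for the derivatives.
The derivative `z = y'` solves an equation `A z + x² B z' = g` with `A ≥ 1 / 2` near the origin and
`B = 4 F'(y) > 0`. The maximum principle gives `|z| ≤ 2 sup |g|` whatever the lower bound of `B`,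
provided that `z` does not grow exponentially in `1 / x` as `x ↘ 0`
(`abs_le_two_mul_of_singular_eq`). That is excluded by a crude polynomial bound, which comes from
bootstrapping the system for each solution separately (`ProfileSolution.reg_polynomiallyBounded`).
Differentiating the equation repeatedly bounds `y` in `C^{k-1}` and `Q` in `C^k`, uniformly in `f`
(`ProfileSolution.reg_Q_uniformlyBounded`). The function `√Q - σ - c x / σ`, which is `u(s) / s`,
vanishes to second order at `x = 0`; in terms of `s` this is the decay
`|u⁽ʲ⁾(s)| ≤ C s^{-(j + 3)}` for `j ≤ k` (`ProfileSolution.exists_remainder_bound`).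

*Geometry.* The shape operator of a hypersurface of revolution is computed along meridians and
parallels (`IsRadius.hasPrincipalCurvatures`). Homotheties act on radius functions by
`r ↦ τ r(· / τ)`, which turns the self-shrinker into a solution of the flow
(`IsRadius.isCurvatureFlow`), the decay of `u` into the weighted estimates
(`IsRemainder.weightedNorm_rescaled_le`), and the decay of `r - σ s` into the convergence to the
cone (`IsRadius.isAsymptoticTo`).
-/

/-! ### A maximum principle for singular first order equations -/

lemma nonneg_of_hasDerivAt_of_isMaxOn_left {φ : ℝ → ℝ} {d a b : ℝ} (hab : a < b)
    (hd : HasDerivAt φ d b) (hmax : ∀ x ∈ Icc a b, φ x ≤ φ b) : 0 ≤ d := by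
  have h := (hasDerivWithinAt_iff_tendsto_slope' (s := Iio b) (by simp)).1
    (hd.hasDerivWithinAt (s := Iio b))
  refine ge_of_tendsto h ?_
  filter_upwards [Ioo_mem_nhdsLT hab] with x hx
  rw [slope_def_field]
  exact div_nonneg_of_nonpos (by linarith [hmax x ⟨hx.1.le, hx.2.le⟩]) (by linarith [hx.2])

lemma tendsto_inv_pow_mul_exp_neg_inv {K : ℝ} (hK : 0 < K) (m : ℕ) :
    Tendsto (fun x : ℝ => (x⁻¹) ^ m * Real.exp (-(K * x)⁻¹)) (𝓝[>] 0) (𝓝 0) := by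
  have h1 : Tendsto (fun x : ℝ => (K * x)⁻¹) (𝓝[>] 0) atTop := by
    have : Tendsto (fun x : ℝ => K⁻¹ * x⁻¹) (𝓝[>] 0) atTop :=
      tendsto_inv_nhdsGT_zero.const_mul_atTop (inv_pos.2 hK)
    simpa [mul_comm] using this
  have h2 := ((Real.tendsto_pow_mul_exp_neg_atTop_nhds_zero m).comp h1).const_mul (K ^ m)
  rw [mul_zero] at h2
  refine h2.congr fun x => ?_
  simp only [Function.comp]
  rw [mul_inv, mul_pow, ← mul_assoc, ← mul_assoc, ← mul_pow, mul_inv_cancel₀ hK.ne', one_pow,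
    one_mul]

/-- The equation `A z + x² B z' = g` contracts towards `g / A` as `x` increases: a solution that
exceeds twice the bound of the right hand side grows like `exp (1 / (2 K x))` as `x ↘ 0`, which
polynomial boundedness excludes. -/
lemma le_two_mul_of_singular_eq {z z' A B g : ℝ → ℝ} {x₁ K G : ℝ} (hx₁ : 0 < x₁)
    (hz : ∀ x ∈ Ioc 0 x₁, HasDerivAt z (z' x) x)
    (heq : ∀ x ∈ Ioc 0 x₁, A x * z x + x ^ 2 * B x * z' x = g x)
    (hA : ∀ x ∈ Ioc 0 x₁, 1 / 2 ≤ A x) (hB : ∀ x ∈ Ioc 0 x₁, 0 < B x ∧ B x ≤ K)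
    (hg : ∀ x ∈ Ioc 0 x₁, |g x| ≤ G) {m : ℕ} {C ε : ℝ} (hε : 0 < ε)
    (hpoly : ∀ x ∈ Ioc 0 x₁, x < ε → |z x| * x ^ m ≤ C) : z x₁ ≤ 2 * G := by
  by_contra! hcon
  have hmem : x₁ ∈ Ioc 0 x₁ := ⟨hx₁, le_rfl⟩
  have hG : 0 ≤ G := (abs_nonneg _).trans (hg x₁ hmem)
  have hK : 0 < K := (hB x₁ hmem).1.trans_le (hB x₁ hmem).2
  set φ : ℝ → ℝ := fun x => (z x - 2 * G) * Real.exp (-(4 * K * x)⁻¹) with hφ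
  have hpos : 0 < φ x₁ := mul_pos (by linarith) (Real.exp_pos _)
  have hderiv : ∀ x ∈ Ioc 0 x₁, HasDerivAt φ
      (z' x * Real.exp (-(4 * K * x)⁻¹) +
        (z x - 2 * G) * (Real.exp (-(4 * K * x)⁻¹) * (4 * K / (4 * K * x) ^ 2))) x := by
    intro x hx
    have hx0 : 4 * K * x ≠ 0 := by have := hx.1; positivity
    have h1 : HasDerivAt (fun x : ℝ => 4 * K * x) (4 * K) x := by
      simpa using (hasDerivAt_id x).const_mul (4 * K)
    have h2 := (h1.fun_inv hx0).neg.exp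
    have h3 := ((hz x hx).sub_const (2 * G)).mul h2
    exact h3.congr_deriv (by rw [neg_div, neg_neg]; rfl)
  have hlim : Tendsto (fun x : ℝ => C * ((x⁻¹) ^ m * Real.exp (-(4 * K * x)⁻¹))) (𝓝[>] 0)
      (𝓝 0) := by
    simpa using (tendsto_inv_pow_mul_exp_neg_inv (K := 4 * K) (by positivity) m).const_mul C
  obtain ⟨x₀, hx₀, hx₀1, hx₀2, hx₀3⟩ : ∃ x₀ : ℝ, 0 < x₀ ∧ x₀ < x₁ ∧ x₀ < ε ∧
      C * ((x₀⁻¹) ^ m * Real.exp (-(4 * K * x₀)⁻¹)) < φ x₁ := by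
    have e1 : ∀ᶠ x in 𝓝[>] (0 : ℝ), x ∈ Ioo 0 x₁ := Ioo_mem_nhdsGT hx₁
    have e2 : ∀ᶠ x in 𝓝[>] (0 : ℝ), x ∈ Ioo 0 ε := Ioo_mem_nhdsGT hε
    obtain ⟨x, h1, h2, h3⟩ := ((hlim.eventually_lt_const hpos).and (e1.and e2)).exists
    exact ⟨x, h2.1, h2.2, h3.2, h1⟩
  have hsub : Icc x₀ x₁ ⊆ Ioc 0 x₁ := fun x hx => ⟨hx₀.trans_le hx.1, hx.2⟩
  have hcont : ContinuousOn φ (Icc x₀ x₁) := fun x hx =>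
    (hderiv x (hsub hx)).continuousAt.continuousWithinAt
  obtain ⟨x₂, hx₂, hmax⟩ := isCompact_Icc.exists_isMaxOn ⟨x₁, hx₀1.le, le_rfl⟩ hcont
  have hφ2 : φ x₁ ≤ φ x₂ := hmax ⟨hx₀1.le, le_rfl⟩
  have hφ0 : φ x₀ < φ x₁ := by
    refine lt_of_le_of_lt ?_ hx₀3
    have h1 := hpoly x₀ ⟨hx₀, hx₀1.le⟩ hx₀2
    have h2 : z x₀ - 2 * G ≤ C * (x₀⁻¹) ^ m := by
      rw [inv_pow, ← div_eq_mul_inv]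
      have := (le_div_iff₀ (pow_pos hx₀ m)).2 h1
      linarith [le_abs_self (z x₀)]
    calc φ x₀ ≤ C * (x₀⁻¹) ^ m * Real.exp (-(4 * K * x₀)⁻¹) :=
          mul_le_mul_of_nonneg_right h2 (Real.exp_pos _).le
      _ = _ := by ring
  have hx02 : x₀ < x₂ := by
    rcases hx₂.1.eq_or_lt with h | h
    · exact absurd (h ▸ hφ2) (not_le.2 hφ0)
    · exact h
  have hd := hderiv x₂ (hsub hx₂)
  have hnn := nonneg_of_hasDerivAt_of_isMaxOn_left hx02 hd
    fun x hx => hmax ⟨hx.1, hx.2.trans hx₂.2⟩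
  have hx2 := hsub hx₂
  have hz2 : 0 < z x₂ - 2 * G := by
    have := hpos.trans_le hφ2
    exact pos_of_mul_pos_left this (Real.exp_pos _).le
  obtain ⟨hBp, hBK⟩ := hB x₂ hx2
  have hx2p : 0 < x₂ := hx2.1
  have e1 : x₂ ^ 2 * B x₂ * z' x₂ ≤ -(z x₂ - 2 * G) / 2 := by
    have h1 := heq x₂ hx2
    have h2 := mul_le_mul_of_nonneg_right (hA x₂ hx2) (by linarith : 0 ≤ z x₂)
    have h3 := (le_abs_self _).trans (hg x₂ hx2)
    linarith
  have e2 : z' x₂ ≤ -(z x₂ - 2 * G) / (2 * K * x₂ ^ 2) := by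
    have h0 : z' x₂ < 0 := by
      by_contra! h
      have : 0 ≤ x₂ ^ 2 * B x₂ * z' x₂ := by positivity
      linarith
    rw [le_div_iff₀ (by positivity)]
    have h5 : x₂ ^ 2 * K * z' x₂ ≤ x₂ ^ 2 * B x₂ * z' x₂ :=
      mul_le_mul_of_nonpos_right (by gcongr) h0.le
    linarith
  have e3 : (z x₂ - 2 * G) * (4 * K / (4 * K * x₂) ^ 2) = (z x₂ - 2 * G) / (4 * K * x₂ ^ 2) := by
    field_simp
  have e4 : z' x₂ + (z x₂ - 2 * G) / (4 * K * x₂ ^ 2) < 0 := by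
    have h1 : -(z x₂ - 2 * G) / (2 * K * x₂ ^ 2) + (z x₂ - 2 * G) / (4 * K * x₂ ^ 2) =
        -((z x₂ - 2 * G) / (4 * K * x₂ ^ 2)) := by
      field_simp
      ring
    have h2 : 0 < (z x₂ - 2 * G) / (4 * K * x₂ ^ 2) := by positivity
    linarith
  have e5 : z' x₂ * Real.exp (-(4 * K * x₂)⁻¹) +
        (z x₂ - 2 * G) * (Real.exp (-(4 * K * x₂)⁻¹) * (4 * K / (4 * K * x₂) ^ 2)) =
      (z' x₂ + (z x₂ - 2 * G) / (4 * K * x₂ ^ 2)) * Real.exp (-(4 * K * x₂)⁻¹) := by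
    rw [← e3]; ring
  rw [e5] at hnn
  exact absurd hnn (not_le.2 (mul_neg_of_neg_of_pos e4 (Real.exp_pos _)))

lemma abs_le_two_mul_of_singular_eq {z z' A B g : ℝ → ℝ} {x₁ K G : ℝ} (hx₁ : 0 < x₁)
    (hz : ∀ x ∈ Ioc 0 x₁, HasDerivAt z (z' x) x)
    (heq : ∀ x ∈ Ioc 0 x₁, A x * z x + x ^ 2 * B x * z' x = g x)
    (hA : ∀ x ∈ Ioc 0 x₁, 1 / 2 ≤ A x) (hB : ∀ x ∈ Ioc 0 x₁, 0 < B x ∧ B x ≤ K)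
    (hg : ∀ x ∈ Ioc 0 x₁, |g x| ≤ G) {m : ℕ} {C ε : ℝ} (hε : 0 < ε)
    (hpoly : ∀ x ∈ Ioc 0 x₁, x < ε → |z x| * x ^ m ≤ C) : |z x₁| ≤ 2 * G := by
  refine abs_le.2 ⟨?_, le_two_mul_of_singular_eq hx₁ hz heq hA hB hg hε hpoly⟩
  have := le_two_mul_of_singular_eq (z := fun x => -z x) (z' := fun x => -z' x)
    (g := fun x => -g x) hx₁ (fun x hx => (hz x hx).neg)
    (fun x hx => by rw [← heq x hx]; ring) hA hB (fun x hx => by rw [abs_neg]; exact hg x hx)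
    hε (fun x hx h => by rw [abs_neg]; exact hpoly x hx h)
  linarith

/-! ### Regularity classes at the origin, for families of functions -/

/-- A class of families `φ i : ℝ → ℝ` of functions on the intervals `(0, X i)` that is closed under
sums, products and domination, and contains the constants and the identity. The two classes in use
are `uniformlyBounded` and `polynomiallyBounded`. -/
structure GrowthClass {ι : Type*} (X : ι → ℝ) where
  carrier : Set (ι → ℝ → ℝ)
  const_mem : ∀ c : ℝ, (fun _ _ => c) ∈ carrier
  id_mem : (fun _ x => x) ∈ carrier
  add_mem : ∀ φ ∈ carrier, ∀ ψ ∈ carrier, (fun i x => φ i x + ψ i x) ∈ carrier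
  mul_mem : ∀ φ ∈ carrier, ∀ ψ ∈ carrier, (fun i x => φ i x * ψ i x) ∈ carrier
  mono : ∀ φ, ∀ ψ ∈ carrier, (∀ i, ∀ x ∈ Ioo 0 (X i), |φ i x| ≤ |ψ i x|) → φ ∈ carrier

/-- The families that are bounded near the origin, on an interval and by a constant that do not
depend on the member of the family. -/
def uniformlyBounded {ι : Type*} (X : ι → ℝ) : GrowthClass X where
  carrier := {φ | ∃ C ε : ℝ, 0 < ε ∧ ∀ i, ∀ x ∈ Ioo 0 (X i), x < ε → |φ i x| ≤ C}
  const_mem c := ⟨|c|, 1, one_pos, fun _ _ _ _ => le_rfl⟩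
  id_mem := ⟨1, 1, one_pos, fun _ x hx h => by rw [abs_of_pos hx.1]; exact h.le⟩
  add_mem := by
    rintro φ ⟨C, ε, hε, h⟩ ψ ⟨C', ε', hε', h'⟩
    exact ⟨C + C', min ε ε', lt_min hε hε', fun i x hx hxe => (abs_add_le _ _).trans
      (add_le_add (h i x hx (hxe.trans_le (min_le_left _ _)))
        (h' i x hx (hxe.trans_le (min_le_right _ _))))⟩
  mul_mem := by
    rintro φ ⟨C, ε, hε, h⟩ ψ ⟨C', ε', hε', h'⟩
    refine ⟨C * C', min ε ε', lt_min hε hε', fun i x hx hxe => ?_⟩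
    rw [abs_mul]
    have h1 := h i x hx (hxe.trans_le (min_le_left _ _))
    exact mul_le_mul h1 (h' i x hx (hxe.trans_le (min_le_right _ _))) (abs_nonneg _)
      ((abs_nonneg _).trans h1)
  mono := by
    rintro φ ψ ⟨C, ε, hε, h⟩ hle
    exact ⟨C, ε, hε, fun i x hx hxe => (hle i x hx).trans (h i x hx hxe)⟩

/-- The families each of whose members grows at most polynomially in `1 / x` at the origin. -/
def polynomiallyBounded {ι : Type*} (X : ι → ℝ) : GrowthClass X where
  carrier := {φ | ∀ i, ∃ (m : ℕ) (C ε : ℝ), 0 < ε ∧ ∀ x ∈ Ioo 0 (X i), x < ε →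
    |φ i x| * x ^ m ≤ C}
  const_mem c := fun _ => ⟨0, |c|, 1, one_pos, fun _ _ _ => by simp⟩
  id_mem := fun _ => ⟨0, 1, 1, one_pos, fun x hx h => by
    rw [abs_of_pos hx.1]; simpa using h.le⟩
  add_mem := by
    intro φ hφ ψ hψ i
    obtain ⟨m, C, ε, hε, h⟩ := hφ i
    obtain ⟨m', C', ε', hε', h'⟩ := hψ i
    refine ⟨m + m', C + C', min (min ε ε') 1, by positivity, fun x hx hxe => ?_⟩
    have hx0 : 0 < x := hx.1
    have hx1 : x ≤ 1 := (hxe.trans_le (min_le_right _ _)).le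
    have h1 := h x hx (hxe.trans_le ((min_le_left _ _).trans (min_le_left _ _)))
    have h2 := h' x hx (hxe.trans_le ((min_le_left _ _).trans (min_le_right _ _)))
    have p1 : x ^ m ≤ 1 := pow_le_one₀ hx0.le hx1
    have p2 : x ^ m' ≤ 1 := pow_le_one₀ hx0.le hx1
    calc |φ i x + ψ i x| * x ^ (m + m') ≤ (|φ i x| + |ψ i x|) * x ^ (m + m') := by
          gcongr; exact abs_add_le _ _
      _ = |φ i x| * x ^ m * x ^ m' + |ψ i x| * x ^ m' * x ^ m := by ring
      _ ≤ |φ i x| * x ^ m * 1 + |ψ i x| * x ^ m' * 1 := by gcongr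
      _ ≤ C + C' := by linarith
  mul_mem := by
    intro φ hφ ψ hψ i
    obtain ⟨m, C, ε, hε, h⟩ := hφ i
    obtain ⟨m', C', ε', hε', h'⟩ := hψ i
    refine ⟨m + m', C * C', min ε ε', by positivity, fun x hx hxe => ?_⟩
    have hx0 : 0 < x := hx.1
    have h1 := h x hx (hxe.trans_le (min_le_left _ _))
    have h2 := h' x hx (hxe.trans_le (min_le_right _ _))
    calc |φ i x * ψ i x| * x ^ (m + m') = (|φ i x| * x ^ m) * (|ψ i x| * x ^ m') := by
          rw [abs_mul]; ring
      _ ≤ C * C' := mul_le_mul h1 h2 (by positivity) (le_trans (by positivity) h1)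
  mono := by
    intro φ ψ hψ hle i
    obtain ⟨m, C, ε, hε, h⟩ := hψ i
    exact ⟨m, C, ε, hε, fun x hx hxe => (mul_le_mul_of_nonneg_right (hle i x hx)
      (pow_nonneg hx.1.le _)).trans (h x hx hxe)⟩

section

variable {ι : Type*} {X : ι → ℝ}

lemma GrowthClass.congr (𝒜 : GrowthClass X) {φ ψ : ι → ℝ → ℝ} (h : ψ ∈ 𝒜.carrier)
    (he : ∀ i, ∀ x ∈ Ioo 0 (X i), φ i x = ψ i x) : φ ∈ 𝒜.carrier :=
  𝒜.mono φ ψ h fun i x hx => by rw [he i x hx]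

lemma GrowthClass.of_abs_le (𝒜 : GrowthClass X) {φ : ι → ℝ → ℝ} (C : ℝ)
    (h : ∀ i, ∀ x ∈ Ioo 0 (X i), |φ i x| ≤ C) : φ ∈ 𝒜.carrier :=
  𝒜.mono φ _ (𝒜.const_mem C) fun i x hx => (h i x hx).trans (le_abs_self _)

/-- The families that are `N` times differentiable on `(0, X i)`, with all derivatives up to order
`N` in the class `𝒜`. -/
def Reg (𝒜 : GrowthClass X) : ℕ → (ι → ℝ → ℝ) → Prop
  | 0, φ => φ ∈ 𝒜.carrier
  | N + 1, φ => φ ∈ 𝒜.carrier ∧ (∀ i, ∀ x ∈ Ioo 0 (X i), DifferentiableAt ℝ (φ i) x) ∧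
      Reg 𝒜 N (fun i => deriv (φ i))

namespace Reg

variable {𝒜 : GrowthClass X} {N : ℕ} {φ ψ φ' : ι → ℝ → ℝ}

lemma mem (h : Reg 𝒜 N φ) : φ ∈ 𝒜.carrier := by
  cases N with
  | zero => exact h
  | succ N => exact h.1

lemma congr (h : Reg 𝒜 N ψ) (he : ∀ i, ∀ x ∈ Ioo 0 (X i), φ i x = ψ i x) : Reg 𝒜 N φ := by
  induction N generalizing φ ψ with
  | zero => exact 𝒜.congr h he
  | succ N ih =>
    have hev : ∀ i, ∀ x ∈ Ioo 0 (X i), φ i =ᶠ[𝓝 x] ψ i := fun i x hx => by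
      filter_upwards [isOpen_Ioo.mem_nhds hx] with t ht using he i t ht
    exact ⟨𝒜.congr h.1 he, fun i x hx => (h.2.1 i x hx).congr_of_eventuallyEq (hev i x hx),
      ih h.2.2 fun i x hx => (hev i x hx).deriv_eq⟩

lemma of_hasDerivAt (h : φ ∈ 𝒜.carrier)
    (hd : ∀ i, ∀ x ∈ Ioo 0 (X i), HasDerivAt (φ i) (φ' i x) x) (h' : Reg 𝒜 N φ') :
    Reg 𝒜 (N + 1) φ :=
  ⟨h, fun i x hx => (hd i x hx).differentiableAt, h'.congr fun i x hx => (hd i x hx).deriv⟩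

lemma hasDerivAt (h : Reg 𝒜 (N + 1) φ) {i : ι} {x : ℝ} (hx : x ∈ Ioo 0 (X i)) :
    HasDerivAt (φ i) (deriv (φ i) x) x := (h.2.1 i x hx).hasDerivAt

lemma pred (h : Reg 𝒜 (N + 1) φ) : Reg 𝒜 N φ := by
  induction N generalizing φ with
  | zero => exact h.1
  | succ N ih => exact ⟨h.1, h.2.1, ih h.2.2⟩

lemma of_le {M : ℕ} (hMN : M ≤ N) (h : Reg 𝒜 N φ) : Reg 𝒜 M φ := by
  induction hMN with
  | refl => exact h
  | step _ ih => exact ih h.pred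

lemma const (c : ℝ) : Reg 𝒜 N (fun _ _ => c) := by
  induction N generalizing c with
  | zero => exact 𝒜.const_mem c
  | succ N ih => exact of_hasDerivAt (𝒜.const_mem c) (fun i x _ => hasDerivAt_const x c) (ih 0)

lemma const_family {c : ι → ℝ} {C : ℝ} (hc : ∀ i, |c i| ≤ C) : Reg 𝒜 N (fun i _ => c i) := by
  have h : (fun i (_ : ℝ) => c i) ∈ 𝒜.carrier := 𝒜.of_abs_le C fun i _ _ => hc i
  cases N with
  | zero => exact h
  | succ N => exact of_hasDerivAt h (fun i x _ => hasDerivAt_const x (c i)) (const 0)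

lemma id : Reg 𝒜 N (fun _ x => x) := by
  cases N with
  | zero => exact 𝒜.id_mem
  | succ N => exact of_hasDerivAt 𝒜.id_mem (fun i x _ => hasDerivAt_id x) (const 1)

lemma add (h : Reg 𝒜 N φ) (h' : Reg 𝒜 N ψ) : Reg 𝒜 N (fun i x => φ i x + ψ i x) := by
  induction N generalizing φ ψ with
  | zero => exact 𝒜.add_mem _ h _ h'
  | succ N ih =>
    exact of_hasDerivAt (𝒜.add_mem _ h.1 _ h'.1)
      (fun i x hx => (h.hasDerivAt hx).add (h'.hasDerivAt hx)) (ih h.2.2 h'.2.2)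

lemma mul (h : Reg 𝒜 N φ) (h' : Reg 𝒜 N ψ) : Reg 𝒜 N (fun i x => φ i x * ψ i x) := by
  induction N generalizing φ ψ with
  | zero => exact 𝒜.mul_mem _ h _ h'
  | succ N ih =>
    exact of_hasDerivAt (𝒜.mul_mem _ h.1 _ h'.1)
      (fun i x hx => (h.hasDerivAt hx).mul (h'.hasDerivAt hx))
      ((ih h.2.2 h'.pred).add (ih h.pred h'.2.2))

lemma neg (h : Reg 𝒜 N φ) : Reg 𝒜 N (fun i x => -φ i x) :=
  ((const (-1)).mul h).congr fun i x _ => by ring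

lemma sub (h : Reg 𝒜 N φ) (h' : Reg 𝒜 N ψ) : Reg 𝒜 N (fun i x => φ i x - ψ i x) :=
  (h.add h'.neg).congr fun i x _ => by ring

lemma pow (h : Reg 𝒜 N φ) (m : ℕ) : Reg 𝒜 N (fun i x => φ i x ^ m) := by
  induction m with
  | zero => simpa using const 1
  | succ m ih => simpa only [pow_succ] using ih.mul h

lemma inv (h : Reg 𝒜 N φ) (h0 : ∀ i, ∀ x ∈ Ioo 0 (X i), φ i x ≠ 0)
    (hinv : (fun i x => (φ i x)⁻¹) ∈ 𝒜.carrier) : Reg 𝒜 N (fun i x => (φ i x)⁻¹) := by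
  induction N generalizing φ with
  | zero => exact hinv
  | succ N ih =>
    refine of_hasDerivAt hinv (fun i x hx => (h.hasDerivAt hx).fun_inv (h0 i x hx)) ?_
    exact (h.2.2.neg.mul ((ih h.pred h0 hinv).pow 2)).congr fun i x _ => by
      rw [div_eq_mul_inv, inv_pow]

/-- The square root of a family bounded from below by a positive constant. -/
lemma sqrt (h : Reg 𝒜 N φ) {q : ℝ} (hq : 0 < q) (h0 : ∀ i, ∀ x ∈ Ioo 0 (X i), q ≤ φ i x) :
    Reg 𝒜 N (fun i x => √(φ i x)) := by
  have hmem : (fun i x => √(φ i x)) ∈ 𝒜.carrier := by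
    refine 𝒜.mono _ _ (𝒜.add_mem _ (𝒜.const_mem 1) _ h.mem) fun i x hx => ?_
    have h1 := h0 i x hx
    rw [abs_of_nonneg (Real.sqrt_nonneg _), abs_of_nonneg (by linarith)]
    nlinarith [Real.sq_sqrt (hq.le.trans h1), Real.sqrt_nonneg (φ i x), sq_nonneg (√(φ i x) - 1)]
  induction N with
  | zero => exact hmem
  | succ N ih =>
    refine of_hasDerivAt hmem (fun i x hx =>
      (h.hasDerivAt hx).sqrt (hq.trans_le (h0 i x hx)).ne') ?_
    have hinv : Reg 𝒜 N (fun i x => (√(φ i x))⁻¹) := by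
      refine (ih h.pred).inv (fun i x hx => (Real.sqrt_pos.2 (hq.trans_le (h0 i x hx))).ne') ?_
      refine 𝒜.of_abs_le (√q)⁻¹ fun i x hx => ?_
      rw [abs_of_nonneg (by positivity)]
      exact inv_anti₀ (Real.sqrt_pos.2 hq) (Real.sqrt_le_sqrt (h0 i x hx))
    exact ((h.2.2.mul hinv).mul (const (1 / 2))).congr fun i x _ => by
      rw [div_eq_mul_inv, mul_inv]; ring

/-- The chain rule: `F` stands for a family of functions together with its derivatives
`F 0, F 1, …`, along a family `y` of arguments. -/
lemma comp {F : ℕ → ι → ℝ → ℝ} {k j : ℕ} {y : ι → ℝ → ℝ} (hjN : j + N ≤ k)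
    (hF : ∀ l, l < k → ∀ i, ∀ x ∈ Ioo 0 (X i), HasDerivAt (F l i) (F (l + 1) i (y i x)) (y i x))
    (hb : ∀ l, l ≤ k → (fun i x => F l i (y i x)) ∈ 𝒜.carrier) (hy : Reg 𝒜 N y) :
    Reg 𝒜 N (fun i x => F j i (y i x)) := by
  induction N generalizing j with
  | zero => exact hb j (by omega)
  | succ N ih =>
    exact of_hasDerivAt (hb j (by omega))
      (fun i x hx => (hF j (by omega) i x hx).comp x (hy.hasDerivAt hx))
      ((ih (j := j + 1) (by omega) hy.pred).mul hy.2.2)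

end Reg

end

/-! ### Uniform estimates for singular equations -/

section

variable {ι : Type*} {X : ι → ℝ}

/-- A bound for the solutions of singular Riccati equations that is uniform in the family, although
`B` has no uniform lower bound. The hypothesis `hz0` makes the quadratic term small near the origin,
and the bound that follows keeps it small. -/
lemma uniformlyBounded_of_riccati {z z' Λ α β B g : ι → ℝ → ℝ}
    (hz : ∀ i, ∀ x ∈ Ioo 0 (X i), HasDerivAt (z i) (z' i x) x)
    (heq : ∀ i, ∀ x ∈ Ioo 0 (X i),
      (Λ i x + x * α i x + x ^ 2 * β i x * z i x) * z i x + x ^ 2 * B i x * z' i x = g i x)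
    (hΛ : ∀ i, ∀ x ∈ Ioo 0 (X i), 1 ≤ Λ i x) (hB : ∀ i, ∀ x ∈ Ioo 0 (X i), 0 < B i x)
    (hα : α ∈ (uniformlyBounded X).carrier) (hβ : β ∈ (uniformlyBounded X).carrier)
    (hBb : B ∈ (uniformlyBounded X).carrier) (hg : g ∈ (uniformlyBounded X).carrier)
    (hzp : z ∈ (polynomiallyBounded X).carrier)
    (hz0 : ∀ i, ∃ D : ℝ, ∀ x ∈ Ioo 0 (X i), x ^ 2 * |z i x| ≤ D * x) :
    z ∈ (uniformlyBounded X).carrier := by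
  obtain ⟨a, ε₁, hε₁, ha⟩ := hα
  obtain ⟨b, ε₂, hε₂, hb⟩ := hβ
  obtain ⟨K, ε₃, hε₃, hK⟩ := hBb
  obtain ⟨G, ε₄, hε₄, hG⟩ := hg
  -- all bounds hold below `ε`, and there the perturbation of `Λ` is at most `1 / 2` as long as
  -- `|z| ≤ 2 |G| + 1`
  obtain ⟨ε, hε, h1, h2, h3, h4, hεa, hεb⟩ : ∃ ε : ℝ, 0 < ε ∧ ε ≤ ε₁ ∧ ε ≤ ε₂ ∧ ε ≤ ε₃ ∧ ε ≤ ε₄ ∧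
      ε * |a| ≤ 1 / 4 ∧ ε ^ 2 * |b| * (2 * |G| + 1) ≤ 1 / 4 := by
    set D := 1 + 4 * |a| + 4 * |b| * (2 * |G| + 1) with hD
    have hD1 : 1 ≤ D := by
      have : 0 ≤ |b| * (2 * |G| + 1) := by positivity
      have := abs_nonneg a
      linarith
    refine ⟨min (min (min ε₁ ε₂) (min ε₃ ε₄)) D⁻¹, by positivity, ?_, ?_, ?_, ?_, ?_, ?_⟩
    · exact (min_le_left _ _).trans ((min_le_left _ _).trans (min_le_left _ _))
    · exact (min_le_left _ _).trans ((min_le_left _ _).trans (min_le_right _ _))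
    · exact (min_le_left _ _).trans ((min_le_right _ _).trans (min_le_left _ _))
    · exact (min_le_left _ _).trans ((min_le_right _ _).trans (min_le_right _ _))
    · calc _ ≤ D⁻¹ * |a| := by gcongr; exact min_le_right _ _
        _ ≤ 1 / 4 := by
          rw [inv_mul_le_iff₀ (by linarith)]
          have : 0 ≤ |b| * (2 * |G| + 1) := by positivity
          linarith
    · have hD2 : D⁻¹ ≤ 1 := inv_le_one_of_one_le₀ hD1
      calc _ ≤ (D⁻¹) ^ 2 * |b| * (2 * |G| + 1) := by gcongr; exact min_le_right _ _
        _ = D⁻¹ * (D⁻¹ * (|b| * (2 * |G| + 1))) := by ring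
        _ ≤ 1 * (D⁻¹ * (|b| * (2 * |G| + 1))) := by gcongr
        _ ≤ 1 / 4 := by
          rw [one_mul, inv_mul_le_iff₀ (by linarith)]
          have := abs_nonneg a
          linarith
  refine ⟨2 * |G| + 1, ε, hε, fun i x₁ hx₁ hx₁ε => ?_⟩
  have key : ∀ x₁ ∈ Ioo 0 (X i), x₁ < ε →
      (∀ x ∈ Ioc 0 x₁, x ^ 2 * |β i x| * |z i x| ≤ 1 / 4) → |z i x₁| ≤ 2 * |G| := by
    intro x₁ hx₁ hx₁ε hsmall
    have hsub : ∀ x ∈ Ioc 0 x₁, x ∈ Ioo 0 (X i) ∧ x < ε := fun x hx =>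
      ⟨⟨hx.1, hx.2.trans_lt hx₁.2⟩, hx.2.trans_lt hx₁ε⟩
    obtain ⟨m, C, η, hη, hp⟩ := hzp i
    refine abs_le_two_mul_of_singular_eq (z' := z' i) (B := B i) (g := g i) (K := |K|)
      (A := fun x => Λ i x + x * α i x + x ^ 2 * β i x * z i x) hx₁.1
      (fun x hx => hz i x (hsub x hx).1) (fun x hx => heq i x (hsub x hx).1) ?_ ?_ ?_ hη
      (m := m) (C := C) (fun x hx hxη => hp x (hsub x hx).1 hxη)
    · intro x hx
      obtain ⟨hx1, hx2⟩ := hsub x hx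
      have e1 := hΛ i x hx1
      have e2 : |x * α i x| ≤ 1 / 4 := by
        rw [abs_mul, abs_of_pos hx.1]
        calc x * |α i x| ≤ ε * |a| := by
              have := (ha i x hx1 (hx2.trans_le h1)).trans (le_abs_self a)
              have := hx.1.le
              gcongr
          _ ≤ 1 / 4 := hεa
      have e3 : |x ^ 2 * β i x * z i x| ≤ 1 / 4 := by
        rw [abs_mul, abs_mul, abs_of_nonneg (sq_nonneg x)]
        exact hsmall x hx
      have := neg_abs_le (x * α i x)
      have := neg_abs_le (x ^ 2 * β i x * z i x)
      linarith
    · intro x hx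
      obtain ⟨hx1, hx2⟩ := hsub x hx
      exact ⟨hB i x hx1, (le_abs_self _).trans
        ((hK i x hx1 (hx2.trans_le h3)).trans (le_abs_self K))⟩
    · intro x hx
      obtain ⟨hx1, hx2⟩ := hsub x hx
      exact (hG i x hx1 (hx2.trans_le h4)).trans (le_abs_self G)
  have hbx : ∀ x ∈ Ioo 0 (X i), x < ε → |β i x| ≤ |b| := fun x hx hxε =>
    (hb i x hx (hxε.trans_le h2)).trans (le_abs_self b)
  obtain ⟨D, hD⟩ := hz0 i
  -- near the origin the bound holds because `x² z → 0`; the first point where it fails is excluded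
  -- by the maximum principle
  obtain ⟨η, hη, hηs⟩ : ∃ η : ℝ, 0 < η ∧ ∀ x ∈ Ioo 0 (X i), x < ε → x < η →
      x ^ 2 * |β i x| * |z i x| ≤ 1 / 4 := by
    refine ⟨(4 * (|b| * |D| + 1))⁻¹, by positivity, fun x hx hxε hxη => ?_⟩
    have e1 : x * (4 * (|b| * |D| + 1)) ≤ 1 := by
      rw [← le_div_iff₀ (by positivity), one_div]; exact hxη.le
    calc x ^ 2 * |β i x| * |z i x| = |β i x| * (x ^ 2 * |z i x|) := by ring
      _ ≤ |b| * (D * x) := mul_le_mul (hbx x hx hxε) (hD x hx)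
            (by positivity) (abs_nonneg b)
      _ ≤ |b| * (|D| * x) := by
            have := hx.1.le
            gcongr; exact le_abs_self D
      _ ≤ 1 / 4 := by nlinarith [hx.1]
  by_contra! hcon
  set S : Set ℝ := {x ∈ Icc (min η x₁ / 2) x₁ | 2 * |G| + 1 ≤ |z i x|} with hS
  have hm : 0 < min η x₁ := lt_min hη hx₁.1
  have hsubI : ∀ x ∈ Icc (min η x₁ / 2) x₁, x ∈ Ioo 0 (X i) ∧ x < ε := fun x hx =>
    ⟨⟨(by linarith [hx.1] : 0 < x), hx.2.trans_lt hx₁.2⟩, hx.2.trans_lt hx₁ε⟩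
  have hScomp : IsCompact S := by
    refine isCompact_Icc.of_isClosed_subset ?_ (fun x hx => hx.1)
    have hc : ContinuousOn (fun x => |z i x|) (Icc (min η x₁ / 2) x₁) := fun x hx =>
      (hz i x (hsubI x hx).1).continuousAt.abs.continuousWithinAt
    exact hc.preimage_isClosed_of_isClosed isClosed_Icc isClosed_Ici
  have hSne : S.Nonempty := ⟨x₁, ⟨by linarith [min_le_right η x₁, hx₁.1], le_rfl⟩, hcon.le⟩
  obtain ⟨x₂, hx₂, hmin⟩ := hScomp.exists_isLeast hSne
  obtain ⟨hx₂X, hx₂ε⟩ := hsubI x₂ hx₂.1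
  have hlt : ∀ x ∈ Ioo 0 x₂, x ^ 2 * |β i x| * |z i x| ≤ 1 / 4 := by
    intro x hx
    have hxX : x ∈ Ioo 0 (X i) := ⟨hx.1, hx.2.trans hx₂X.2⟩
    by_cases hxη : x < η
    · exact hηs x hxX (hx.2.trans hx₂ε) hxη
    · have hxz : |z i x| ≤ 2 * |G| + 1 := by
        by_contra! h
        have : x₂ ≤ x := hmin ⟨⟨by linarith [min_le_left η x₁], hx.2.le.trans hx₂.1.2⟩, h.le⟩
        linarith [hx.2]
      calc x ^ 2 * |β i x| * |z i x| ≤ ε ^ 2 * |b| * (2 * |G| + 1) := by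
            have := hx.1.le
            have := (hx.2.trans hx₂ε).le
            have := hbx x hxX (hx.2.trans hx₂ε)
            gcongr
        _ ≤ 1 / 4 := hεb
  have hlt2 : ∀ x ∈ Ioo 0 x₂, |z i x| ≤ 2 * |G| := fun x hx =>
    key x ⟨hx.1, hx.2.trans hx₂X.2⟩ (hx.2.trans hx₂ε)
      fun t ht => hlt t ⟨ht.1, ht.2.trans_lt hx.2⟩
  have hle : |z i x₂| ≤ 2 * |G| := by
    have hc : Tendsto (fun x => |z i x|) (𝓝[<] x₂) (𝓝 |z i x₂|) :=
      (hz i x₂ hx₂X).continuousAt.abs.continuousWithinAt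
    refine le_of_tendsto hc ?_
    filter_upwards [Ioo_mem_nhdsLT hx₂X.1] with x hx using hlt2 x hx
  linarith [hx₂.2]

/-- The linear case, which needs no initial smallness of `x² z`. -/
lemma uniformlyBounded_of_linear {z z' Λ α B g : ι → ℝ → ℝ}
    (hz : ∀ i, ∀ x ∈ Ioo 0 (X i), HasDerivAt (z i) (z' i x) x)
    (heq : ∀ i, ∀ x ∈ Ioo 0 (X i),
      (Λ i x + x * α i x) * z i x + x ^ 2 * B i x * z' i x = g i x)
    (hΛ : ∀ i, ∀ x ∈ Ioo 0 (X i), 1 ≤ Λ i x) (hB : ∀ i, ∀ x ∈ Ioo 0 (X i), 0 < B i x)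
    (hα : α ∈ (uniformlyBounded X).carrier)
    (hBb : B ∈ (uniformlyBounded X).carrier) (hg : g ∈ (uniformlyBounded X).carrier)
    (hzp : z ∈ (polynomiallyBounded X).carrier) :
    z ∈ (uniformlyBounded X).carrier := by
  obtain ⟨a, ε₁, hε₁, ha⟩ := hα
  obtain ⟨K, ε₃, hε₃, hK⟩ := hBb
  obtain ⟨G, ε₄, hε₄, hG⟩ := hg
  refine ⟨2 * |G|, min (min ε₁ (2 * (|a| + 1))⁻¹) (min ε₃ ε₄), by positivity,
    fun i x₁ hx₁ hx₁ε => ?_⟩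
  obtain ⟨m, C, η, hη, hp⟩ := hzp i
  have hsub : ∀ x ∈ Ioc 0 x₁, x ∈ Ioo 0 (X i) := fun x hx => ⟨hx.1, hx.2.trans_lt hx₁.2⟩
  refine abs_le_two_mul_of_singular_eq (z' := z' i) (B := B i) (g := g i) (K := |K|)
      (A := fun x => Λ i x + x * α i x) hx₁.1
      (fun x hx => hz i x (hsub x hx)) (fun x hx => heq i x (hsub x hx)) ?_ ?_ ?_ hη
      (m := m) (C := C) (fun x hx hxη => hp x (hsub x hx) hxη)
  · intro x hx
    have hxe := hx.2.trans_lt hx₁ε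
    have e1 := hΛ i x (hsub x hx)
    have e2 := (ha i x (hsub x hx) (hxe.trans_le ((min_le_left _ _).trans (min_le_left _ _)))).trans
      (le_abs_self a)
    have e3 : x * (2 * (|a| + 1)) ≤ 1 := by
      rw [← le_div_iff₀ (by positivity), one_div]
      exact (hxe.trans_le ((min_le_left _ _).trans (min_le_right _ _))).le
    have e4 : |x * α i x| ≤ 1 / 2 := by
      rw [abs_mul, abs_of_pos hx.1]
      nlinarith [hx.1]
    linarith [neg_abs_le (x * α i x)]
  · intro x hx
    exact ⟨hB i x (hsub x hx), (le_abs_self _).trans ((hK i x (hsub x hx)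
      ((hx.2.trans_lt hx₁ε).trans_le ((min_le_right _ _).trans (min_le_left _ _)))).trans
        (le_abs_self K))⟩
  · intro x hx
    exact (hG i x (hsub x hx)
      ((hx.2.trans_lt hx₁ε).trans_le ((min_le_right _ _).trans (min_le_right _ _)))).trans
        (le_abs_self G)

/-- Differentiating a singular linear equation gives an equation of the same form for the
derivative, with the same leading coefficients `Λ` and `B`. -/
lemma reg_of_linear {N : ℕ} {z Λ α B g : ι → ℝ → ℝ}
    (heq : ∀ i, ∀ x ∈ Ioo 0 (X i),
      (Λ i x + x * α i x) * z i x + x ^ 2 * B i x * deriv (z i) x = g i x)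
    (hΛ : ∀ i, ∀ x ∈ Ioo 0 (X i), 1 ≤ Λ i x) (hB : ∀ i, ∀ x ∈ Ioo 0 (X i), 0 < B i x)
    (hΛr : Reg (uniformlyBounded X) N Λ) (hα : Reg (uniformlyBounded X) N α)
    (hBr : Reg (uniformlyBounded X) N B) (hg : Reg (uniformlyBounded X) N g)
    (hzp : Reg (polynomiallyBounded X) (N + 1) z) : Reg (uniformlyBounded X) N z := by
  induction N generalizing z α g with
  | zero =>
    exact uniformlyBounded_of_linear (fun i x hx => hzp.hasDerivAt hx) heq hΛ hB hα hBr hg hzp.mem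
  | succ N ih =>
    have hz := ih heq hΛr.pred hα.pred hBr.pred hg.pred hzp.pred
    refine ⟨hz.mem, hzp.2.1, ih (z := fun i => deriv (z i))
      (α := fun i x => α i x + 2 * B i x + x * deriv (B i) x)
      (g := fun i x => deriv (g i) x - (deriv (Λ i) x + α i x + x * deriv (α i) x) * z i x)
      ?_ hΛr.pred ?_ hBr.pred ?_ hzp.2.2⟩
    · intro i x hx
      have hev : (fun x => (Λ i x + x * α i x) * z i x + x ^ 2 * B i x * deriv (z i) x)
          =ᶠ[𝓝 x] g i := by
        filter_upwards [isOpen_Ioo.mem_nhds hx] with t ht using heq i t ht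
      have h1 := (((hΛr.hasDerivAt hx).add ((hasDerivAt_id x).mul (hα.hasDerivAt hx))).mul
        (hzp.hasDerivAt hx)).add ((((hasDerivAt_id x).pow 2).mul (hBr.hasDerivAt hx)).mul
          (hzp.2.2.hasDerivAt hx))
      have h2 := h1.unique ((hg.hasDerivAt hx).congr_of_eventuallyEq hev)
      rw [← h2]
      simp
      ring
    · exact (hα.pred.add ((Reg.const 2).mul hBr.pred)).add (Reg.id.mul hBr.2.2)
    · exact hg.2.2.sub (((hΛr.2.2.add hα.pred).add (Reg.id.mul hα.2.2)).mul hz)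

/-- Once `z` is bounded, the derivative of a Riccati equation is a linear equation for `z'`. -/
lemma reg_of_riccati {N : ℕ} {z Λ α β B g : ι → ℝ → ℝ}
    (heq : ∀ i, ∀ x ∈ Ioo 0 (X i), (Λ i x + x * α i x + x ^ 2 * β i x * z i x) * z i x +
      x ^ 2 * B i x * deriv (z i) x = g i x)
    (hΛ : ∀ i, ∀ x ∈ Ioo 0 (X i), 1 ≤ Λ i x) (hB : ∀ i, ∀ x ∈ Ioo 0 (X i), 0 < B i x)
    (hΛr : Reg (uniformlyBounded X) N Λ) (hα : Reg (uniformlyBounded X) N α)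
    (hβ : Reg (uniformlyBounded X) N β)
    (hBr : Reg (uniformlyBounded X) N B) (hg : Reg (uniformlyBounded X) N g)
    (hzp : Reg (polynomiallyBounded X) (N + 1) z)
    (hz0 : ∀ i, ∃ D : ℝ, ∀ x ∈ Ioo 0 (X i), x ^ 2 * |z i x| ≤ D * x) :
    Reg (uniformlyBounded X) N z := by
  induction N with
  | zero =>
    exact uniformlyBounded_of_riccati (fun i x hx => hzp.hasDerivAt hx) heq hΛ hB hα hβ hBr hg
      hzp.mem hz0
  | succ N ih =>
    have hz := ih hΛr.pred hα.pred hβ.pred hBr.pred hg.pred hzp.pred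
    refine ⟨hz.mem, hzp.2.1, reg_of_linear (z := fun i => deriv (z i)) (Λ := Λ) (B := B)
      (α := fun i x => α i x + 2 * x * β i x * z i x + 2 * B i x + x * deriv (B i) x)
      (g := fun i x => deriv (g i) x - (deriv (Λ i) x + α i x + x * deriv (α i) x +
        2 * x * β i x * z i x + x ^ 2 * deriv (β i) x * z i x) * z i x)
      ?_ hΛ hB hΛr.pred ?_ hBr.pred ?_ hzp.2.2⟩
    · intro i x hx
      have hev : (fun x => (Λ i x + x * α i x + x ^ 2 * β i x * z i x) * z i x +
          x ^ 2 * B i x * deriv (z i) x) =ᶠ[𝓝 x] g i := by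
        filter_upwards [isOpen_Ioo.mem_nhds hx] with t ht using heq i t ht
      have h1 := ((((hΛr.hasDerivAt hx).add ((hasDerivAt_id x).mul (hα.hasDerivAt hx))).add
        ((((hasDerivAt_id x).pow 2).mul (hβ.hasDerivAt hx)).mul (hzp.hasDerivAt hx))).mul
        (hzp.hasDerivAt hx)).add ((((hasDerivAt_id x).pow 2).mul (hBr.hasDerivAt hx)).mul
          (hzp.2.2.hasDerivAt hx))
      have h2 := h1.unique ((hg.hasDerivAt hx).congr_of_eventuallyEq hev)
      rw [← h2]
      simp
      ring
    · exact ((hα.pred.add ((((Reg.const 2).mul Reg.id).mul hβ.pred).mul hz)).add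
        ((Reg.const 2).mul hBr.pred)).add (Reg.id.mul hBr.2.2)
    · exact hg.2.2.sub (((((hΛr.2.2.add hα.pred).add (Reg.id.mul hα.2.2)).add
        ((((Reg.const 2).mul Reg.id).mul hβ.pred).mul hz)).add
        (((Reg.id.pow 2).mul hβ.2.2).mul hz)).mul hz)

end

/-! ### The profile system -/

/-- The slope of `y` in the profile system at the point `x`, for the values `Q` and `y` of the
unknowns, and the values `p = F(y)` and `F₁ = F'(y)`. -/
noncomputable def profileSlope (x Q y p F₁ : ℝ) : ℝ :=
  (4 * x ^ 2 * p ^ 2 / Q - 2 * x * p - (1 + (Q - 2 * x * p) ^ 2 / Q) * y) / (4 * x ^ 2 * F₁)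

/-- A solution of the profile system on `(0, X)`. For a hypersurface of revolution with radius
function `r`, the unknowns are `Q = r² / s²` and `y = -r r'' / (1 + r'²)` as functions of
`x = 1 / s²`, and the self-shrinker equation is `Q' = 2 F(y)` together with the equation
`4 x² F'(y) y' = 4 x² F(y)² / Q - 2 x F(y) - (1 + r'²) y`, where `r' ² = (Q - 2 x F(y))² / Q`.
The sequence `F` lists the function `F 0` and its derivatives up to order `k`, all of them bounded
by `M`; no lower bound for `F'` that is uniform in the solution is required. -/
structure ProfileSolution (σ M : ℝ) (k : ℕ) where
  /-- The end of the interval of existence. -/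
  X : ℝ
  /-- The size of the domain of `F`. -/
  δ : ℝ
  /-- The function `F` and its derivatives. -/
  F : ℕ → ℝ → ℝ
  /-- The scaled curvature `y` of the profile curve. -/
  y : ℝ → ℝ
  /-- The squared slope `Q = r² / s²`. -/
  Q : ℝ → ℝ
  X_pos : 0 < X
  δ_pos : 0 < δ
  hasDerivAt_F : ∀ l < k, ∀ v, |v| < δ → HasDerivAt (F l) (F (l + 1) v) v
  abs_F_le : ∀ l ≤ k, ∀ v, |v| < δ → |F l v| ≤ M
  F_one_bound : ∃ η > 0, ∀ x ∈ Ioo 0 X, η ≤ F 1 (y x)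
  abs_y_lt : ∀ x ∈ Ioo 0 X, |y x| < δ
  abs_y_le_one : ∀ x ∈ Ioo 0 X, |y x| ≤ 1
  abs_y_le : ∃ A : ℝ, ∀ x ∈ Ioo 0 X, |y x| ≤ A * x
  le_Q : ∀ x ∈ Ioo 0 X, σ ^ 2 / 2 ≤ Q x
  abs_Q_le : ∃ A : ℝ, ∀ x ∈ Ioo 0 X, |Q x - σ ^ 2| ≤ A * x
  hasDerivAt_Q : ∀ x ∈ Ioo 0 X, HasDerivAt Q (2 * F 0 (y x)) x
  hasDerivAt_y : ∀ x ∈ Ioo 0 X,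
    HasDerivAt y (profileSlope x (Q x) (y x) (F 0 (y x)) (F 1 (y x))) x

namespace ProfileSolution

variable {σ M : ℝ} {k : ℕ}

lemma Q_pos (hσ : 0 < σ) (i : ProfileSolution σ M k) {x : ℝ} (hx : x ∈ Ioo 0 i.X) : 0 < i.Q x :=
  lt_of_lt_of_le (by positivity) (i.le_Q x hx)

lemma F_one_pos (i : ProfileSolution σ M k) {x : ℝ} (hx : x ∈ Ioo 0 i.X) : 0 < i.F 1 (i.y x) := by
  obtain ⟨η, hη, h⟩ := i.F_one_bound
  exact hη.trans_le (h x hx)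

/-- The families of the functions `F l ∘ y`, over all solutions of the profile system. -/
def Fy (l : ℕ) (i : ProfileSolution σ M k) (x : ℝ) : ℝ := i.F l (i.y x)

lemma reg_Fy (𝒜 : GrowthClass (X : ProfileSolution σ M k → ℝ)) {N j : ℕ} (hjN : j + N ≤ k)
    (hy : Reg 𝒜 N (y : ProfileSolution σ M k → ℝ → ℝ)) : Reg 𝒜 N (Fy (σ := σ) (M := M) j) :=
  Reg.comp (F := fun l i => i.F l) hjN
    (fun l hl i x hx => i.hasDerivAt_F l hl _ (i.abs_y_lt x hx))
    (fun l hl => 𝒜.of_abs_le M fun i x hx => i.abs_F_le l hl _ (i.abs_y_lt x hx)) hy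

lemma reg_inv_Q (hσ : 0 < σ) (𝒜 : GrowthClass (X : ProfileSolution σ M k → ℝ)) {N : ℕ}
    (hQ : Reg 𝒜 N (Q : ProfileSolution σ M k → ℝ → ℝ)) :
    Reg 𝒜 N (fun (i : ProfileSolution σ M k) x => (i.Q x)⁻¹) := by
  refine hQ.inv (fun i x hx => (i.Q_pos hσ hx).ne') (𝒜.of_abs_le (σ ^ 2 / 2)⁻¹ fun i x hx => ?_)
  rw [abs_of_pos (inv_pos.2 (i.Q_pos hσ hx))]
  exact inv_anti₀ (by positivity) (i.le_Q x hx)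

lemma Q_mem (𝒜 : GrowthClass (X : ProfileSolution σ M k → ℝ))
    (h : (fun (i : ProfileSolution σ M k) x => i.Q x - σ ^ 2) ∈ 𝒜.carrier) :
    (Q : ProfileSolution σ M k → ℝ → ℝ) ∈ 𝒜.carrier :=
  𝒜.congr (𝒜.add_mem _ h _ (𝒜.const_mem (σ ^ 2))) fun i x _ => by ring

lemma Q_sub_mem_uniformlyBounded (hk : 1 ≤ k) :
    (fun (i : ProfileSolution σ M k) x => i.Q x - σ ^ 2) ∈
      (uniformlyBounded (X : ProfileSolution σ M k → ℝ)).carrier := by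
  refine ⟨2 * M, 1, one_pos, fun i x hx hx1 => ?_⟩
  have hM : 0 ≤ M := (abs_nonneg _).trans (i.abs_F_le 0 (by omega) _ (i.abs_y_lt x hx))
  -- `|Q t - σ²| ≤ |Q t - Q x| + |Q x - σ²|`, and the first term is controlled by the derivative
  obtain ⟨A, hA⟩ := i.abs_Q_le
  have hlip : ∀ t ∈ Ioo 0 x, |i.Q x - i.Q t| ≤ 2 * M := by
    intro t ht
    have h := (convex_Icc t x).norm_image_sub_le_of_norm_hasDerivWithin_le (C := 2 * M)
      (f := i.Q) (f' := fun x => 2 * i.F 0 (i.y x))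
      (fun v hv => (i.hasDerivAt_Q v ⟨ht.1.trans_le hv.1, hv.2.trans_lt hx.2⟩).hasDerivWithinAt)
      (fun v hv => ?_) (left_mem_Icc.2 ht.2.le) (right_mem_Icc.2 ht.2.le)
    · rw [Real.norm_eq_abs, Real.norm_eq_abs, abs_of_pos (sub_pos.2 ht.2)] at h
      refine h.trans ?_
      have : x - t ≤ 1 := by linarith [ht.1]
      nlinarith
    · rw [Real.norm_eq_abs, abs_mul, abs_two]
      have := i.abs_F_le 0 (by omega) _ (i.abs_y_lt v ⟨ht.1.trans_le hv.1, hv.2.trans_lt hx.2⟩)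
      linarith
  have hlim : Tendsto (fun t => 2 * M + A * t) (𝓝[>] 0) (𝓝 (2 * M + A * 0)) :=
    ((continuous_const.add (continuous_const.mul continuous_id)).tendsto 0).mono_left
      nhdsWithin_le_nhds
  rw [mul_zero, add_zero] at hlim
  refine ge_of_tendsto hlim ?_
  filter_upwards [Ioo_mem_nhdsGT hx.1] with t ht
  have h1 := hA t ⟨ht.1, ht.2.trans hx.2⟩
  have h2 := hlip t ht
  have : i.Q x - σ ^ 2 = (i.Q x - i.Q t) + (i.Q t - σ ^ 2) := by ring
  rw [this]
  exact (abs_add_le _ _).trans (add_le_add h2 h1)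

lemma Q_sub_mem_polynomiallyBounded :
    (fun (i : ProfileSolution σ M k) x => i.Q x - σ ^ 2) ∈
      (polynomiallyBounded (X : ProfileSolution σ M k → ℝ)).carrier := fun i => by
  obtain ⟨A, hA⟩ := i.abs_Q_le
  refine ⟨0, |A|, 1, one_pos, fun x hx hx1 => ?_⟩
  rw [pow_zero, mul_one]
  calc _ ≤ A * x := hA x hx
    _ ≤ |A| * 1 := mul_le_mul (le_abs_self A) hx1.le hx.1.le (abs_nonneg A)
    _ = |A| := mul_one _

lemma reg_Q (𝒜 : GrowthClass (X : ProfileSolution σ M k → ℝ)) {N : ℕ} (hN : N ≤ k)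
    (h : (fun (i : ProfileSolution σ M k) x => i.Q x - σ ^ 2) ∈ 𝒜.carrier)
    (hy : Reg 𝒜 N (y : ProfileSolution σ M k → ℝ → ℝ)) :
    Reg 𝒜 (N + 1) (Q : ProfileSolution σ M k → ℝ → ℝ) :=
  Reg.of_hasDerivAt (Q_mem 𝒜 h) (fun i x hx => i.hasDerivAt_Q x hx)
    ((Reg.const 2).mul (reg_Fy 𝒜 (j := 0) (by omega) hy))

/-- Each solution is smooth with at most polynomially growing derivatives, by bootstrapping. The
bounds involve the lower bound of `F'(y)`, and are not uniform. -/
lemma reg_polynomiallyBounded (hσ : 0 < σ) :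
    ∀ N ≤ k, Reg (polynomiallyBounded (X : ProfileSolution σ M k → ℝ)) N
      (y : ProfileSolution σ M k → ℝ → ℝ)
  | 0, _ => (polynomiallyBounded _).of_abs_le 1 fun i x hx => i.abs_y_le_one x hx
  | N + 1, hN => by
    have hy := reg_polynomiallyBounded hσ N (by omega)
    have hQ := (reg_Q _ (by omega) Q_sub_mem_polynomiallyBounded hy).pred
    have hQi := reg_inv_Q hσ _ hQ
    have h0 := reg_Fy (polynomiallyBounded _) (j := 0) (by omega) hy
    have h1 := reg_Fy (polynomiallyBounded _) (j := 1) (by omega) hy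
    have h1i : Reg (polynomiallyBounded (X : ProfileSolution σ M k → ℝ)) N
        (fun i x => (Fy 1 i x)⁻¹) := by
      refine h1.inv (fun i x hx => (i.F_one_pos hx).ne') fun i => ?_
      obtain ⟨η, hη, h⟩ := i.F_one_bound
      refine ⟨0, η⁻¹, 1, one_pos, fun x hx _ => ?_⟩
      change |(i.F 1 (i.y x))⁻¹| * x ^ 0 ≤ η⁻¹
      rw [pow_zero, mul_one, abs_of_pos (inv_pos.2 (i.F_one_pos hx))]
      exact inv_anti₀ hη (h x hx)
    have hxi : Reg (polynomiallyBounded (X : ProfileSolution σ M k → ℝ)) N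
        (fun _ x => x⁻¹) := by
      refine Reg.id.inv (fun i x hx => hx.1.ne') fun i => ⟨1, 1, 1, one_pos, fun x hx _ => ?_⟩
      rw [pow_one, abs_of_pos (inv_pos.2 hx.1), inv_mul_cancel₀ hx.1.ne']
    refine Reg.of_hasDerivAt hy.mem (fun i x hx => i.hasDerivAt_y x hx) ?_
    refine (((((((Reg.const 4).mul (Reg.id.pow 2)).mul (h0.pow 2)).mul hQi).sub
      (((Reg.const 2).mul Reg.id).mul h0)).sub (((Reg.const 1).add
      (((hQ.sub (((Reg.const 2).mul Reg.id).mul h0)).pow 2).mul hQi)).mul hy)).mul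
      (((Reg.const (1 / 4)).mul (hxi.pow 2)).mul h1i)).congr fun i x hx => ?_
    have := hx.1.ne'
    have := (i.F_one_pos hx).ne'
    simp only [profileSlope, Fy, div_eq_mul_inv, mul_inv, inv_pow]
    ring

/-- The derivative `z = y'` satisfies a singular equation of Riccati type whose coefficients are
polynomials in `x`, `y`, `Q`, `1 / Q`, `F(y)`, `F'(y)`, `F''(y)`. -/
lemma riccati_eq (hσ : 0 < σ) (hk : 2 ≤ k) (i : ProfileSolution σ M k) {x : ℝ}
    (hx : x ∈ Ioo 0 i.X) :
    (((1 + i.Q x - 4 * x * Fy 0 i x + 4 * x ^ 2 * Fy 0 i x ^ 2 * (i.Q x)⁻¹) +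
      x * ((-4 * Fy 1 i x + 8 * x * Fy 0 i x * Fy 1 i x * (i.Q x)⁻¹) * i.y x + 10 * Fy 1 i x
        - 8 * x * Fy 0 i x * Fy 1 i x * (i.Q x)⁻¹) +
      x ^ 2 * (4 * Fy 2 i x) * deriv i.y x) * deriv i.y x +
      x ^ 2 * (4 * Fy 1 i x) * deriv (deriv i.y) x =
    4 * x * Fy 0 i x ^ 2 * (i.Q x)⁻¹ - 2 * Fy 0 i x + x * (4 * Fy 0 i x ^ 2 * (i.Q x)⁻¹
      - 8 * x * Fy 0 i x ^ 3 * (i.Q x)⁻¹ ^ 2)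
      + (2 * Fy 0 i x - 8 * x * Fy 0 i x ^ 2 * (i.Q x)⁻¹
        + 8 * x ^ 2 * Fy 0 i x ^ 3 * (i.Q x)⁻¹ ^ 2) * i.y x) := by
  have hreg := reg_polynomiallyBounded (M := M) hσ 2 hk
  have hev : (fun t => 4 * t ^ 2 * i.F 1 (i.y t) * deriv i.y t +
      (1 + i.Q t - 4 * t * i.F 0 (i.y t) + 4 * t ^ 2 * i.F 0 (i.y t) ^ 2 * (i.Q t)⁻¹) * i.y t)
      =ᶠ[𝓝 x] fun t => t * (4 * t * i.F 0 (i.y t) ^ 2 * (i.Q t)⁻¹ - 2 * i.F 0 (i.y t)) := by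
    filter_upwards [isOpen_Ioo.mem_nhds hx] with t ht
    have h1 := ht.1.ne'
    have h2 := (i.F_one_pos ht).ne'
    have h3 := (i.Q_pos hσ ht).ne'
    rw [(i.hasDerivAt_y t ht).deriv, profileSlope]
    field_simp
    ring
  have hyl := i.abs_y_lt x hx
  have dy : HasDerivAt i.y (deriv i.y x) x := hreg.pred.hasDerivAt hx
  have dz : HasDerivAt (deriv i.y) (deriv (deriv i.y) x) x := Reg.hasDerivAt (N := 0) hreg.2.2 hx
  have d0 := (i.hasDerivAt_F 0 (by omega) _ hyl).comp x dy
  have d1 := (i.hasDerivAt_F 1 (by omega) _ hyl).comp x dy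
  have dQ := i.hasDerivAt_Q x hx
  have dQi := dQ.fun_inv (i.Q_pos hσ hx).ne'
  have dx := hasDerivAt_id x
  have hl := ((((dx.pow 2).const_mul 4).mul d1).mul dz).add ((((dQ.const_add 1).sub
    ((dx.const_mul 4).mul d0)).add ((((dx.pow 2).const_mul 4).mul (d0.pow 2)).mul dQi)).mul dy)
  have hr := dx.mul ((((dx.const_mul 4).mul (d0.pow 2)).mul dQi).sub (d0.const_mul 2))
  have h := hl.unique (hr.congr_of_eventuallyEq hev)
  simp only [Fy]
  simp [div_eq_mul_inv] at h
  linear_combination h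

/-- Uniform bounds for the derivatives of `y` up to order `k - 1`, from the Riccati equation. -/
lemma reg_y_uniformlyBounded (hσ : 0 < σ) :
    ∀ N, N + 1 ≤ k → Reg (uniformlyBounded (X : ProfileSolution σ M k → ℝ)) N
      (y : ProfileSolution σ M k → ℝ → ℝ)
  | 0, _ => (uniformlyBounded _).of_abs_le 1 fun i x hx => i.abs_y_le_one x hx
  | N + 1, hN => by
    have hy := reg_y_uniformlyBounded hσ N (by omega)
    have hQ := (reg_Q _ (by omega) (Q_sub_mem_uniformlyBounded (by omega)) hy).pred
    have hQi := reg_inv_Q hσ _ hQ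
    have h0 := reg_Fy (uniformlyBounded _) (j := 0) (by omega) hy
    have h1 := reg_Fy (uniformlyBounded _) (j := 1) (by omega) hy
    have h2 := reg_Fy (uniformlyBounded _) (j := 2) (by omega) hy
    have hp := reg_polynomiallyBounded (M := M) hσ (N + 2) (by omega)
    refine ⟨hy.mem, hp.2.1, reg_of_riccati
      (fun i x hx => riccati_eq hσ (by omega) i hx) ?_ ?_ ?_ ?_ ?_ ?_ ?_ hp.2.2 ?_⟩
    · intro i x hx
      have hQ := i.Q_pos hσ hx
      have : 1 + i.Q x - 4 * x * Fy 0 i x + 4 * x ^ 2 * Fy 0 i x ^ 2 * (i.Q x)⁻¹ =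
          1 + (i.Q x - 2 * x * Fy 0 i x) ^ 2 * (i.Q x)⁻¹ := by
        field_simp
        ring
      rw [this]
      have : 0 ≤ (i.Q x - 2 * x * Fy 0 i x) ^ 2 * (i.Q x)⁻¹ := by positivity
      linarith
    · intro i x hx
      exact mul_pos four_pos (i.F_one_pos hx)
    · exact (((Reg.const 1).add hQ).sub (((Reg.const 4).mul Reg.id).mul h0)).add
        ((((Reg.const 4).mul (Reg.id.pow 2)).mul (h0.pow 2)).mul hQi)
    · exact ((((Reg.const (-4)).mul h1).add (((((Reg.const 8).mul Reg.id).mul h0).mul h1).mul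
        hQi)).mul hy).add ((Reg.const 10).mul h1) |>.sub
        (((((Reg.const 8).mul Reg.id).mul h0).mul h1).mul hQi)
    · exact (Reg.const 4).mul h2
    · exact (Reg.const 4).mul h1
    · exact ((((((Reg.const 4).mul Reg.id).mul (h0.pow 2)).mul hQi).sub ((Reg.const 2).mul h0)).add
        (Reg.id.mul ((((Reg.const 4).mul (h0.pow 2)).mul hQi).sub
          ((((Reg.const 8).mul Reg.id).mul (h0.pow 3)).mul (hQi.pow 2))))).add
        (((((Reg.const 2).mul h0).sub ((((Reg.const 8).mul Reg.id).mul (h0.pow 2)).mul hQi)).add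
          ((((Reg.const 8).mul (Reg.id.pow 2)).mul (h0.pow 3)).mul (hQi.pow 2))).mul hy)
    · intro i
      -- `4 x² F'(y) y'` is a combination of `x` and `y`, hence `O(x)`
      obtain ⟨η, hη, hη'⟩ := i.F_one_bound
      obtain ⟨A, hA⟩ := i.abs_y_le
      obtain ⟨A', hA'⟩ := i.abs_Q_le
      set q := σ ^ 2 / 2 with hq
      have hqp : 0 < q := by positivity
      set Y := |i.X| with hY
      set S := σ ^ 2 + |A'| * Y with hS
      set T := (S + 2 * Y * |M|) ^ 2 / q with hT
      refine ⟨(4 * Y * |M| ^ 2 / q + 2 * |M| + (1 + T) * |A|) / (4 * η), fun x hx => ?_⟩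
      have hxY : x ≤ Y := hx.2.le.trans (le_abs_self _)
      have hx0 : 0 < x := hx.1
      have hY0 : 0 ≤ Y := abs_nonneg _
      have hp := (i.abs_F_le 0 (by omega) _ (i.abs_y_lt x hx)).trans (le_abs_self M)
      have hF := hη' x hx
      have hQq : q ≤ i.Q x := i.le_Q x hx
      have hQ0 : 0 < i.Q x := i.Q_pos hσ hx
      have hyA : |i.y x| ≤ |A| * x := (hA x hx).trans (by gcongr; exact le_abs_self A)
      have hQS : |i.Q x| ≤ S := by
        have e1 : |i.Q x - σ ^ 2| ≤ |A'| * Y := (hA' x hx).trans (by gcongr; exact le_abs_self A')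
        have := abs_le.1 e1
        rw [abs_of_pos hQ0]
        linarith [this.2]
      rw [(i.hasDerivAt_y x hx).deriv, profileSlope]
      set p := i.F 0 (i.y x)
      have hF0 : 0 < i.F 1 (i.y x) := i.F_one_pos hx
      have e1 : |4 * x ^ 2 * p ^ 2 / i.Q x| ≤ 4 * Y * |M| ^ 2 / q * x := by
        rw [abs_div, abs_of_pos hQ0, abs_mul, abs_pow, abs_of_nonneg (by positivity)]
        calc 4 * x ^ 2 * |p| ^ 2 / i.Q x ≤ 4 * (Y * x) * |M| ^ 2 / q := by
              have : x ^ 2 ≤ Y * x := by nlinarith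
              gcongr
          _ = _ := by ring
      have e2 : |2 * x * p| ≤ 2 * |M| * x := by
        rw [abs_mul, abs_of_pos (by positivity)]
        nlinarith
      have e3 : |(i.Q x - 2 * x * p) ^ 2 / i.Q x| ≤ T := by
        rw [abs_div, abs_of_pos hQ0, abs_pow]
        have : |i.Q x - 2 * x * p| ≤ S + 2 * Y * |M| := by
          refine (abs_sub _ _).trans (add_le_add hQS (e2.trans ?_))
          nlinarith [abs_nonneg M]
        rw [hT]
        gcongr
      have e4 : |(1 + (i.Q x - 2 * x * p) ^ 2 / i.Q x) * i.y x| ≤ (1 + T) * (|A| * x) := by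
        rw [abs_mul]
        have : |1 + (i.Q x - 2 * x * p) ^ 2 / i.Q x| ≤ 1 + T :=
          (abs_add_le _ _).trans (by rw [abs_one]; linarith)
        exact mul_le_mul this hyA (abs_nonneg _) ((abs_nonneg _).trans this)
      have e5 := (abs_sub (4 * x ^ 2 * p ^ 2 / i.Q x - 2 * x * p)
        ((1 + (i.Q x - 2 * x * p) ^ 2 / i.Q x) * i.y x)).trans
        (add_le_add ((abs_sub (4 * x ^ 2 * p ^ 2 / i.Q x) (2 * x * p)).trans
          (add_le_add e1 e2)) e4)
      rw [abs_div, abs_of_pos (by positivity : 0 < 4 * x ^ 2 * i.F 1 (i.y x)), ← mul_div_assoc,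
        div_mul_eq_mul_div, div_le_div_iff₀ (by positivity) (by positivity)]
      calc _ ≤ x ^ 2 * ((4 * Y * |M| ^ 2 / q * x + 2 * |M| * x) + (1 + T) * (|A| * x)) *
            (4 * η) := by
            gcongr
        _ = (4 * Y * |M| ^ 2 / q + 2 * |M| + (1 + T) * |A|) * x * (4 * x ^ 2 * η) := by ring
        _ ≤ _ := by
            have : 0 ≤ T := by positivity
            gcongr

/-- Uniform bounds for the derivatives of `Q` up to order `k`. -/
lemma reg_Q_uniformlyBounded (hσ : 0 < σ) (hk : 1 ≤ k) :
    Reg (uniformlyBounded (X : ProfileSolution σ M k → ℝ)) k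
      (Q : ProfileSolution σ M k → ℝ → ℝ) := by
  obtain ⟨m, rfl⟩ : ∃ m, k = m + 1 := ⟨k - 1, by omega⟩
  exact reg_Q _ (by omega) (Q_sub_mem_uniformlyBounded hk)
    (reg_y_uniformlyBounded hσ m le_rfl)

end ProfileSolution

/-! ### Existence for the profile system -/

/-- A barrier principle: a function that decreases wherever it is positive stays nonpositive. -/
lemma nonpos_of_hasDerivAt_neg {φ φ' : ℝ → ℝ} {a b : ℝ} (hab : a ≤ b)
    (hc : ContinuousOn φ (Icc a b)) (hd : ∀ x ∈ Ioc a b, HasDerivAt φ (φ' x) x)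
    (hneg : ∀ x ∈ Ioc a b, 0 < φ x → φ' x < 0) (ha : φ a ≤ 0) : φ b ≤ 0 := by
  by_contra! hb
  obtain ⟨x, hx, hmax⟩ := isCompact_Icc.exists_isMaxOn ⟨b, hab, le_rfl⟩ hc
  have hxb : φ b ≤ φ x := hmax ⟨hab, le_rfl⟩
  have hax : a < x := by
    rcases hx.1.eq_or_lt with h | h
    · rw [← h] at hxb; linarith
    · exact h
  have := nonneg_of_hasDerivAt_of_isMaxOn_left hax (hd x ⟨hax, hx.2⟩)
    fun t ht => hmax ⟨ht.1, ht.2.trans hx.2⟩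
  exact absurd this (not_le.2 (hneg x ⟨hax, hx.2⟩ (hb.trans_le hxb)))

/-- `F` lists a strictly increasing function `F 0` on `(-δ, δ)` and its derivatives up to order `k`,
all of them bounded by `M`. -/
structure IsIncreasingJet (F : ℕ → ℝ → ℝ) (δ M : ℝ) (k : ℕ) : Prop where
  hasDerivAt : ∀ l < k, ∀ v, |v| < δ → HasDerivAt (F l) (F (l + 1) v) v
  abs_le : ∀ l ≤ k, ∀ v, |v| < δ → |F l v| ≤ M
  pos : ∀ v, |v| < δ → 0 < F 1 v

/-- The right hand side of the profile system. -/
noncomputable def profileField (F : ℕ → ℝ → ℝ) (x : ℝ) (w : ℝ × ℝ) : ℝ × ℝ :=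
  (2 * F 0 w.2, profileSlope x w.1 w.2 (F 0 w.2) (F 1 w.2))

/-- The values of `(Q, y)` to which solutions of the profile system will be confined. -/
def profileBox (σ δ : ℝ) : Set (ℝ × ℝ) := Icc (σ ^ 2 / 2) (2 * σ ^ 2) ×ˢ Icc (-(δ / 2)) (δ / 2)

namespace IsIncreasingJet

variable {F : ℕ → ℝ → ℝ} {σ δ M : ℝ} {k : ℕ}

lemma contDiffOn_one (hF : IsIncreasingJet F δ M k) {l : ℕ} (hl : l + 1 < k) :
    ContDiffOn ℝ 1 (F l) (Ioo (-δ) δ) := by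
  have hd : ∀ v ∈ Ioo (-δ) δ, HasDerivAt (F l) (F (l + 1) v) v := fun v hv =>
    hF.hasDerivAt l (by omega) v (abs_lt.2 hv)
  have hc : ContinuousOn (F (l + 1)) (Ioo (-δ) δ) := fun v hv =>
    (hF.hasDerivAt (l + 1) hl v (abs_lt.2 hv)).continuousAt.continuousWithinAt
  have := (contDiffOn_succ_iff_deriv_of_isOpen (𝕜 := ℝ) (n := 0) (f := F l)
    (isOpen_Ioo (a := -δ) (b := δ))).2
      ⟨fun v hv => (hd v hv).differentiableAt.differentiableWithinAt,
      by simp, contDiffOn_zero.2 (hc.congr fun v hv => (hd v hv).deriv)⟩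
  simpa using this

lemma contDiffOn_profileField (hF : IsIncreasingJet F δ M k) (hk : 3 ≤ k) (hσ : 0 < σ) (hδ : 0 < δ)
    {a X : ℝ} (ha : 0 < a) :
    ContDiffOn ℝ 1 (fun p : ℝ × ℝ × ℝ => profileField F p.1 p.2) (Icc a X ×ˢ profileBox σ δ) := by
  set S := Icc a X ×ˢ profileBox σ δ with hS
  have hmem : ∀ p ∈ S, 0 < p.1 ∧ 0 < p.2.1 ∧ p.2.2 ∈ Ioo (-δ) δ := fun p hp =>
    ⟨ha.trans_le hp.1.1, lt_of_lt_of_le (by positivity) hp.2.1.1,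
      ⟨by linarith [hp.2.2.1], by linarith [hp.2.2.2]⟩⟩
  have c1 : ContDiffOn ℝ 1 (fun p : ℝ × ℝ × ℝ => p.1) S := contDiff_fst.contDiffOn
  have c2 : ContDiffOn ℝ 1 (fun p : ℝ × ℝ × ℝ => p.2.1) S :=
    (contDiff_fst.comp contDiff_snd).contDiffOn
  have c3 : ContDiffOn ℝ 1 (fun p : ℝ × ℝ × ℝ => p.2.2) S :=
    (contDiff_snd.comp contDiff_snd).contDiffOn
  have f0 : ContDiffOn ℝ 1 (fun p : ℝ × ℝ × ℝ => F 0 p.2.2) S :=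
    (hF.contDiffOn_one (by omega)).comp c3 fun p hp => (hmem p hp).2.2
  have f1 : ContDiffOn ℝ 1 (fun p : ℝ × ℝ × ℝ => F 1 p.2.2) S :=
    (hF.contDiffOn_one (by omega)).comp c3 fun p hp => (hmem p hp).2.2
  refine (contDiffOn_const.mul f0).prodMk ?_
  unfold profileSlope
  refine ContDiffOn.div (((((contDiffOn_const.mul (c1.pow 2)).mul (f0.pow 2)).div c2 ?_).sub
    ((contDiffOn_const.mul c1).mul f0)).sub ((contDiffOn_const.add
      (((c2.sub ((contDiffOn_const.mul c1).mul f0)).pow 2).div c2 ?_)).mul c3))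
      ((contDiffOn_const.mul (c1.pow 2)).mul f1) ?_
  · exact fun p hp => (hmem p hp).2.1.ne'
  · exact fun p hp => (hmem p hp).2.1.ne'
  · intro p hp
    obtain ⟨h1, -, h3⟩ := hmem p hp
    have := hF.pos _ (abs_lt.2 h3)
    positivity

lemma exists_lipschitz_profileField (hF : IsIncreasingJet F δ M k) (hk : 3 ≤ k) (hσ : 0 < σ)
    (hδ : 0 < δ) {a X : ℝ} (ha : 0 < a) :
    ∃ K : ℝ≥0, ∀ x ∈ Icc a X, LipschitzOnWith K (profileField F x) (profileBox σ δ) := by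
  obtain ⟨K, hK⟩ := (hF.contDiffOn_profileField hk hσ hδ ha (X := X)).exists_lipschitzOnWith
    one_ne_zero ((convex_Icc _ _).prod ((convex_Icc _ _).prod (convex_Icc _ _)))
    (isCompact_Icc.prod (isCompact_Icc.prod isCompact_Icc))
  refine ⟨K, fun x hx => LipschitzOnWith.of_dist_le_mul fun w hw w' hw' => ?_⟩
  refine (hK.dist_le_mul (x, w) ⟨hx, hw⟩ (x, w') ⟨hx, hw'⟩).trans_eq ?_
  rw [Prod.dist_eq, dist_self, max_eq_right dist_nonneg]

/-- Solutions of the profile system, with the unknowns clamped to `profileBox σ δ`, exist on every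
interval `[a, X]` with `a > 0`. -/
lemma exists_clamped_solution (hF : IsIncreasingJet F δ M k) (hk : 3 ≤ k) (hσ : 0 < σ)
    (hδ : 0 < δ) {a X : ℝ} (ha : 0 < a) (haX : a ≤ X) :
    ∃ w : ℝ → ℝ × ℝ, w a = (σ ^ 2, 0) ∧ ∀ x ∈ Icc a X, HasDerivWithinAt w
      (profileField F x (max (σ ^ 2 / 2) (min (2 * σ ^ 2) (w x).1),
        max (-(δ / 2)) (min (δ / 2) (w x).2))) (Icc a X) x := by
  set cl : ℝ × ℝ → ℝ × ℝ := fun w =>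
    (max (σ ^ 2 / 2) (min (2 * σ ^ 2) w.1), max (-(δ / 2)) (min (δ / 2) w.2)) with hcl
  have hclmem : ∀ w, cl w ∈ profileBox σ δ := fun w =>
    ⟨⟨le_max_left _ _, max_le (by nlinarith) (min_le_left _ _)⟩,
      ⟨le_max_left _ _, max_le (by linarith) (min_le_left _ _)⟩⟩
  have hcllip : LipschitzWith 1 cl := by
    have h1 : LipschitzWith 1 (fun w : ℝ × ℝ => max (σ ^ 2 / 2) (min (2 * σ ^ 2) w.1)) :=
      (LipschitzWith.prod_fst.const_min _).const_max _
    have h2 : LipschitzWith 1 (fun w : ℝ × ℝ => max (-(δ / 2)) (min (δ / 2) w.2)) :=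
      (LipschitzWith.prod_snd.const_min _).const_max _
    simpa using h1.prodMk h2
  obtain ⟨K, hK⟩ := hF.exists_lipschitz_profileField hk hσ hδ ha (X := X)
  have hcont := (hF.contDiffOn_profileField hk hσ hδ ha (X := X)).continuousOn
  obtain ⟨L, hL⟩ :=
    (isCompact_Icc.prod (isCompact_Icc.prod isCompact_Icc)).exists_bound_of_continuousOn
    hcont
  have hPL : IsPicardLindelof (fun x w => profileField F x (cl w)) (tmin := a) (tmax := X)
      ⟨a, le_rfl, haX⟩ (σ ^ 2, (0 : ℝ)) (L.toNNReal * (X - a).toNNReal) 0 L.toNNReal K := by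
    refine ⟨fun x hx => ?_, fun w _ => ?_, fun x hx w _ => ?_, ?_⟩
    · have := (hK x hx).comp (hcllip.lipschitzOnWith (s := univ)) fun w _ => hclmem w
      rw [mul_one] at this
      exact this.mono (subset_univ _)
    · exact hcont.comp (continuousOn_id.prodMk continuousOn_const) fun x hx => ⟨hx, hclmem w⟩
    · exact (hL (x, cl w) ⟨hx, hclmem w⟩).trans (Real.le_coe_toNNReal L)
    · simp [max_eq_left (sub_nonneg.2 haX)]
  exact hPL.exists_eq_forall_mem_Icc_hasDerivWithinAt₀

end IsIncreasingJet

/-- The smallness of the interval of existence `(0, X)` that the barrier and the contraction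
arguments need. It does not involve a lower bound for `F'`. -/
structure IsSmallInterval (σ M δ X : ℝ) : Prop where
  pos : 0 < X
  le_one : X ≤ 1
  barrier : (2 * M + 1) * X ≤ min (δ / 2) 1
  slope : 4 * M ^ 2 / (σ ^ 2 / 2) * X < 1
  radius : 2 * M * X ≤ σ ^ 2 / 2
  contraction : (8 * M / (σ ^ 2 / 2) + 4 * (2 * M + 1) + 8 * (2 * M + 1) * M / (σ ^ 2 / 2)) * X ≤
    1 / (2 * M)
  gain : (4 * M ^ 2 / (σ ^ 2 / 2) ^ 2 + (2 * M + 1) + 4 * (2 * M + 1) * M ^ 2 / (σ ^ 2 / 2) ^ 2) *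
    (4 * M * X) ≤ 1 / 2

lemma exists_isSmallInterval {σ M δ : ℝ} (hσ : 0 < σ) (hM : 0 < M) (hδ : 0 < δ) :
    ∃ X, IsSmallInterval σ M δ X := by
  have key : ∀ c t : ℝ, 0 < t → ∀ᶠ X in 𝓝[>] (0 : ℝ), c * X < t := by
    intro c t ht
    have : Tendsto (fun X : ℝ => c * X) (𝓝[>] 0) (𝓝 (c * 0)) :=
      ((continuous_const.mul continuous_id).tendsto 0).mono_left nhdsWithin_le_nhds
    rw [mul_zero] at this
    exact this.eventually_lt_const ht
  have hpos : ∀ᶠ X in 𝓝[>] (0 : ℝ), 0 < X := self_mem_nhdsWithin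
  obtain ⟨X, h0, h1, h2, h3, h4, h5, h6⟩ := (hpos.and ((key 1 1 one_pos).and
    ((key (2 * M + 1) (min (δ / 2) 1) (by positivity)).and
    ((key (4 * M ^ 2 / (σ ^ 2 / 2)) 1 one_pos).and ((key (2 * M) (σ ^ 2 / 2) (by positivity)).and
    ((key (8 * M / (σ ^ 2 / 2) + 4 * (2 * M + 1) + 8 * (2 * M + 1) * M / (σ ^ 2 / 2)) (1 / (2 * M))
      (by positivity)).and
    (key ((4 * M ^ 2 / (σ ^ 2 / 2) ^ 2 + (2 * M + 1) + 4 * (2 * M + 1) * M ^ 2 / (σ ^ 2 / 2) ^ 2) *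
      (4 * M)) (1 / 2) (by positivity)))))))).exists
  exact ⟨X, h0, by linarith, h2.le, h3, h4.le, h5.le, by linarith⟩

/-- `w = (Q, y)` solves the profile system on `(a, X)`, within the barriers. -/
structure IsBarrierSolution (F : ℕ → ℝ → ℝ) (σ M a X : ℝ) (w : ℝ → ℝ × ℝ) : Prop where
  hasDerivAt : ∀ x ∈ Ioo a X, HasDerivAt w (profileField F x (w x)) x
  abs_snd_le : ∀ x ∈ Ioo a X, |(w x).2| ≤ (2 * M + 1) * x
  abs_fst_le : ∀ x ∈ Ioo a X, |(w x).1 - σ ^ 2| ≤ 2 * M * x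

lemma profileSlope_numerator_neg {x Q y p M q A : ℝ} (hx : 0 < x) (hq : 0 < q) (hQ : q ≤ Q)
    (hp : |p| ≤ M) (hA : 4 * M ^ 2 / q * x + 2 * M < A) (hy : A * x ≤ y) :
    4 * x ^ 2 * p ^ 2 / Q - 2 * x * p - (1 + (Q - 2 * x * p) ^ 2 / Q) * y < 0 := by
  have hM : 0 ≤ M := (abs_nonneg _).trans hp
  have hQ0 : 0 < Q := hq.trans_le hQ
  have hA0 : 0 < A := lt_of_le_of_lt (by positivity) hA
  have e1 : 4 * x ^ 2 * p ^ 2 / Q ≤ 4 * M ^ 2 / q * x * x := by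
    have : p ^ 2 ≤ M ^ 2 := sq_le_sq' (abs_le.1 hp).1 (abs_le.1 hp).2
    calc 4 * x ^ 2 * p ^ 2 / Q ≤ 4 * x ^ 2 * M ^ 2 / q := by gcongr
      _ = _ := by ring
  have e2 : -(2 * x * p) ≤ 2 * M * x := by nlinarith [(abs_le.1 hp).1]
  have e3 : A * x ≤ (1 + (Q - 2 * x * p) ^ 2 / Q) * y := by
    have : 0 ≤ (Q - 2 * x * p) ^ 2 / Q := by positivity
    have hy0 : 0 < y := lt_of_lt_of_le (by positivity) hy
    nlinarith
  nlinarith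

/-- Above the line `y = A x` solutions of the profile system decrease. -/
lemma profileSlope_neg {x Q y p F₁ M q A : ℝ} (hx : 0 < x) (hq : 0 < q) (hQ : q ≤ Q)
    (hp : |p| ≤ M) (hA : 4 * M ^ 2 / q * x + 2 * M < A) (hy : A * x ≤ y) (hF : 0 < F₁) :
    profileSlope x Q y p F₁ < 0 :=
  div_neg_of_neg_of_pos (profileSlope_numerator_neg hx hq hQ hp hA hy) (by positivity)

/-- Below the line `y = -A x` solutions of the profile system increase. -/
lemma profileSlope_pos {x Q y p F₁ M q A : ℝ} (hx : 0 < x) (hq : 0 < q) (hQ : q ≤ Q)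
    (hp : |p| ≤ M) (hA : 4 * M ^ 2 / q * x + 2 * M < A) (hy : y ≤ -(A * x)) (hF : 0 < F₁) :
    0 < profileSlope x Q y p F₁ := by
  refine div_pos ?_ (by positivity)
  have hM : 0 ≤ M := (abs_nonneg _).trans hp
  have hQ0 : 0 < Q := hq.trans_le hQ
  have e1 : 0 ≤ 4 * x ^ 2 * p ^ 2 / Q := by positivity
  have e2 : 2 * x * p ≤ 2 * M * x := by nlinarith [(abs_le.1 hp).2]
  have e4 : 0 ≤ 4 * M ^ 2 / q * x := by positivity
  have e3 : (1 + (Q - 2 * x * p) ^ 2 / Q) * y ≤ -(A * x) := by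
    have : 0 ≤ (Q - 2 * x * p) ^ 2 / Q := by positivity
    have : 0 < A := by linarith
    have hy0 : y ≤ 0 := hy.trans (by nlinarith)
    nlinarith
  nlinarith

section

variable {F : ℕ → ℝ → ℝ} {σ δ M X : ℝ} {k : ℕ}

/-- Starting from `Q = σ²` and `y = 0` at `x = a`, the linear barriers `± (2 M + 1) x` for `y`
cannot be crossed, and the solution exists up to `X`. -/
lemma exists_isBarrierSolution (hF : IsIncreasingJet F δ M k) (hk : 3 ≤ k) (hσ : 0 < σ)
    (hδ : 0 < δ) (hX : IsSmallInterval σ M δ X) {a : ℝ} (ha : 0 < a) (haX : a ≤ X) :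
    ∃ w : ℝ → ℝ × ℝ, w a = (σ ^ 2, 0) ∧ ContinuousOn w (Icc a X) ∧
      IsBarrierSolution F σ M a X w := by
  obtain ⟨w, hwa, hw⟩ := hF.exists_clamped_solution hk hσ hδ ha haX
  have hM : 0 ≤ M := (abs_nonneg _).trans (hF.abs_le 0 (by omega) 0 (by simpa using hδ))
  have hwc : ContinuousOn w (Icc a X) := fun x hx => (hw x hx).continuousWithinAt
  set yc : ℝ → ℝ := fun x => max (-(δ / 2)) (min (δ / 2) (w x).2) with hyc
  set Qc : ℝ → ℝ := fun x => max (σ ^ 2 / 2) (min (2 * σ ^ 2) (w x).1) with hQc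
  have hycδ : ∀ x, |yc x| < δ := fun x => abs_lt.2
    ⟨lt_of_lt_of_le (by linarith) (le_max_left _ _),
      lt_of_le_of_lt (max_le (by linarith) (min_le_left _ _)) (by linarith : δ / 2 < δ)⟩
  have hd : ∀ x ∈ Ioo a X, HasDerivAt w (profileField F x (Qc x, yc x)) x := fun x hx =>
    (hw x (Ioo_subset_Icc_self hx)).hasDerivAt (Icc_mem_nhds hx.1 hx.2)
  have hds : ∀ x ∈ Ioo a X, HasDerivAt (fun x => (w x).2) (profileField F x (Qc x, yc x)).2 x :=
    fun x hx => (hd x hx).snd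
  have hp : ∀ x, |F 0 (yc x)| ≤ M := fun x => hF.abs_le 0 (by omega) _ (hycδ x)
  have hF1 : ∀ x, 0 < F 1 (yc x) := fun x => hF.pos _ (hycδ x)
  have hbar := hX.barrier
  have hslope := hX.slope
  have hA : ∀ x ∈ Ioo a X, 4 * M ^ 2 / (σ ^ 2 / 2) * x + 2 * M < 2 * M + 1 := by
    intro x hx
    have : 4 * M ^ 2 / (σ ^ 2 / 2) * x ≤ 4 * M ^ 2 / (σ ^ 2 / 2) * X := by gcongr; exact hx.2.le
    linarith
  have hxδ : ∀ x ∈ Ioo a X, (2 * M + 1) * x ≤ δ / 2 := fun x hx => by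
    have : (2 * M + 1) * x ≤ (2 * M + 1) * X := by gcongr; exact hx.2.le
    exact this.trans (hbar.trans (min_le_left _ _))
  have hup : ∀ x ∈ Ioo a X, (w x).2 - (2 * M + 1) * x ≤ 0 := by
    intro b hb
    have hsub : ∀ x ∈ Ioc a b, x ∈ Ioo a X := fun x hx => ⟨hx.1, hx.2.trans_lt hb.2⟩
    refine nonpos_of_hasDerivAt_neg (φ := fun x => (w x).2 - (2 * M + 1) * x) hb.1.le
      ((continuous_snd.comp_continuousOn (hwc.mono (Icc_subset_Icc_right hb.2.le))).sub
        (continuousOn_const.mul continuousOn_id))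
      (fun x hx => (hds x (hsub x hx)).sub ((hasDerivAt_id x).const_mul (2 * M + 1))) ?_
      (by rw [hwa]; nlinarith)
    intro x hx hpos
    have hx0 : 0 < x := ha.trans hx.1
    have hy : (2 * M + 1) * x ≤ yc x :=
      le_max_of_le_right (le_min (hxδ x (hsub x hx)) (by linarith))
    have := profileSlope_neg hx0 (by positivity : 0 < σ ^ 2 / 2) (le_max_left _ _ : _ ≤ Qc x)
      (hp x) (hA x (hsub x hx)) hy (hF1 x)
    simp only [profileField, mul_one]
    linarith
  have hlow : ∀ x ∈ Ioo a X, -(w x).2 - (2 * M + 1) * x ≤ 0 := by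
    intro b hb
    have hsub : ∀ x ∈ Ioc a b, x ∈ Ioo a X := fun x hx => ⟨hx.1, hx.2.trans_lt hb.2⟩
    refine nonpos_of_hasDerivAt_neg (φ := fun x => -(w x).2 - (2 * M + 1) * x) hb.1.le
      ((continuous_snd.comp_continuousOn (hwc.mono (Icc_subset_Icc_right hb.2.le))).neg.sub
        (continuousOn_const.mul continuousOn_id))
      (fun x hx => (hds x (hsub x hx)).neg.sub ((hasDerivAt_id x).const_mul (2 * M + 1))) ?_
      (by rw [hwa]; nlinarith)
    intro x hx hpos
    have hx0 : 0 < x := ha.trans hx.1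
    have hy : yc x ≤ -((2 * M + 1) * x) :=
      max_le (by linarith [hxδ x (hsub x hx)]) ((min_le_right _ _).trans (by linarith))
    have := profileSlope_pos hx0 (by positivity : 0 < σ ^ 2 / 2) (le_max_left _ _ : _ ≤ Qc x)
      (hp x) (hA x (hsub x hx)) hy (hF1 x)
    simp only [profileField, mul_one]
    linarith
  have hfst : ∀ x ∈ Ioo a X, |(w x).1 - σ ^ 2| ≤ 2 * M * x := by
    intro x hx
    have h := (convex_Icc a x).norm_image_sub_le_of_norm_hasDerivWithin_le (C := 2 * M)
      (f := fun x => (w x).1) (f' := fun x => 2 * F 0 (yc x))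
      (fun v hv => ((hw v ⟨hv.1, hv.2.trans hx.2.le⟩).mono (Icc_subset_Icc_right hx.2.le)).fst)
      (fun v _ => by
        rw [Real.norm_eq_abs, abs_mul, abs_two]; linarith [hp v])
      (left_mem_Icc.2 hx.1.le) (right_mem_Icc.2 hx.1.le)
    rw [hwa, Real.norm_eq_abs, Real.norm_eq_abs, abs_of_pos (sub_pos.2 hx.1)] at h
    refine h.trans ?_
    gcongr
    linarith
  have hsnd : ∀ x ∈ Ioo a X, |(w x).2| ≤ (2 * M + 1) * x := fun x hx =>
    abs_le.2 ⟨by linarith [hlow x hx], by linarith [hup x hx]⟩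
  refine ⟨w, hwa, hwc, fun x hx => ?_, hsnd, hfst⟩
  -- within the barriers the clamping is void
  have h1 : Qc x = (w x).1 := by
    have h1 := abs_le.1 (hfst x hx)
    have h2 : 2 * M * x ≤ 2 * M * X := by gcongr; exact hx.2.le
    have h3 := hX.radius
    have : 0 < σ ^ 2 := by positivity
    simp only [hQc]
    rw [min_eq_right (by linarith [h1.2]), max_eq_right (by linarith [h1.1])]
  have h2 : yc x = (w x).2 := by
    have h1 := abs_le.1 (hsnd x hx)
    have h2 := hxδ x hx
    simp only [hyc]
    rw [min_eq_right (by linarith [h1.2]), max_eq_right (by linarith [h1.1])]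
  have := hd x hx
  rwa [h1, h2] at this

namespace IsBarrierSolution

variable {a : ℝ} {w : ℝ → ℝ × ℝ}

lemma mem_profileBox (hM : 0 ≤ M) (hσ : 0 < σ) (hX : IsSmallInterval σ M δ X)
    (h : IsBarrierSolution F σ M a X w) {x : ℝ} (hx : x ∈ Ioo a X) : w x ∈ profileBox σ δ := by
  have h1 := abs_le.1 (h.abs_fst_le x hx)
  have h2 : 2 * M * x ≤ 2 * M * X := by gcongr; exact hx.2.le
  have h3 := hX.radius
  have h4 := abs_le.1 (h.abs_snd_le x hx)
  have h5 : (2 * M + 1) * x ≤ (2 * M + 1) * X := by gcongr; exact hx.2.le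
  have h6 := hX.barrier.trans (min_le_left _ _)
  have : 0 < σ ^ 2 := by positivity
  exact ⟨⟨by linarith [h1.1], by linarith [h1.2]⟩, ⟨by linarith [h4.1], by linarith [h4.2]⟩⟩

/-- Along a solution, the factor `F'(y)` cancels in the derivative of `F(y)`. -/
lemma hasDerivAt_F_zero (hF : IsIncreasingJet F δ M k) (hk : 3 ≤ k) (hσ : 0 < σ) (hδ : 0 < δ)
    (hM : 0 ≤ M) (hX : IsSmallInterval σ M δ X) (ha : 0 < a)
    (h : IsBarrierSolution F σ M a X w) {x : ℝ} (hx : x ∈ Ioo a X) :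
    HasDerivAt (fun x => F 0 (w x).2)
      ((4 * x ^ 2 * F 0 (w x).2 ^ 2 / (w x).1 - 2 * x * F 0 (w x).2 -
        (1 + ((w x).1 - 2 * x * F 0 (w x).2) ^ 2 / (w x).1) * (w x).2) / (4 * x ^ 2)) x := by
  have hb := h.mem_profileBox hM hσ hX hx
  have hyδ : |(w x).2| < δ := abs_lt.2 ⟨by linarith [hb.2.1], by linarith [hb.2.2]⟩
  have h1 := (hF.hasDerivAt 0 (by omega) _ hyδ).comp x (h.hasDerivAt x hx).snd
  refine h1.congr_deriv ?_
  have := hF.pos _ hyδ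
  have hx0 : 0 < x := ha.trans hx.1
  simp only [profileField, profileSlope, zero_add]
  field_simp

end IsBarrierSolution

end

/-! ### Comparison of solutions and passage to the limit -/

section

variable {F : ℕ → ℝ → ℝ} {σ δ M X : ℝ} {k : ℕ}

namespace IsIncreasingJet

lemma exists_slope_eq (hF : IsIncreasingJet F δ M k) (hk : 1 ≤ k) {u v : ℝ} (hu : |u| < δ)
    (hv : |v| < δ) (huv : u < v) : ∃ ξ ∈ Ioo u v, F 0 v - F 0 u = F 1 ξ * (v - u) := by
  have hmem : ∀ t ∈ Icc u v, |t| < δ := fun t ht => abs_lt.2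
    ⟨(abs_lt.1 hu).1.trans_le ht.1, ht.2.trans_lt (abs_lt.1 hv).2⟩
  obtain ⟨ξ, hξ, h⟩ := exists_hasDerivAt_eq_slope (F 0) (F 1) huv
    (fun t ht => (hF.hasDerivAt 0 (by omega) t (hmem t ht)).continuousAt.continuousWithinAt)
    (fun t ht => hF.hasDerivAt 0 (by omega) t (hmem t (Ioo_subset_Icc_self ht)))
  refine ⟨ξ, hξ, ?_⟩
  rw [h, div_mul_cancel₀ _ (sub_pos.2 huv).ne']

lemma sub_le_of_lt (hF : IsIncreasingJet F δ M k) (hk : 1 ≤ k) {u v : ℝ} (hu : |u| < δ)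
    (hv : |v| < δ) (h : F 0 u < F 0 v) : u < v ∧ F 0 v - F 0 u ≤ M * (v - u) := by
  rcases lt_trichotomy u v with huv | rfl | huv
  · obtain ⟨ξ, hξ, e⟩ := hF.exists_slope_eq hk hu hv huv
    have hξδ : |ξ| < δ := abs_lt.2 ⟨(abs_lt.1 hu).1.trans hξ.1, hξ.2.trans (abs_lt.1 hv).2⟩
    refine ⟨huv, e.trans_le (mul_le_mul_of_nonneg_right ?_ (sub_pos.2 huv).le)⟩
    exact (le_abs_self _).trans (hF.abs_le 1 hk ξ hξδ)
  · exact absurd h (lt_irrefl _)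
  · obtain ⟨ξ, hξ, e⟩ := hF.exists_slope_eq hk hv hu huv
    have hξδ : |ξ| < δ := abs_lt.2 ⟨(abs_lt.1 hv).1.trans hξ.1, hξ.2.trans (abs_lt.1 hu).2⟩
    have := mul_pos (hF.pos ξ hξδ) (sub_pos.2 huv)
    linarith

lemma abs_sub_le (hF : IsIncreasingJet F δ M k) (hk : 1 ≤ k) {u v : ℝ} (hu : |u| < δ)
    (hv : |v| < δ) : |F 0 u - F 0 v| ≤ M * |u - v| := by
  rcases lt_trichotomy (F 0 u) (F 0 v) with h | h | h
  · obtain ⟨h1, h2⟩ := hF.sub_le_of_lt hk hu hv h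
    rw [abs_sub_comm, abs_sub_comm u, abs_of_pos (sub_pos.2 h), abs_of_pos (sub_pos.2 h1)]
    exact h2
  · rw [h, sub_self, abs_zero]
    have := (abs_nonneg _).trans (hF.abs_le 0 (by omega) u hu)
    positivity
  · obtain ⟨h1, h2⟩ := hF.sub_le_of_lt hk hv hu h
    rw [abs_of_pos (sub_pos.2 h), abs_of_pos (sub_pos.2 h1)]
    exact h2

lemma exists_lower_bound (hF : IsIncreasingJet F δ M k) (hk : 2 ≤ k) (hδ : 0 < δ) :
    ∃ η > 0, ∀ v ∈ Icc (-(δ / 2)) (δ / 2), η ≤ F 1 v := by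
  have hmem : ∀ v ∈ Icc (-(δ / 2)) (δ / 2), |v| < δ := fun v hv =>
    abs_lt.2 ⟨by linarith [hv.1], by linarith [hv.2]⟩
  obtain ⟨v, hv, hmin⟩ := isCompact_Icc.exists_isMinOn (s := Icc (-(δ / 2)) (δ / 2)) (f := F 1)
    ⟨0, by constructor <;> linarith⟩
    (fun v hv => (hF.hasDerivAt 1 (by omega) v (hmem v hv)).continuousAt.continuousWithinAt)
  exact ⟨F 1 v, hF.pos v (hmem v hv), fun t ht => hmin ht⟩

lemma mul_abs_sub_le (hF : IsIncreasingJet F δ M k) (hk : 1 ≤ k) (hδ : 0 < δ) {η : ℝ}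
    (hη : ∀ v ∈ Icc (-(δ / 2)) (δ / 2), η ≤ F 1 v) {u v : ℝ} (hu : u ∈ Icc (-(δ / 2)) (δ / 2))
    (hv : v ∈ Icc (-(δ / 2)) (δ / 2)) : η * |u - v| ≤ |F 0 u - F 0 v| := by
  have hmem : ∀ v ∈ Icc (-(δ / 2)) (δ / 2), |v| < δ := fun v hv =>
    abs_lt.2 ⟨by linarith [hv.1], by linarith [hv.2]⟩
  wlog huv : u < v generalizing u v with H
  · rcases (not_lt.1 huv).eq_or_lt with h | h
    · simp [h]
    · have := H hv hu h
      rwa [abs_sub_comm, abs_sub_comm (F 0 u)]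
  obtain ⟨ξ, hξ, e⟩ := hF.exists_slope_eq hk (hmem u hu) (hmem v hv) huv
  rw [abs_sub_comm, abs_sub_comm (F 0 u), e, abs_of_pos (sub_pos.2 huv)]
  refine le_trans ?_ (le_abs_self _)
  exact mul_le_mul_of_nonneg_right (hη ξ ⟨hu.1.trans hξ.1.le, hξ.2.le.trans hv.2⟩)
    (sub_pos.2 huv).le

end IsIncreasingJet

/-- If `F(y₁)` exceeds `F(y₂)` by more than the influence of the difference `m` of the first
components, then the second equation makes the difference decrease. -/
lemma profileSlope_numerator_sub_neg {x Q₁ Q₂ y₁ y₂ p₁ p₂ m q A X : ℝ} (hx : 0 < x) (hxX : x ≤ X)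
    (hX : X ≤ 1) (hM : 0 < M) (hq : 0 < q) (hQ₁ : q ≤ Q₁) (hQ₂ : q ≤ Q₂) (hp₁ : |p₁| ≤ M)
    (hp₂ : |p₂| ≤ M) (hA : 0 ≤ A) (hy₂ : |y₂| ≤ A * x) (hp : p₂ < p₁)
    (hpy : p₁ - p₂ ≤ M * (y₁ - y₂)) (hm : |Q₁ - Q₂| ≤ m)
    (hc : (8 * M / q + 4 * A + 8 * A * M / q) * X ≤ 1 / (2 * M))
    (hgap : 2 * M * (4 * M ^ 2 / q ^ 2 + A + 4 * A * M ^ 2 / q ^ 2) * X * m < p₁ - p₂) :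
    (4 * x ^ 2 * p₁ ^ 2 / Q₁ - 2 * x * p₁ - (1 + (Q₁ - 2 * x * p₁) ^ 2 / Q₁) * y₁) -
      (4 * x ^ 2 * p₂ ^ 2 / Q₂ - 2 * x * p₂ - (1 + (Q₂ - 2 * x * p₂) ^ 2 / Q₂) * y₂) < 0 := by
  have hQ₁0 : 0 < Q₁ := hq.trans_le hQ₁
  have hQ₂0 : 0 < Q₂ := hq.trans_le hQ₂
  have hm0 : 0 ≤ m := (abs_nonneg _).trans hm
  set d := p₁ - p₂ with hd
  have hd0 : 0 < d := sub_pos.2 hp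
  set ρ := 2 * M * d / q + M ^ 2 * m / q ^ 2 with hρ
  set D := p₁ ^ 2 / Q₁ - p₂ ^ 2 / Q₂ with hD
  have hDρ : |D| ≤ ρ := by
    have e : D = (p₁ + p₂) * d / Q₁ + p₂ ^ 2 * (Q₂ - Q₁) / (Q₁ * Q₂) := by
      rw [hD, hd]; field_simp; ring
    have e1 : |(p₁ + p₂) * d / Q₁| ≤ 2 * M * d / q := by
      rw [abs_div, abs_mul, abs_of_pos hd0, abs_of_pos hQ₁0]
      have : |p₁ + p₂| ≤ 2 * M := (abs_add_le _ _).trans (by linarith)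
      gcongr
    have e2 : |p₂ ^ 2 * (Q₂ - Q₁) / (Q₁ * Q₂)| ≤ M ^ 2 * m / q ^ 2 := by
      rw [abs_div, abs_mul, abs_pow, abs_of_pos (mul_pos hQ₁0 hQ₂0), abs_sub_comm, sq q]
      gcongr
    rw [e]
    exact (abs_add_le _ _).trans (add_le_add e1 e2)
  have hρ0 : 0 ≤ ρ := (abs_nonneg _).trans hDρ
  -- the difference of the factors `1 + r'²`
  set L := (Q₁ - Q₂) - 4 * x * d + 4 * x ^ 2 * D with hL
  have hLb : |L| ≤ m + 4 * x * d + 4 * x ^ 2 * ρ := by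
    refine (abs_add_le _ _).trans (add_le_add ((abs_sub _ _).trans (add_le_add hm ?_)) ?_)
    · rw [abs_of_pos (by positivity)]
    · rw [abs_mul, abs_of_pos (by positivity)]
      gcongr
  have hexp : (4 * x ^ 2 * p₁ ^ 2 / Q₁ - 2 * x * p₁ - (1 + (Q₁ - 2 * x * p₁) ^ 2 / Q₁) * y₁) -
      (4 * x ^ 2 * p₂ ^ 2 / Q₂ - 2 * x * p₂ - (1 + (Q₂ - 2 * x * p₂) ^ 2 / Q₂) * y₂) =
      4 * x ^ 2 * D - 2 * x * d - (1 + (Q₁ - 2 * x * p₁) ^ 2 / Q₁) * (y₁ - y₂) - L * y₂ := by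
    rw [hL, hD, hd]; field_simp; ring
  rw [hexp]
  have hy : d / M ≤ y₁ - y₂ := by rw [div_le_iff₀ hM]; linarith
  have hy0 : 0 ≤ y₁ - y₂ := le_trans (by positivity) hy
  have t1 : 4 * x ^ 2 * D ≤ 4 * x ^ 2 * ρ := by
    have := (le_abs_self D).trans hDρ
    gcongr
  have t2 : d / M ≤ (1 + (Q₁ - 2 * x * p₁) ^ 2 / Q₁) * (y₁ - y₂) := by
    have : 0 ≤ (Q₁ - 2 * x * p₁) ^ 2 / Q₁ * (y₁ - y₂) := by positivity
    linarith
  have t3 : -(L * y₂) ≤ (m + 4 * x * d + 4 * x ^ 2 * ρ) * (A * x) := by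
    refine (neg_le_abs _).trans ?_
    rw [abs_mul]
    exact mul_le_mul hLb hy₂ (abs_nonneg _) (by positivity)
  have t4 : 0 < 2 * x * d := by positivity
  have hx1 : x ≤ 1 := hxX.trans hX
  have hx2 : x ^ 2 ≤ X := by
    rw [sq]
    exact (mul_le_of_le_one_right hx.le hx1).trans hxX
  have hx3 : x ^ 3 ≤ X := by
    rw [pow_succ]
    exact (mul_le_of_le_one_right (sq_nonneg x) hx1).trans hx2
  have t5 : 4 * x ^ 2 * ρ + (m + 4 * x * d + 4 * x ^ 2 * ρ) * (A * x) ≤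
      d * ((8 * M / q + 4 * A + 8 * A * M / q) * X) +
        (4 * M ^ 2 / q ^ 2 + A + 4 * A * M ^ 2 / q ^ 2) * X * m := by
    have e : 4 * x ^ 2 * ρ + (m + 4 * x * d + 4 * x ^ 2 * ρ) * (A * x) =
        d * (8 * M / q * x ^ 2 + 4 * A * x ^ 2 + 8 * A * M / q * x ^ 3) +
        (4 * M ^ 2 / q ^ 2 * x ^ 2 + A * x + 4 * A * M ^ 2 / q ^ 2 * x ^ 3) * m := by
      rw [hρ]; field_simp; ring
    have g1 : 8 * M / q * x ^ 2 ≤ 8 * M / q * X := mul_le_mul_of_nonneg_left hx2 (by positivity)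
    have g2 : 4 * A * x ^ 2 ≤ 4 * A * X := mul_le_mul_of_nonneg_left hx2 (by positivity)
    have g3 : 8 * A * M / q * x ^ 3 ≤ 8 * A * M / q * X :=
      mul_le_mul_of_nonneg_left hx3 (by positivity)
    have g4 : 4 * M ^ 2 / q ^ 2 * x ^ 2 ≤ 4 * M ^ 2 / q ^ 2 * X :=
      mul_le_mul_of_nonneg_left hx2 (by positivity)
    have g5 : A * x ≤ A * X := mul_le_mul_of_nonneg_left hxX hA
    have g6 : 4 * A * M ^ 2 / q ^ 2 * x ^ 3 ≤ 4 * A * M ^ 2 / q ^ 2 * X :=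
      mul_le_mul_of_nonneg_left hx3 (by positivity)
    rw [e]
    exact add_le_add
      (mul_le_mul_of_nonneg_left (by linarith) hd0.le)
      (mul_le_mul_of_nonneg_right (by linarith) hm0)
  have t6 : d * ((8 * M / q + 4 * A + 8 * A * M / q) * X) ≤ d * (1 / (2 * M)) := by gcongr
  have t7 : (4 * M ^ 2 / q ^ 2 + A + 4 * A * M ^ 2 / q ^ 2) * X * m < d / (2 * M) := by
    rw [lt_div_iff₀ (by positivity)]
    linarith
  have t8 : d / M = d * (1 / (2 * M)) + d / (2 * M) := by field_simp; ring
  linarith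

namespace IsBarrierSolution

/-- One side of the comparison of `F(y)` for two solutions, by the maximum principle. -/
lemma F_sub_le (hF : IsIncreasingJet F δ M k) (hk : 3 ≤ k) (hσ : 0 < σ) (hδ : 0 < δ)
    (hM : 0 < M) (hX : IsSmallInterval σ M δ X) {a b m T : ℝ} {w v : ℝ → ℝ × ℝ} (ha : 0 < a)
    (hab : a ≤ b) (hb : b < X) (hw : IsBarrierSolution F σ M a X w)
    (hv : IsBarrierSolution F σ M a X v)
    (hc : ContinuousOn (fun x => F 0 (w x).2 - F 0 (v x).2) (Icc a b))
    (hm : ∀ x ∈ Icc a b, |(w x).1 - (v x).1| ≤ m)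
    (hT : F 0 (w a).2 - F 0 (v a).2 ≤ T)
    (hgap : 2 * M * (4 * M ^ 2 / (σ ^ 2 / 2) ^ 2 + (2 * M + 1) +
      4 * (2 * M + 1) * M ^ 2 / (σ ^ 2 / 2) ^ 2) * X * m ≤ T) :
    F 0 (w b).2 - F 0 (v b).2 ≤ T := by
  have hsub : ∀ x ∈ Ioc a b, x ∈ Ioo a X := fun x hx => ⟨hx.1, hx.2.trans_lt hb⟩
  have hm0 : 0 ≤ m := (abs_nonneg _).trans (hm a ⟨le_rfl, hab⟩)
  have hT0 : 0 ≤ T := le_trans (by have := hX.pos; positivity) hgap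
  have key := nonpos_of_hasDerivAt_neg (φ := fun x => F 0 (w x).2 - F 0 (v x).2 - T) hab
    (hc.sub continuousOn_const)
    (fun x hx => ((hw.hasDerivAt_F_zero hF hk hσ hδ hM.le hX ha (hsub x hx)).sub
      (hv.hasDerivAt_F_zero hF hk hσ hδ hM.le hX ha (hsub x hx))).sub_const T) ?_ (by linarith)
  · linarith
  intro x hx hpos
  have hx0 : 0 < x := ha.trans hx.1
  have hxX := hsub x hx
  have bw := hw.mem_profileBox hM.le hσ hX hxX
  have bv := hv.mem_profileBox hM.le hσ hX hxX
  have yw : |(w x).2| < δ := abs_lt.2 ⟨by linarith [bw.2.1], by linarith [bw.2.2]⟩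
  have yv : |(v x).2| < δ := abs_lt.2 ⟨by linarith [bv.2.1], by linarith [bv.2.2]⟩
  have hlt : F 0 (v x).2 < F 0 (w x).2 := by linarith
  rw [← sub_div]
  refine div_neg_of_neg_of_pos ?_ (by positivity)
  exact profileSlope_numerator_sub_neg hx0 hxX.2.le hX.le_one hM (by positivity) bw.1.1 bv.1.1
    (hF.abs_le 0 (by omega) _ yw) (hF.abs_le 0 (by omega) _ yv) (by positivity)
    (hv.abs_snd_le x hxX) hlt (hF.sub_le_of_lt (by omega) yv yw hlt).2
    (hm x (Ioc_subset_Icc_self hx)) hX.contraction (by linarith)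

/-- Solutions that start at `a' < a` and at `a` differ by `O(a)`. -/
lemma abs_sub_le (hF : IsIncreasingJet F δ M k) (hk : 3 ≤ k) (hσ : 0 < σ) (hδ : 0 < δ)
    (hM : 0 < M) (hX : IsSmallInterval σ M δ X) {a' a : ℝ} {w v : ℝ → ℝ × ℝ} (ha' : 0 < a')
    (haa : a' < a) (hw : IsBarrierSolution F σ M a' X w)
    (hv : IsBarrierSolution F σ M a X v) (hva : v a = (σ ^ 2, 0)) (hvc : ContinuousOn v (Icc a X))
    {b : ℝ} (hb : b ∈ Ico a X) :
    |(w b).1 - (v b).1| ≤ 4 * M * (2 * M + 2) * a ∧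
      |F 0 (w b).2 - F 0 (v b).2| ≤ 4 * M * (2 * M + 2) * a := by
  have ha : 0 < a := ha'.trans haa
  have hX0 := hX.pos
  have hX1 := hX.le_one
  have hwr : IsBarrierSolution F σ M a X w :=
    ⟨fun x hx => hw.hasDerivAt x ⟨haa.trans hx.1, hx.2⟩,
      fun x hx => hw.abs_snd_le x ⟨haa.trans hx.1, hx.2⟩,
      fun x hx => hw.abs_fst_le x ⟨haa.trans hx.1, hx.2⟩⟩
  have hsub : ∀ x ∈ Icc a b, x ∈ Ioo a' X := fun x hx => ⟨haa.trans_le hx.1, hx.2.trans_lt hb.2⟩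
  have hsub' : Icc a b ⊆ Icc a X := Icc_subset_Icc_right hb.2.le
  have hwδ : ∀ x ∈ Icc a b, |(w x).2| < δ := fun x hx => by
    have := (hw.mem_profileBox hM.le hσ hX (hsub x hx)).2
    exact abs_lt.2 ⟨by linarith [this.1], by linarith [this.2]⟩
  have hvδ : ∀ x ∈ Icc a b, |(v x).2| < δ := fun x hx => by
    rcases hx.1.eq_or_lt with rfl | h
    · simpa [hva] using hδ
    · have := (hv.mem_profileBox hM.le hσ hX ⟨h, hx.2.trans_lt hb.2⟩).2
      exact abs_lt.2 ⟨by linarith [this.1], by linarith [this.2]⟩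
  have hwcon : ContinuousOn w (Icc a b) := fun x hx =>
    (hw.hasDerivAt x (hsub x hx)).continuousAt.continuousWithinAt
  have hvcon : ContinuousOn v (Icc a b) := hvc.mono hsub'
  have hFc : ContinuousOn (F 0) (Ioo (-δ) δ) := (hF.contDiffOn_one (by omega)).continuousOn
  have hpw : ContinuousOn (fun x => F 0 (w x).2) (Icc a b) :=
    hFc.comp (continuous_snd.comp_continuousOn hwcon) fun x hx => abs_lt.1 (hwδ x hx)
  have hpv : ContinuousOn (fun x => F 0 (v x).2) (Icc a b) :=
    hFc.comp (continuous_snd.comp_continuousOn hvcon) fun x hx => abs_lt.1 (hvδ x hx)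
  obtain ⟨z, hz, hmax⟩ := isCompact_Icc.exists_isMaxOn (s := Icc a b)
    (f := fun x => |(w x).1 - (v x).1|) ⟨a, le_rfl, hb.1⟩
    ((continuous_fst.comp_continuousOn hwcon).sub (continuous_fst.comp_continuousOn hvcon)).abs
  set m := |(w z).1 - (v z).1| with hm
  have hm0 : 0 ≤ m := abs_nonneg _
  set c := 4 * M ^ 2 / (σ ^ 2 / 2) ^ 2 + (2 * M + 1) + 4 * (2 * M + 1) * M ^ 2 / (σ ^ 2 / 2) ^ 2
    with hc
  have hc0 : 0 ≤ c := by positivity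
  have hgain : c * (4 * M * X) ≤ 1 / 2 := hX.gain
  set T := M * (2 * M + 1) * a + 2 * M * c * X * m with hT
  have hini : |F 0 (w a).2 - F 0 (v a).2| ≤ M * (2 * M + 1) * a := by
    have h1 := hF.abs_sub_le (by omega) (hwδ a ⟨le_rfl, hb.1⟩) (hvδ a ⟨le_rfl, hb.1⟩)
    refine h1.trans ?_
    have := hw.abs_snd_le a (hsub a ⟨le_rfl, hb.1⟩)
    rw [hva, sub_zero, mul_assoc]
    gcongr
  have hp : ∀ x ∈ Icc a b, |F 0 (w x).2 - F 0 (v x).2| ≤ T := by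
    intro x hx
    have hIcc : Icc a x ⊆ Icc a b := Icc_subset_Icc_right hx.2
    have h0 : 0 ≤ 2 * M * c * X * m := by positivity
    have h0' : 0 ≤ M * (2 * M + 1) * a := by positivity
    have hi := abs_le.1 hini
    refine abs_le.2 ⟨?_, ?_⟩
    · have := hv.F_sub_le hF hk hσ hδ hM hX ha hx.1 (hx.2.trans_lt hb.2) hwr
        ((hpv.sub hpw).mono hIcc) (m := m) (T := T)
        (fun t ht => by rw [abs_sub_comm]; exact hmax (hIcc ht)) (by linarith [hi.1]) (by linarith)
      linarith
    · exact hwr.F_sub_le hF hk hσ hδ hM hX ha hx.1 (hx.2.trans_lt hb.2) hv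
        ((hpw.sub hpv).mono hIcc) (m := m) (T := T)
        (fun t ht => hmax (hIcc ht)) (by linarith [hi.2]) (by linarith)
  have hT0 : 0 ≤ T := (abs_nonneg _).trans (hp a ⟨le_rfl, hb.1⟩)
  have hQ : m ≤ 2 * M * a + 2 * T * X := by
    -- integrate `(Q₁ - Q₂)' = 2 (F(y₁) - F(y₂))`, which holds only in the interior
    have hmv : ∀ t ∈ Ioo a b, ∀ s ∈ Icc t b,
        |((w s).1 - (v s).1) - ((w t).1 - (v t).1)| ≤ 2 * T * X := by
      intro t ht s hs
      have h := (convex_Icc t s).norm_image_sub_le_of_norm_hasDerivWithin_le (C := 2 * T)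
        (f := fun x => (w x).1 - (v x).1) (f' := fun x => 2 * F 0 (w x).2 - 2 * F 0 (v x).2)
        (fun u hu => by
          have hu' : u ∈ Ioo a X := ⟨ht.1.trans_le hu.1, (hu.2.trans hs.2).trans_lt hb.2⟩
          have h1 : HasDerivAt (fun x => (w x).1) (2 * F 0 (w u).2) u :=
            (hwr.hasDerivAt u hu').fst
          have h2 : HasDerivAt (fun x => (v x).1) (2 * F 0 (v u).2) u :=
            (hv.hasDerivAt u hu').fst
          exact (h1.sub h2).hasDerivWithinAt)
        (fun u hu => by
          rw [Real.norm_eq_abs, ← mul_sub, abs_mul, abs_two]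
          have := hp u ⟨ht.1.le.trans hu.1, hu.2.trans hs.2⟩
          linarith)
        (left_mem_Icc.2 hs.1) (right_mem_Icc.2 hs.1)
      rw [Real.norm_eq_abs, Real.norm_eq_abs, abs_of_nonneg (sub_nonneg.2 hs.1)] at h
      refine h.trans ?_
      have : s - t ≤ X := by linarith [hs.2, hb.2, ht.1]
      gcongr
    have hia : |(w a).1 - (v a).1| ≤ 2 * M * a := by
      rw [hva]
      exact hw.abs_fst_le a (hsub a ⟨le_rfl, hb.1⟩)
    rcases hz.1.eq_or_lt with h | h
    · rw [hm, ← h]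
      have : 0 ≤ 2 * T * X := by positivity
      linarith
    · have hcont : ContinuousWithinAt (fun t => |(w t).1 - (v t).1|) (Ioi a) a := by
        have h1 : ContinuousWithinAt (fun t => |(w t).1 - (v t).1|) (Icc a b) a :=
          (((continuous_fst.comp_continuousOn hwcon).sub
            (continuous_fst.comp_continuousOn hvcon)).abs) a ⟨le_rfl, hb.1⟩
        exact h1.mono_of_mem_nhdsWithin (Icc_mem_nhdsGT (h.trans_le hz.2))
      have hlim : Tendsto (fun t => |(w t).1 - (v t).1| + 2 * T * X) (𝓝[>] a)
          (𝓝 (|(w a).1 - (v a).1| + 2 * T * X)) := hcont.add_const _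
      have : m ≤ |(w a).1 - (v a).1| + 2 * T * X := by
        refine ge_of_tendsto hlim ?_
        filter_upwards [Ioo_mem_nhdsGT h] with t ht
        have h1 := hmv t ⟨ht.1, ht.2.trans_le hz.2⟩ z ⟨ht.2.le, hz.2⟩
        have h2 := abs_sub_abs_le_abs_sub ((w z).1 - (v z).1) ((w t).1 - (v t).1)
        linarith
      linarith
  have h1 : 2 * M * c * X * m ≤ m / 4 := by
    have : 2 * M * c * X = c * (4 * M * X) / 2 := by ring
    rw [this]
    nlinarith
  have h2 : T ≤ M * (2 * M + 1) * a + m / 4 := by linarith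
  have h3 : 2 * T * X ≤ 2 * T := by nlinarith
  have h4 : m ≤ 4 * M * (2 * M + 2) * a := by nlinarith
  refine ⟨(hmax ⟨hb.1, le_rfl⟩).trans h4, (hp b ⟨hb.1, le_rfl⟩).trans ?_⟩
  have : 0 ≤ M * a := by positivity
  nlinarith

end IsBarrierSolution

/-- A solution of the profile system on the whole interval `(0, X)`, as the limit of solutions with
initial points `a ↘ 0`. -/
theorem exists_isBarrierSolution_zero (hF : IsIncreasingJet F δ M k) (hk : 3 ≤ k) (hσ : 0 < σ)
    (hδ : 0 < δ) (hM : 0 < M) (hX : IsSmallInterval σ M δ X) :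
    ∃ w : ℝ → ℝ × ℝ, IsBarrierSolution F σ M 0 X w := by
  have hX0 := hX.pos
  set a : ℕ → ℝ := fun n => X / (n + 2) with ha
  have ha0 : ∀ n, 0 < a n := fun n => by positivity
  have haX : ∀ n, a n ≤ X := fun n => div_le_self hX0.le (by
    have : (0 : ℝ) ≤ n := n.cast_nonneg
    linarith)
  have hanti : StrictAnti a := fun n l hnl => by
    have : (n : ℝ) < l := by exact_mod_cast hnl
    simp only [ha]
    gcongr
  have halim : Tendsto a atTop (𝓝 0) :=
    (tendsto_natCast_atTop_atTop.atTop_add tendsto_const_nhds).const_div_atTop X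
  choose w hwa hwc hw using fun n => exists_isBarrierSolution hF hk hσ hδ hX (ha0 n) (haX n)
  obtain ⟨η, hη, hη'⟩ := hF.exists_lower_bound (by omega) hδ
  set C := 4 * M * (2 * M + 2) * (1 + η⁻¹) with hC
  have hC0 : 0 ≤ C := by positivity
  have hdist : ∀ n l, n ≤ l → ∀ x ∈ Ioo (a n) X, dist (w l x) (w n x) ≤ C * a n := by
    intro n l hnl x hx
    rcases hnl.eq_or_lt with rfl | hlt
    · rw [dist_self]; exact mul_nonneg hC0 (ha0 n).le
    have hal := hanti hlt
    obtain ⟨h1, h2⟩ := IsBarrierSolution.abs_sub_le hF hk hσ hδ hM hX (ha0 l) hal (hw l) (hw n)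
      (hwa n) (hwc n) ⟨hx.1.le, hx.2⟩
    have han := (ha0 n).le
    have b1 := ((hw l).mem_profileBox hM.le hσ hX ⟨hal.trans hx.1, hx.2⟩).2
    have b2 := ((hw n).mem_profileBox hM.le hσ hX hx).2
    have h3 := (hF.mul_abs_sub_le (by omega) hδ hη' b1 b2).trans h2
    have h4 : |(w l x).2 - (w n x).2| ≤ η⁻¹ * (4 * M * (2 * M + 2) * a n) := by
      rw [inv_mul_eq_div, le_div_iff₀ hη, mul_comm]; exact h3
    have h5 : 0 ≤ 4 * M * (2 * M + 2) * a n := by positivity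
    have h6 : 0 ≤ η⁻¹ * (4 * M * (2 * M + 2) * a n) := by positivity
    rw [Prod.dist_eq, Real.dist_eq, Real.dist_eq]
    refine max_le ?_ ?_ <;> rw [hC] <;> linarith
  have hlim : ∀ x, ∃ z, x ∈ Ioo 0 X → Tendsto (fun n => w n x) atTop (𝓝 z) := by
    intro x
    by_cases hx : x ∈ Ioo 0 X
    swap
    · exact ⟨0, fun h => absurd h hx⟩
    obtain ⟨n₀, hn₀⟩ := (halim.eventually_lt_const hx.1).exists
    have hca : CauchySeq (fun n => w (n + n₀) x) := by
      refine cauchySeq_of_le_tendsto_0' (fun n => C * a (n + n₀)) (fun n l hnl => ?_) ?_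
      · rw [dist_comm]
        exact hdist _ _ (by omega) x ⟨(hanti.antitone (by omega)).trans_lt hn₀, hx.2⟩
      · simpa using (((tendsto_add_atTop_iff_nat n₀).2 halim).const_mul C)
    obtain ⟨z, hz⟩ := cauchySeq_tendsto_of_complete hca
    exact ⟨z, fun _ => (tendsto_add_atTop_iff_nat n₀).1 hz⟩
  choose W hW using hlim
  have hWdist : ∀ n, ∀ x ∈ Ioo (a n) X, dist (W x) (w n x) ≤ C * a n := by
    intro n x hx
    have := (hW x ⟨(ha0 n).trans hx.1, hx.2⟩).dist (tendsto_const_nhds (x := w n x))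
    exact le_of_tendsto this ((eventually_ge_atTop n).mono fun l hl => hdist n l hl x hx)
  have hev : ∀ x ∈ Ioo 0 X, ∀ᶠ n in atTop, x ∈ Ioo (a n) X := fun x hx =>
    (halim.eventually_lt_const hx.1).mono fun n hn => ⟨hn, hx.2⟩
  have hWbox : ∀ x ∈ Ioo 0 X, W x ∈ profileBox σ δ := fun x hx =>
    (isClosed_Icc.prod isClosed_Icc).mem_of_tendsto (hW x hx)
      ((hev x hx).mono fun n hn => (hw n).mem_profileBox hM.le hσ hX hn)
  refine ⟨W, fun x₀ hx₀ => ?_, fun x hx => ?_, fun x hx => ?_⟩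
  · obtain ⟨K, hK⟩ := hF.exists_lipschitz_profileField hk hσ hδ (half_pos hx₀.1) (X := X)
    have hx₀s : x₀ ∈ Ioo (x₀ / 2) X := ⟨half_lt_self hx₀.1, hx₀.2⟩
    have hsub : ∀ x ∈ Ioo (x₀ / 2) X, x ∈ Ioo 0 X := fun x hx => ⟨(half_pos hx₀.1).trans hx.1, hx.2⟩
    have hn : ∀ᶠ n in atTop, a n < x₀ / 2 := halim.eventually_lt_const (half_pos hx₀.1)
    refine hasDerivAt_of_tendstoUniformlyOn (f := w) (l := atTop)
      (f' := fun n x => profileField F x (w n x))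
      (g' := fun x => profileField F x (W x)) isOpen_Ioo ?_ ?_ (fun x hx => hW x (hsub x hx)) hx₀s
    · rw [Metric.tendstoUniformlyOn_iff]
      intro ε hε
      have h1 : Tendsto (fun n => K * (C * a n)) atTop (𝓝 0) := by
        simpa using (halim.const_mul C).const_mul (K : ℝ)
      filter_upwards [hn, h1.eventually_lt_const hε] with n hn hnε x hx
      refine lt_of_le_of_lt ?_ hnε
      have hx' : x ∈ Ioo (a n) X := ⟨hn.trans hx.1, hx.2⟩
      exact ((hK x (Ioo_subset_Icc_self hx)).dist_le_mul _ (hWbox x (hsub x hx)) _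
        ((hw n).mem_profileBox hM.le hσ hX hx')).trans
        (mul_le_mul_of_nonneg_left (hWdist n x hx') K.2)
    · exact hn.mono fun n hn x hx => (hw n).hasDerivAt x ⟨hn.trans hx.1, hx.2⟩
  · have := ((continuous_snd.tendsto _).comp (hW x hx)).abs
    exact le_of_tendsto this ((hev x hx).mono fun n hn => (hw n).abs_snd_le x hn)
  · have := (((continuous_fst.tendsto _).comp (hW x hx)).sub_const (σ ^ 2)).abs
    exact le_of_tendsto this ((hev x hx).mono fun n hn => (hw n).abs_fst_le x hn)

/-- A solution within the barriers, as a member of the family of solutions with a given bound `M'`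
for the derivatives of `F`; the barriers may belong to a different bound `M`. -/
noncomputable def IsBarrierSolution.toProfileSolution {M' : ℝ} (hF : IsIncreasingJet F δ M' k)
    (hk : 3 ≤ k) (hσ : 0 < σ) (hδ : 0 < δ) (hM : 0 < M) (hX : IsSmallInterval σ M δ X)
    {w : ℝ → ℝ × ℝ} (h : IsBarrierSolution F σ M 0 X w) : ProfileSolution σ M' k where
  X := X
  δ := δ
  F := F
  y x := (w x).2
  Q x := (w x).1
  X_pos := hX.pos
  δ_pos := hδ
  hasDerivAt_F := hF.hasDerivAt
  abs_F_le := hF.abs_le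
  F_one_bound := by
    obtain ⟨η, hη, h'⟩ := hF.exists_lower_bound (by omega) hδ
    exact ⟨η, hη, fun x hx => h' _ (h.mem_profileBox hM.le hσ hX hx).2⟩
  abs_y_lt x hx := by
    have := (h.mem_profileBox hM.le hσ hX hx).2
    exact abs_lt.2 ⟨by linarith [this.1], by linarith [this.2]⟩
  abs_y_le_one x hx := by
    have h5 : (2 * M + 1) * x ≤ (2 * M + 1) * X := by gcongr; exact hx.2.le
    exact (h.abs_snd_le x hx).trans (h5.trans (hX.barrier.trans (min_le_right _ _)))
  abs_y_le := ⟨_, h.abs_snd_le⟩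
  le_Q x hx := (h.mem_profileBox hM.le hσ hX hx).1.1
  abs_Q_le := ⟨_, h.abs_fst_le⟩
  hasDerivAt_Q x hx := (h.hasDerivAt x hx).fst
  hasDerivAt_y x hx := (h.hasDerivAt x hx).snd

end

/-! ### Decay estimates in the original variable -/

lemma abs_le_mul_of_tendsto_zero {φ φ' : ℝ → ℝ} {x D : ℝ} (hx : 0 < x)
    (hd : ∀ t ∈ Ioc 0 x, HasDerivAt φ (φ' t) t) (hb : ∀ t ∈ Ioc 0 x, |φ' t| ≤ D)
    (h0 : Tendsto φ (𝓝[>] 0) (𝓝 0)) : |φ x| ≤ D * x := by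
  have hD : 0 ≤ D := (abs_nonneg _).trans (hb x ⟨hx, le_rfl⟩)
  have hlim : Tendsto (fun t => D * x + |φ t|) (𝓝[>] 0) (𝓝 (D * x + |0|)) := h0.abs.const_add _
  rw [abs_zero, add_zero] at hlim
  refine ge_of_tendsto hlim ?_
  filter_upwards [Ioo_mem_nhdsGT hx] with t ht
  have hsub : ∀ v ∈ Icc t x, v ∈ Ioc 0 x := fun v hv => ⟨ht.1.trans_le hv.1, hv.2⟩
  have h := (convex_Icc t x).norm_image_sub_le_of_norm_hasDerivWithin_le (C := D) (f := φ)
    (f' := φ') (fun v hv => (hd v (hsub v hv)).hasDerivWithinAt) (fun v hv => hb v (hsub v hv))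
    (left_mem_Icc.2 ht.2.le) (right_mem_Icc.2 ht.2.le)
  rw [Real.norm_eq_abs, Real.norm_eq_abs, abs_of_pos (sub_pos.2 ht.2)] at h
  have h2 : D * (x - t) ≤ D * x := by gcongr; linarith [ht.1]
  linarith [abs_sub_abs_le_abs_sub (φ x) (φ t)]

section

variable {ι : Type*} {X : ι → ℝ}

/-- The families that are `O(x²)` at the origin, uniformly in the family, together with their Euler
derivatives `(x d/dx)^j φ` up to order `N`. -/
def EulerClass (X : ι → ℝ) : ℕ → (ι → ℝ → ℝ) → Prop
  | 0, φ => ∃ C ε : ℝ, 0 < ε ∧ ∀ i, ∀ x ∈ Ioo 0 (X i), x < ε → |φ i x| ≤ C * x ^ 2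
  | N + 1, φ => (∃ C ε : ℝ, 0 < ε ∧ ∀ i, ∀ x ∈ Ioo 0 (X i), x < ε → |φ i x| ≤ C * x ^ 2) ∧
      (∀ i, ∀ x ∈ Ioo 0 (X i), DifferentiableAt ℝ (φ i) x) ∧
      EulerClass X N (fun i x => x * deriv (φ i) x)

namespace EulerClass

variable {N : ℕ} {φ ψ φ' : ι → ℝ → ℝ}

lemma bound (h : EulerClass X N φ) :
    ∃ C ε : ℝ, 0 < ε ∧ ∀ i, ∀ x ∈ Ioo 0 (X i), x < ε → |φ i x| ≤ C * x ^ 2 := by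
  cases N with
  | zero => exact h
  | succ N => exact h.1

lemma congr (h : EulerClass X N ψ) (he : ∀ i, ∀ x ∈ Ioo 0 (X i), φ i x = ψ i x) :
    EulerClass X N φ := by
  have hb : ∃ C ε : ℝ, 0 < ε ∧ ∀ i, ∀ x ∈ Ioo 0 (X i), x < ε → |φ i x| ≤ C * x ^ 2 := by
    obtain ⟨C, ε, hε, hC⟩ := h.bound
    exact ⟨C, ε, hε, fun i x hx hxε => by rw [he i x hx]; exact hC i x hx hxε⟩
  induction N generalizing φ ψ with
  | zero => exact hb
  | succ N ih =>
    have hev : ∀ i, ∀ x ∈ Ioo 0 (X i), φ i =ᶠ[𝓝 x] ψ i := fun i x hx => by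
      filter_upwards [isOpen_Ioo.mem_nhds hx] with t ht using he i t ht
    have he' : ∀ i, ∀ x ∈ Ioo 0 (X i), x * deriv (φ i) x = x * deriv (ψ i) x := fun i x hx => by
      rw [(hev i x hx).deriv_eq]
    refine ⟨hb, fun i x hx => (h.2.1 i x hx).congr_of_eventuallyEq (hev i x hx),
      ih h.2.2 he' ?_⟩
    obtain ⟨C, ε, hε, hC⟩ := h.2.2.bound
    exact ⟨C, ε, hε, fun i x hx hxε => by rw [he' i x hx]; exact hC i x hx hxε⟩

lemma of_hasDerivAt (hb : EulerClass X 0 φ)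
    (hd : ∀ i, ∀ x ∈ Ioo 0 (X i), HasDerivAt (φ i) (φ' i x) x)
    (h' : EulerClass X N (fun i x => x * φ' i x)) : EulerClass X (N + 1) φ :=
  ⟨hb, fun i x hx => (hd i x hx).differentiableAt,
    h'.congr fun i x hx => by rw [(hd i x hx).deriv]⟩

lemma add (h : EulerClass X N φ) (h' : EulerClass X N ψ) :
    EulerClass X N (fun i x => φ i x + ψ i x) := by
  induction N generalizing φ ψ with
  | zero =>
    obtain ⟨C, ε, hε, hC⟩ := h
    obtain ⟨C', ε', hε', hC'⟩ := h'
    refine ⟨C + C', min ε ε', lt_min hε hε', fun i x hx hxe => ?_⟩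
    rw [add_mul]
    exact (abs_add_le _ _).trans (add_le_add (hC i x hx (hxe.trans_le (min_le_left _ _)))
      (hC' i x hx (hxe.trans_le (min_le_right _ _))))
  | succ N ih =>
    have h0 : EulerClass X 0 (fun i x => φ i x + ψ i x) := by
      obtain ⟨C, ε, hε, hC⟩ := h.1
      obtain ⟨C', ε', hε', hC'⟩ := h'.1
      refine ⟨C + C', min ε ε', lt_min hε hε', fun i x hx hxe => ?_⟩
      rw [add_mul]
      exact (abs_add_le _ _).trans (add_le_add (hC i x hx (hxe.trans_le (min_le_left _ _)))
        (hC' i x hx (hxe.trans_le (min_le_right _ _))))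
    refine of_hasDerivAt h0 (fun i x hx => (h.2.1 i x hx).hasDerivAt.add (h'.2.1 i x hx).hasDerivAt)
      ((ih h.2.2 h'.2.2).congr fun i x _ => by ring)

lemma const_mul (a : ℝ) (h : EulerClass X N φ) : EulerClass X N (fun i x => a * φ i x) := by
  have h0 : EulerClass X 0 (fun i x => a * φ i x) := by
    obtain ⟨C, ε, hε, hC⟩ := h.bound
    refine ⟨|a| * C, ε, hε, fun i x hx hxe => ?_⟩
    rw [abs_mul, mul_assoc]
    exact mul_le_mul_of_nonneg_left (hC i x hx hxe) (abs_nonneg a)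
  induction N generalizing φ with
  | zero => exact h0
  | succ N ih =>
    refine of_hasDerivAt h0 (fun i x hx => (h.2.1 i x hx).hasDerivAt.const_mul a)
      ((ih h.2.2 ?_).congr fun i x _ => by ring)
    obtain ⟨C, ε, hε, hC⟩ := h.2.2.bound
    refine ⟨|a| * C, ε, hε, fun i x hx hxe => ?_⟩
    rw [abs_mul, mul_assoc]
    exact mul_le_mul_of_nonneg_left (hC i x hx hxe) (abs_nonneg a)

lemma pred (h : EulerClass X (N + 1) φ) : EulerClass X N φ := by
  induction N generalizing φ with
  | zero => exact h.1
  | succ N ih => exact ⟨h.1, h.2.1, ih h.2.2⟩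

lemma sq_mul_of_reg (h : Reg (uniformlyBounded X) N φ) :
    EulerClass X N (fun i x => x ^ 2 * φ i x) := by
  have h0 : EulerClass X 0 (fun i x => x ^ 2 * φ i x) := by
    obtain ⟨C, ε, hε, hC⟩ := h.mem
    refine ⟨C, ε, hε, fun i x hx hxe => ?_⟩
    rw [abs_mul, abs_of_nonneg (sq_nonneg x), mul_comm]
    exact mul_le_mul_of_nonneg_right (hC i x hx hxe) (sq_nonneg x)
  induction N generalizing φ with
  | zero => exact h0
  | succ N ih =>
    have h1 : Reg (uniformlyBounded X) N (fun i x => 2 * φ i x + x * deriv (φ i) x) :=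
      ((Reg.const 2).mul h.pred).add (Reg.id.mul h.2.2)
    refine of_hasDerivAt h0 (fun i x hx => ((hasDerivAt_id x).pow 2).mul (h.hasDerivAt hx))
      ((ih h1 ?_).congr fun i x _ => by simp; ring)
    obtain ⟨C, ε, hε, hC⟩ := h1.mem
    refine ⟨C, ε, hε, fun i x hx hxe => ?_⟩
    rw [abs_mul, abs_of_nonneg (sq_nonneg x), mul_comm]
    exact mul_le_mul_of_nonneg_right (hC i x hx hxe) (sq_nonneg x)

/-- A family with bounded derivatives whose members vanish to second order at the origin. -/
lemma of_reg (h : Reg (uniformlyBounded X) (N + 2) φ)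
    (h0 : ∀ i, Tendsto (φ i) (𝓝[>] 0) (𝓝 0))
    (h1 : ∀ i, Tendsto (deriv (φ i)) (𝓝[>] 0) (𝓝 0)) : EulerClass X (N + 2) φ := by
  obtain ⟨C, ε, hε, hC⟩ := h.2.2.2.2.mem
  have hb1 : ∀ i, ∀ x ∈ Ioo 0 (X i), x < ε → |deriv (φ i) x| ≤ C * x := fun i x hx hxε =>
    abs_le_mul_of_tendsto_zero hx.1
      (fun t ht => Reg.hasDerivAt h.2.2 ⟨ht.1, ht.2.trans_lt hx.2⟩)
      (fun t ht => hC i t ⟨ht.1, ht.2.trans_lt hx.2⟩ (ht.2.trans_lt hxε)) (h1 i)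
  have hb0 : EulerClass X 0 φ := by
    refine ⟨C, ε, hε, fun i x hx hxε => ?_⟩
    have hC0 : 0 ≤ C := (abs_nonneg _).trans (hC i x hx hxε)
    rw [sq, ← mul_assoc]
    refine abs_le_mul_of_tendsto_zero hx.1 (fun t ht => h.hasDerivAt ⟨ht.1, ht.2.trans_lt hx.2⟩)
      (fun t ht => ?_) (h0 i)
    refine (hb1 i t ⟨ht.1, ht.2.trans_lt hx.2⟩ (ht.2.trans_lt hxε)).trans ?_
    gcongr
    exact ht.2
  have hV0 : EulerClass X 0 (fun i x => x * deriv (φ i) x) := by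
    refine ⟨C, ε, hε, fun i x hx hxε => ?_⟩
    rw [abs_mul, abs_of_pos hx.1]
    calc x * |deriv (φ i) x| ≤ x * (C * x) :=
          mul_le_mul_of_nonneg_left (hb1 i x hx hxε) hx.1.le
      _ = C * x ^ 2 := by ring
  have hV : ∀ m ≤ N + 1, EulerClass X m (fun i x => x * deriv (φ i) x) := by
    intro m
    induction m with
    | zero => exact fun _ => hV0
    | succ m ih =>
      intro hm
      refine of_hasDerivAt hV0 (fun i x hx => (hasDerivAt_id x).mul (Reg.hasDerivAt h.2.2 hx)) ?_
      exact ((ih (by omega)).add (sq_mul_of_reg (h.2.2.2.2.of_le (by omega)))).congr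
        fun i x _ => by simp; ring
  exact of_hasDerivAt hb0 (fun i x hx => h.hasDerivAt hx) (hV _ le_rfl)

/-- The set of `s > 0` with `1 / s² < X`. -/
def farRegion (X : ℝ) : Set ℝ := {s | 0 < s ∧ 1 < X * s ^ 2}

lemma isOpen_farRegion (X : ℝ) : IsOpen (farRegion X) :=
  (isOpen_lt continuous_const continuous_id).inter
    (isOpen_lt continuous_const (continuous_const.mul (continuous_id.pow 2)))

lemma inv_sq_mem_of_farRegion {X s : ℝ} (hs : s ∈ farRegion X) : (s ^ 2)⁻¹ ∈ Ioo 0 X := by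
  have h0 : 0 < s := hs.1
  refine ⟨by positivity, ?_⟩
  rw [inv_lt_iff_one_lt_mul₀ (by positivity)]
  linarith [hs.2]

lemma hasDerivAt_inv_sq {s : ℝ} (hs : 0 < s) :
    HasDerivAt (fun s : ℝ => (s ^ 2)⁻¹) (-2 * (s ^ 3)⁻¹) s := by
  have h := (hasDerivAt_pow 2 s).fun_inv (by positivity)
  refine h.congr_deriv ?_
  field_simp
  push_cast
  ring

lemma hasDerivAt_zpow_mul_comp {φ φ' : ℝ → ℝ} {X s : ℝ} (hs : s ∈ farRegion X)
    (hd : ∀ x ∈ Ioo 0 X, HasDerivAt φ (φ' x) x) (a : ℤ) :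
    HasDerivAt (fun s : ℝ => s ^ a * φ (s ^ 2)⁻¹)
      (s ^ (a - 1) * (a * φ (s ^ 2)⁻¹ + (-2) * ((s ^ 2)⁻¹ * φ' (s ^ 2)⁻¹))) s := by
  have h0 : s ≠ 0 := hs.1.ne'
  have h1 := (hd _ (inv_sq_mem_of_farRegion hs)).comp s (hasDerivAt_inv_sq hs.1)
  refine ((hasDerivAt_zpow a s (Or.inl h0)).mul h1).congr_deriv ?_
  have h3 : s ^ a = s ^ (a - 1) * s := by rw [← zpow_add_one₀ h0]; simp
  rw [h3]
  simp only [Function.comp]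
  field_simp

/-- Derivatives of the functions `s ↦ s^a φ(1/s²)` for `φ` of Euler class. -/
lemma decay (h : EulerClass X N φ) (a : ℤ) :
    ∃ C ε : ℝ, 0 < ε ∧ ∀ i, ∀ s ∈ farRegion (X i), 1 < ε * s ^ 2 → ∀ j ≤ N,
      |iteratedDeriv j (fun s : ℝ => s ^ a * φ i (s ^ 2)⁻¹) s| ≤ C * s ^ (a - j - 4) := by
  have base : ∃ C ε : ℝ, 0 < ε ∧ ∀ i, ∀ s ∈ farRegion (X i), 1 < ε * s ^ 2 →
      |s ^ a * φ i (s ^ 2)⁻¹| ≤ C * s ^ (a - 4) := by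
    obtain ⟨C, ε, hε, hC⟩ := h.bound
    refine ⟨C, ε, hε, fun i s hs hsε => ?_⟩
    have hs0 : 0 < s := hs.1
    have h1 := hC i _ (inv_sq_mem_of_farRegion hs) (inv_sq_mem_of_farRegion ⟨hs0, hsε⟩).2
    rw [abs_mul, abs_of_pos (zpow_pos hs0 a)]
    have e : C * s ^ (a - 4) = s ^ a * (C * ((s ^ 2)⁻¹) ^ 2) := by
      rw [zpow_sub₀ hs0.ne']
      field_simp
    rw [e]
    exact mul_le_mul_of_nonneg_left h1 (zpow_pos hs0 a).le
  induction N generalizing φ a with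
  | zero =>
    obtain ⟨C, ε, hε, hC⟩ := base
    refine ⟨C, ε, hε, fun i s hs hsε j hj => ?_⟩
    obtain rfl : j = 0 := by omega
    simpa using hC i s hs hsε
  | succ N ih =>
    obtain ⟨C, ε, hε, hC⟩ := base
    have h' : EulerClass X N (fun i x => a * φ i x + (-2) * (x * deriv (φ i) x)) :=
      (h.pred.const_mul a).add (h.2.2.const_mul (-2))
    have base' : ∃ C ε : ℝ, 0 < ε ∧ ∀ i, ∀ s ∈ farRegion (X i), 1 < ε * s ^ 2 →
        |s ^ (a - 1) * ((fun i x => a * φ i x + (-2) * (x * deriv (φ i) x)) i (s ^ 2)⁻¹)| ≤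
          C * s ^ (a - 1 - 4) := by
      obtain ⟨C, ε, hε, hC⟩ := h'.bound
      refine ⟨C, ε, hε, fun i s hs hsε => ?_⟩
      have hs0 : 0 < s := hs.1
      have h1 := hC i _ (inv_sq_mem_of_farRegion hs) (inv_sq_mem_of_farRegion ⟨hs0, hsε⟩).2
      rw [abs_mul, abs_of_pos (zpow_pos hs0 (a - 1))]
      have e : C * s ^ (a - 1 - 4) = s ^ (a - 1) * (C * ((s ^ 2)⁻¹) ^ 2) := by
        rw [zpow_sub₀ hs0.ne' (a - 1)]
        field_simp
      rw [e]
      exact mul_le_mul_of_nonneg_left h1 (zpow_pos hs0 (a - 1)).le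
    obtain ⟨C', ε', hε', hC'⟩ := ih h' (a - 1) base'
    refine ⟨max C C', min ε ε', lt_min hε hε', fun i s hs hsε j hj => ?_⟩
    have hs0 : 0 < s := hs.1
    have hε1 : 1 < ε * s ^ 2 := hsε.trans_le (by gcongr; exact min_le_left _ _)
    have hε2 : 1 < ε' * s ^ 2 := hsε.trans_le (by gcongr; exact min_le_right _ _)
    cases j with
    | zero =>
      have := hC i s hs hε1
      simp only [iteratedDeriv_zero, Nat.cast_zero, sub_zero]
      exact this.trans (mul_le_mul_of_nonneg_right (le_max_left _ _) (zpow_pos hs0 _).le)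
    | succ j =>
      have hev : deriv (fun s : ℝ => s ^ a * φ i (s ^ 2)⁻¹) =ᶠ[𝓝 s] fun s : ℝ => s ^ (a - 1) *
          (a * φ i (s ^ 2)⁻¹ + (-2) * ((s ^ 2)⁻¹ * deriv (φ i) (s ^ 2)⁻¹)) := by
        filter_upwards [(isOpen_farRegion (X i)).mem_nhds hs] with t ht
        exact (hasDerivAt_zpow_mul_comp ht (fun x hx => (h.2.1 i x hx).hasDerivAt) a).deriv
      rw [iteratedDeriv_succ', hev.iteratedDeriv_eq j]
      refine (hC' i s hs hε2 j (by omega)).trans ?_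
      have e : a - 1 - (j : ℤ) - 4 = a - ((j + 1 : ℕ) : ℤ) - 4 := by push_cast; ring
      rw [e]
      exact mul_le_mul_of_nonneg_right (le_max_right _ _) (zpow_pos hs0 _).le

end EulerClass

lemma Reg.contDiffOn {𝒜 : GrowthClass X} {N : ℕ} {φ : ι → ℝ → ℝ} (h : Reg 𝒜 (N + 1) φ) (i : ι) :
    ContDiffOn ℝ N (φ i) (Ioo 0 (X i)) := by
  induction N generalizing φ with
  | zero =>
    exact contDiffOn_zero.2 fun x hx => (h.2.1 i x hx).continuousAt.continuousWithinAt
  | succ N ih =>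
    rw [Nat.cast_succ]
    exact (contDiffOn_succ_iff_deriv_of_isOpen isOpen_Ioo).2
      ⟨fun x hx => (h.2.1 i x hx).differentiableWithinAt, by simp, ih h.2.2⟩

end

/-! ### The radius function of a solution of the profile system -/

namespace ProfileSolution

variable {σ M : ℝ} {k : ℕ}

/-- The radius function `r(s) = s √Q(1/s²)`. -/
noncomputable def rad (i : ProfileSolution σ M k) (s : ℝ) : ℝ := s * √(i.Q (s ^ 2)⁻¹)

/-- The derivative of the radius function. -/
noncomputable def radDeriv (i : ProfileSolution σ M k) (s : ℝ) : ℝ :=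
  i.rad s / s - 2 * i.F 0 (i.y (s ^ 2)⁻¹) / (s * i.rad s)

/-- The remainder `u(s) = r(s) - σ s - c / (σ s)`, where `c = F(0)`. -/
noncomputable def remainder (i : ProfileSolution σ M k) (s : ℝ) : ℝ :=
  i.rad s - σ * s - i.F 0 0 / (σ * s)

variable (i : ProfileSolution σ M k) {s : ℝ}

lemma rad_pos (hσ : 0 < σ) (hs : s ∈ EulerClass.farRegion i.X) : 0 < i.rad s :=
  mul_pos hs.1 (Real.sqrt_pos.2 (i.Q_pos hσ (EulerClass.inv_sq_mem_of_farRegion hs)))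

lemma rad_sq (hσ : 0 < σ) (hs : s ∈ EulerClass.farRegion i.X) :
    i.rad s ^ 2 = s ^ 2 * i.Q (s ^ 2)⁻¹ := by
  rw [rad, mul_pow, Real.sq_sqrt (i.Q_pos hσ (EulerClass.inv_sq_mem_of_farRegion hs)).le]

lemma hasDerivAt_rad (hσ : 0 < σ) (hs : s ∈ EulerClass.farRegion i.X) :
    HasDerivAt i.rad (i.radDeriv s) s := by
  have hx := EulerClass.inv_sq_mem_of_farRegion hs
  have hQ := i.Q_pos hσ hx
  have hs0 : 0 < s := hs.1
  have h1 := ((i.hasDerivAt_Q _ hx).comp s (EulerClass.hasDerivAt_inv_sq hs0)).sqrt hQ.ne'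
  refine ((hasDerivAt_id s).mul h1).congr_deriv ?_
  have hq : 0 < √(i.Q (s ^ 2)⁻¹) := Real.sqrt_pos.2 hQ
  simp only [radDeriv, rad, Function.comp, id]
  field_simp
  ring

lemma hasDerivAt_radDeriv (hσ : 0 < σ) (hk : 1 ≤ k) (hs : s ∈ EulerClass.farRegion i.X) :
    HasDerivAt i.radDeriv (-((1 + i.radDeriv s ^ 2) * i.y (s ^ 2)⁻¹ / i.rad s)) s := by
  have hx := EulerClass.inv_sq_mem_of_farRegion hs
  have hs0 : 0 < s := hs.1
  have hr := i.rad_pos hσ hs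
  have hF := i.F_one_pos hx
  have h0 := (i.hasDerivAt_F 0 (by omega) _ (i.abs_y_lt _ hx)).comp _ (i.hasDerivAt_y _ hx)
  have hp := h0.comp s (EulerClass.hasDerivAt_inv_sq hs0)
  have hd := ((i.hasDerivAt_rad hσ hs).div (hasDerivAt_id s) hs0.ne').sub
    ((hp.const_mul 2).div ((hasDerivAt_id s).mul (i.hasDerivAt_rad hσ hs)) (mul_pos hs0 hr).ne')
  refine hd.congr_deriv ?_
  have hQ : i.Q (s ^ 2)⁻¹ = i.rad s ^ 2 / s ^ 2 := by rw [i.rad_sq hσ hs]; field_simp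
  simp only [profileSlope, radDeriv, Function.comp, id, zero_add, Pi.mul_apply]
  rw [hQ]
  generalize i.F 1 (i.y (s ^ 2)⁻¹) = F₁ at hF ⊢
  generalize i.F 0 (i.y (s ^ 2)⁻¹) = p
  generalize i.y (s ^ 2)⁻¹ = y
  field_simp
  ring

/-- The self-shrinker equation for the radius function. -/
lemma F_y_eq (hσ : 0 < σ) (hs : s ∈ EulerClass.farRegion i.X) :
    i.F 0 (i.y (s ^ 2)⁻¹) = i.rad s * (i.rad s - s * i.radDeriv s) / 2 := by
  have hs0 : 0 < s := hs.1
  have hr := i.rad_pos hσ hs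
  rw [radDeriv]
  field_simp
  ring

lemma contDiffOn_rad (hσ : 0 < σ) : ContDiffOn ℝ k i.rad (EulerClass.farRegion i.X) := by
  have hQ : ContDiffOn ℝ k i.Q (Ioo 0 i.X) :=
    (reg_Q (polynomiallyBounded _) le_rfl Q_sub_mem_polynomiallyBounded
      (reg_polynomiallyBounded hσ k le_rfl)).contDiffOn i
  have h1 : ContDiffOn ℝ k (fun s : ℝ => (s ^ 2)⁻¹) (EulerClass.farRegion i.X) :=
    (contDiffOn_id.pow 2).inv fun _ hs => (pow_pos hs.1 2).ne'
  exact contDiffOn_id.mul ((hQ.comp h1 fun s hs => EulerClass.inv_sq_mem_of_farRegion hs).sqrt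
    fun s hs => (i.Q_pos hσ (EulerClass.inv_sq_mem_of_farRegion hs)).ne')

lemma contDiffOn_remainder (hσ : 0 < σ) :
    ContDiffOn ℝ k i.remainder (EulerClass.farRegion i.X) :=
  ((i.contDiffOn_rad hσ).sub (contDiffOn_const.mul contDiffOn_id)).sub
    (contDiffOn_const.div (contDiffOn_const.mul contDiffOn_id)
      fun _ hs => (mul_pos hσ hs.1).ne')

/-- The function `x ↦ √Q(x) - σ - c x / σ`, whose value at `1 / s²` is `u(s) / s`. -/
noncomputable def slopeRemainder (i : ProfileSolution σ M k) (x : ℝ) : ℝ :=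
  √(i.Q x) - σ - i.F 0 0 / σ * x

lemma hasDerivAt_slopeRemainder (hσ : 0 < σ) {x : ℝ} (hx : x ∈ Ioo 0 i.X) :
    HasDerivAt i.slopeRemainder (i.F 0 (i.y x) / √(i.Q x) - i.F 0 0 / σ) x := by
  have h := (((i.hasDerivAt_Q x hx).sqrt (i.Q_pos hσ hx).ne').sub_const σ).sub
    ((hasDerivAt_id x).const_mul (i.F 0 0 / σ))
  refine h.congr_deriv ?_
  rw [mul_one, mul_div_mul_left _ _ two_ne_zero]

lemma eventually_mem : ∀ᶠ x in 𝓝[>] (0 : ℝ), x ∈ Ioo 0 i.X := Ioo_mem_nhdsGT i.X_pos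

lemma tendsto_sqrt_Q (hσ : 0 < σ) : Tendsto (fun x => √(i.Q x)) (𝓝[>] 0) (𝓝 σ) := by
  obtain ⟨A, hA⟩ := i.abs_Q_le
  have h0 : Tendsto (fun x : ℝ => A * x) (𝓝[>] 0) (𝓝 (A * 0)) :=
    ((continuous_const.mul continuous_id).tendsto 0).mono_left nhdsWithin_le_nhds
  rw [mul_zero] at h0
  have h1 : Tendsto (fun x => i.Q x - σ ^ 2) (𝓝[>] 0) (𝓝 0) :=
    squeeze_zero_norm' (i.eventually_mem.mono fun x hx => hA x hx) h0
  have h2 := (h1.add_const (σ ^ 2)).sqrt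
  simpa [Real.sqrt_sq hσ.le] using h2

lemma tendsto_F_y (hk : 1 ≤ k) : Tendsto (fun x => i.F 0 (i.y x)) (𝓝[>] 0) (𝓝 (i.F 0 0)) := by
  obtain ⟨A, hA⟩ := i.abs_y_le
  have h0 : Tendsto (fun x : ℝ => A * x) (𝓝[>] 0) (𝓝 (A * 0)) :=
    ((continuous_const.mul continuous_id).tendsto 0).mono_left nhdsWithin_le_nhds
  rw [mul_zero] at h0
  have h1 : Tendsto i.y (𝓝[>] 0) (𝓝 0) :=
    squeeze_zero_norm' (i.eventually_mem.mono fun x hx => hA x hx) h0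
  exact (i.hasDerivAt_F 0 (by omega) 0 (by simpa using i.δ_pos)).continuousAt.tendsto.comp h1

lemma eulerClass_slopeRemainder (hσ : 0 < σ) (N : ℕ) :
    EulerClass (X : ProfileSolution σ M (N + 2) → ℝ) (N + 2) slopeRemainder := by
  refine EulerClass.of_reg ?_ (fun i => ?_) (fun i => ?_)
  · refine (((reg_Q_uniformlyBounded hσ (by omega)).sqrt (q := σ ^ 2 / 2) (by positivity)
      fun i x hx => i.le_Q x hx).sub (Reg.const σ)).sub
      ((Reg.const_family (C := M / σ) fun i => ?_).mul Reg.id)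
    rw [abs_div, abs_of_pos hσ]
    have := i.abs_F_le 0 (by omega) 0 (by simpa using i.δ_pos)
    gcongr
  · have hx : Tendsto (fun x : ℝ => i.F 0 0 / σ * x) (𝓝[>] 0) (𝓝 (i.F 0 0 / σ * 0)) :=
      ((continuous_const.mul continuous_id).tendsto 0).mono_left nhdsWithin_le_nhds
    have h := ((i.tendsto_sqrt_Q hσ).sub_const σ).sub hx
    rw [mul_zero, sub_self, sub_zero] at h
    exact h
  · have h := ((i.tendsto_F_y (by omega)).div (i.tendsto_sqrt_Q hσ) hσ.ne').sub_const
      (i.F 0 0 / σ)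
    rw [sub_self] at h
    exact h.congr' (i.eventually_mem.mono fun x hx =>
      (i.hasDerivAt_slopeRemainder hσ hx).deriv.symm)

/-- The decay of the remainder, uniformly over all solutions of the profile system. -/
theorem exists_remainder_bound (σ M : ℝ) (k : ℕ) (hσ : 0 < σ) (hk : 2 ≤ k) :
    ∃ C ε : ℝ, 0 < ε ∧ ∀ i : ProfileSolution σ M k,
      ∀ s ∈ EulerClass.farRegion i.X, 1 < ε * s ^ 2 → ∀ j ≤ k,
        |iteratedDeriv j i.remainder s| * s ^ (j + 3) ≤ C := by
  obtain ⟨N, rfl⟩ : ∃ N, k = N + 2 := ⟨k - 2, by omega⟩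
  obtain ⟨C, ε, hε, h⟩ := (eulerClass_slopeRemainder (M := M) hσ N).decay 1
  refine ⟨C, ε, hε, fun i s hs hsε j hj => ?_⟩
  have hs0 : 0 < s := hs.1
  have hev : i.remainder =ᶠ[𝓝 s] fun s : ℝ => s ^ (1 : ℤ) * i.slopeRemainder (s ^ 2)⁻¹ := by
    filter_upwards [lt_mem_nhds hs0] with t ht
    rw [zpow_one, slopeRemainder, remainder, rad]
    field_simp
  have h1 := h i s hs hsε j hj
  rw [hev.iteratedDeriv_eq j]
  refine (mul_le_mul_of_nonneg_right h1 (pow_nonneg hs0.le _)).trans_eq ?_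
  rw [mul_assoc, ← zpow_natCast, ← zpow_add₀ hs0.ne']
  have : (1 : ℤ) - j - 4 + ((j + 3 : ℕ) : ℤ) = 0 := by push_cast; ring
  rw [this, zpow_zero, mul_one]

end ProfileSolution

/-! ### Hypersurfaces of revolution -/

section

variable {n : ℕ}

@[simp] lemma horizontal_point (x : EuclideanSpace ℝ (Fin n)) (s : ℝ) :
    horizontal (point x s) = x := by
  ext i
  simp [horizontal, point]

@[simp] lemma height_point (x : EuclideanSpace ℝ (Fin n)) (s : ℝ) : height (point x s) = s := by
  simp [height, point]

@[simp] lemma point_horizontal_height (X : Amb n) : point (horizontal X) (height X) = X := by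
  ext i
  refine Fin.lastCases ?_ (fun j => ?_) i <;> simp [horizontal, height, point]

lemma point_add (x y : EuclideanSpace ℝ (Fin n)) (s t : ℝ) :
    point (x + y) (s + t) = point x s + point y t := by
  ext i
  refine Fin.lastCases ?_ (fun j => ?_) i <;> simp [point]

lemma point_smul (c : ℝ) (x : EuclideanSpace ℝ (Fin n)) (s : ℝ) :
    point (c • x) (c * s) = c • point x s := by
  ext i
  refine Fin.lastCases ?_ (fun j => ?_) i <;> simp [point]

lemma inner_eq (X Y : Amb n) :
    inner ℝ X Y = inner ℝ (horizontal X) (horizontal Y) + height X * height Y := by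
  simp only [PiLp.inner_apply, Fin.sum_univ_castSucc, horizontal, height]
  simp [mul_comm]

/-- The projection `(x, s) ↦ x` as a continuous linear map. -/
noncomputable def horizontalL (n : ℕ) : Amb n →L[ℝ] EuclideanSpace ℝ (Fin n) :=
  LinearMap.toContinuousLinearMap
    { toFun := horizontal
      map_add' := fun X Y => by ext i; simp [horizontal]
      map_smul' := fun c X => by ext i; simp [horizontal] }

/-- The projection `(x, s) ↦ s` as a continuous linear map. -/
noncomputable def heightL (n : ℕ) : Amb n →L[ℝ] ℝ :=
  LinearMap.toContinuousLinearMap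
    { toFun := height
      map_add' := fun X Y => by simp [height]
      map_smul' := fun c X => by simp [height] }

/-- The map `(x, s) ↦ (x, s)` into `ℝⁿ⁺¹` as a continuous linear map. -/
noncomputable def pointL (n : ℕ) : EuclideanSpace ℝ (Fin n) × ℝ →L[ℝ] Amb n :=
  LinearMap.toContinuousLinearMap
    { toFun := fun p => point p.1 p.2
      map_add' := fun p q => point_add p.1 q.1 p.2 q.2
      map_smul' := fun c p => point_smul c p.1 p.2 }

@[simp] lemma horizontalL_apply (X : Amb n) : horizontalL n X = horizontal X := rfl

@[simp] lemma heightL_apply (X : Amb n) : heightL n X = height X := rfl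

lemma continuous_horizontal : Continuous (horizontal : Amb n → _) := (horizontalL n).continuous

lemma continuous_height : Continuous (height : Amb n → ℝ) := (heightL n).continuous

lemma hasDerivAt_point {x : ℝ → EuclideanSpace ℝ (Fin n)} {s : ℝ → ℝ} {x'} {s' t : ℝ}
    (hx : HasDerivAt x x' t) (hs : HasDerivAt s s' t) :
    HasDerivAt (fun t => point (x t) (s t)) (point x' s') t :=
  (pointL n).hasFDerivAt.comp_hasDerivAt t (hx.prodMk hs)

lemma norm_point_sq (x : EuclideanSpace ℝ (Fin n)) (s : ℝ) : ‖point x s‖ ^ 2 = ‖x‖ ^ 2 + s ^ 2 := by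
  rw [← real_inner_self_eq_norm_sq, inner_eq, horizontal_point, height_point,
    real_inner_self_eq_norm_sq]
  ring

/-- A radius function on `[a, ∞)`: positive and `C^m`, up to and beyond the end point `a`. -/
structure IsRadius (m : ℕ) (r : ℝ → ℝ) (b a : ℝ) : Prop where
  lt : b < a
  contDiffOn : ContDiffOn ℝ m r (Ioi b)
  pos : ∀ s, b < s → 0 < r s

lemma mem_revolution {r : ℝ → ℝ} {J : Set ℝ} (hr : ∀ s ∈ J, 0 < r s) {X : Amb n} :
    X ∈ revolution n r J ↔ height X ∈ J ∧ ‖horizontal X‖ = r (height X) := by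
  constructor
  · rintro ⟨ν, hν, s, hs, rfl⟩
    rw [mem_sphere_zero_iff_norm] at hν
    rw [height_point, horizontal_point, norm_smul, hν, mul_one, Real.norm_eq_abs,
      abs_of_pos (hr s hs)]
    exact ⟨hs, rfl⟩
  · rintro ⟨hs, h⟩
    have h0 := hr _ hs
    refine ⟨(r (height X))⁻¹ • horizontal X, ?_, height X, hs, ?_⟩
    · rw [mem_sphere_zero_iff_norm, norm_smul, h, norm_inv, Real.norm_eq_abs, abs_of_pos h0,
        inv_mul_cancel₀ h0.ne']
    · rw [smul_smul, mul_inv_cancel₀ h0.ne', one_smul, point_horizontal_height]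

/-- The defining function `|x|² - r(s)²` of a hypersurface of revolution. -/
noncomputable def revEquation (r : ℝ → ℝ) (X : Amb n) : ℝ := ‖horizontal X‖ ^ 2 - r (height X) ^ 2

lemma revEquation_eq_zero_iff {r : ℝ → ℝ} {X : Amb n} (h : 0 < r (height X)) :
    revEquation r X = 0 ↔ ‖horizontal X‖ = r (height X) := by
  rw [revEquation, sub_eq_zero, sq_eq_sq₀ (norm_nonneg _) h.le]

lemma hasFDerivAt_revEquation {r : ℝ → ℝ} {r' : ℝ} {X : Amb n}
    (h : HasDerivAt r r' (height X)) :
    HasFDerivAt (revEquation r) (2 • ((innerSL ℝ (horizontal X)).comp (horizontalL n)) -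
      (2 * r (height X) * r') • heightL n) X := by
  have h1 : HasFDerivAt (fun Y : Amb n => ‖horizontalL n Y‖ ^ 2)
      (2 • ((innerSL ℝ (horizontal X)).comp (horizontalL n))) X :=
    (horizontalL n).hasFDerivAt.norm_sq
  have h2 := (h.comp_hasFDerivAt X (heightL n).hasFDerivAt).pow 2
  refine (h1.sub h2).congr_fderiv ?_
  ext v
  simp
  ring

namespace IsRadius

variable {m : ℕ} {r : ℝ → ℝ} {b a : ℝ}

lemma hasDerivAt (hr : IsRadius m r b a) (hm : 1 ≤ m) {s : ℝ} (hs : b < s) :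
    HasDerivAt r (deriv r s) s :=
  ((hr.contDiffOn.contDiffAt (Ioi_mem_nhds hs)).differentiableAt
    (by exact_mod_cast (by omega : m ≠ 0))).hasDerivAt

lemma derivWithin_eq (hr : IsRadius m r b a) (hm : 1 ≤ m) {s : ℝ} (hs : a ≤ s) :
    derivWithin r (Ici a) s = deriv r s :=
  (hr.hasDerivAt hm (hr.lt.trans_le hs)).hasDerivWithinAt.derivWithin (uniqueDiffOn_Ici a s hs)

lemma mem_iff (hr : IsRadius m r b a) {X : Amb n} :
    X ∈ revolution n r (Ici a) ↔ a ≤ height X ∧ ‖horizontal X‖ = r (height X) :=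
  mem_revolution fun s hs => hr.pos s (hr.lt.trans_le hs)

lemma contDiffOn_revEquation (hr : IsRadius m r b a) :
    ContDiffOn ℝ m (revEquation r : Amb n → ℝ) {X | b < height X} := by
  have h1 : ContDiff ℝ m (fun X : Amb n => ‖horizontal X‖ ^ 2) :=
    (horizontalL n).contDiff.norm_sq ℝ
  exact h1.contDiffOn.sub
    ((hr.contDiffOn.comp (heightL n).contDiff.contDiffOn fun X hX => hX).pow 2)

lemma isHypersurface (hr : IsRadius m r b a) (hm : 1 ≤ m) :
    IsHypersurface m (revolution n r (Ici a)) := by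
  have hfd : ∀ X ∈ revolution n r (Ici a), HasFDerivAt (revEquation r)
      (2 • ((innerSL ℝ (horizontal X)).comp (horizontalL n)) -
        (2 * r (height X) * deriv r (height X)) • heightL n) X := fun X hX =>
    hasFDerivAt_revEquation (hr.hasDerivAt hm (hr.lt.trans_le (hr.mem_iff.1 hX).1))
  have hval : ∀ X ∈ revolution n r (Ici a),
      0 < fderiv ℝ (revEquation r) X (point (horizontal X) 0) := by
    intro X hX
    obtain ⟨h1, h2⟩ := hr.mem_iff.1 hX
    rw [(hfd X hX).fderiv]
    have : 0 < ‖horizontal X‖ := by rw [h2]; exact hr.pos _ (hr.lt.trans_le h1)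
    simp
    positivity
  refine ⟨?_, fun X hX => ?_⟩
  · have e : revolution n r (Ici a) =
        {X : Amb n | a ≤ height X} ∩ (fun X => ‖horizontal X‖ - r (height X)) ⁻¹' {0} := by
      ext X
      rw [hr.mem_iff, mem_inter_iff, mem_ofPred_eq, mem_preimage, mem_singleton_iff, sub_eq_zero]
    rw [e]
    refine ContinuousOn.preimage_isClosed_of_isClosed ?_
      (isClosed_le continuous_const continuous_height) isClosed_singleton
    exact continuous_horizontal.norm.continuousOn.sub (hr.contDiffOn.continuousOn.comp
      continuous_height.continuousOn fun X hX => hr.lt.trans_le hX)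
  obtain ⟨h1, h2⟩ := hr.mem_iff.1 hX
  have hne : fderiv ℝ (revEquation r) X ≠ 0 := fun h => by
    have := hval X hX
    rw [h] at this
    simp at this
  rcases h1.eq_or_lt with h1 | h1
  · refine ⟨{Y | b < height Y}, isOpen_lt continuous_const continuous_height, by
      rw [mem_ofPred_eq, ← h1]; exact hr.lt, Or.inr ⟨revEquation r, fun Y => height Y - a,
      hr.contDiffOn_revEquation, ((heightL n).contDiff.sub contDiff_const).contDiffOn, ?_,
      sub_eq_zero.2 h1.symm, ?_⟩⟩
    · have hh : fderiv ℝ (fun Y : Amb n => height Y - a) X = heightL n :=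
        ((heightL n).hasFDerivAt.sub_const a).fderiv
      rw [hh, LinearIndependent.pair_iff]
      intro c d hcd
      have e1 := congrArg (fun L : Amb n →L[ℝ] ℝ => L (point (horizontal X) 0)) hcd
      have e2 := congrArg (fun L : Amb n →L[ℝ] ℝ => L (point 0 1)) hcd
      have hv := hval X hX
      have hc : c = 0 := by simpa [hv.ne'] using e1
      subst hc
      simpa using e2
    · ext Y
      simp only [mem_inter_iff, mem_ofPred_eq, hr.mem_iff]
      constructor
      · rintro ⟨⟨h3, h4⟩, h5⟩
        exact ⟨h5, (revEquation_eq_zero_iff (hr.pos _ h5)).2 h4, by linarith⟩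
      · rintro ⟨h5, h4, h3⟩
        exact ⟨⟨by linarith, (revEquation_eq_zero_iff (hr.pos _ h5)).1 h4⟩, h5⟩
  · refine ⟨{Y | a < height Y}, isOpen_lt continuous_const continuous_height, h1,
      Or.inl ⟨revEquation r, hr.contDiffOn_revEquation.mono fun Y hY => hr.lt.trans hY, hne, ?_⟩⟩
    ext Y
    simp only [mem_inter_iff, mem_ofPred_eq, hr.mem_iff]
    constructor
    · rintro ⟨⟨h3, h4⟩, h5⟩
      exact ⟨h5, (revEquation_eq_zero_iff (hr.pos _ (hr.lt.trans h5))).2 h4⟩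
    · rintro ⟨h5, h4⟩
      exact ⟨⟨h5.le, (revEquation_eq_zero_iff (hr.pos _ (hr.lt.trans h5))).1 h4⟩, h5⟩

/-- The unit normal, by a formula that makes sense on a neighbourhood of the hypersurface. -/
lemma revNormal_eq (hr : IsRadius m r b a) (hm : 1 ≤ m) {X : Amb n} (hX : a ≤ height X) :
    revNormal r a X = (√(1 + deriv r (height X) ^ 2))⁻¹ •
      point (-(‖horizontal X‖⁻¹ • horizontal X)) (deriv r (height X)) := by
  rw [revNormal, hr.derivWithin_eq hm hX]

lemma revNormal_point (hr : IsRadius m r b a) (hm : 1 ≤ m) {ν : EuclideanSpace ℝ (Fin n)}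
    (hν : ‖ν‖ = 1) {s : ℝ} (hs : a ≤ s) :
    revNormal r a (point (r s • ν) s) = (√(1 + deriv r s ^ 2))⁻¹ • point (-ν) (deriv r s) := by
  have h0 := hr.pos s (hr.lt.trans_le hs)
  rw [hr.revNormal_eq hm (by simpa using hs), height_point, horizontal_point, norm_smul, hν,
    mul_one, Real.norm_eq_abs, abs_of_pos h0, smul_smul, inv_mul_cancel₀ h0.ne', one_smul]

/-- Tangent vectors are annihilated by the differential of the defining function. -/
lemma inner_revNormal_eq_zero (hr : IsRadius m r b a) (hm : 1 ≤ m) {X v : Amb n}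
    (hX : X ∈ revolution n r (Ici a)) (hv : v ∈ tangentSpaceAt (revolution n r (Ici a)) X) :
    inner ℝ v (revNormal r a X) = 0 := by
  obtain ⟨h1, h2⟩ := hr.mem_iff.1 hX
  have hs := hr.lt.trans_le h1
  have hr0 := hr.pos _ hs
  rw [hr.revNormal_eq hm h1]
  induction hv using Submodule.span_induction with
  | mem v hv =>
    have hfd := (hasFDerivAt_revEquation (X := X) (hr.hasDerivAt hm hs)).hasFDerivWithinAt
      (s := revolution n r (Ici a))
    have hmaps := hfd.mapsTo_tangent_cone hv
    have himg : revEquation r '' revolution n r (Ici a) ⊆ {0} := by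
      rintro _ ⟨Y, hY, rfl⟩
      obtain ⟨h3, h4⟩ := hr.mem_iff.1 hY
      exact (revEquation_eq_zero_iff (hr.pos _ (hr.lt.trans_le h3))).2 h4
    have h0 := tangentConeAt_mono himg hmaps
    have hX0 : revEquation r X = 0 := himg ⟨X, hX, rfl⟩
    rw [hX0] at h0
    have h3 := tangentConeAt_subset_zero (𝕜 := ℝ) (s := ({0} : Set ℝ)) (x := 0) (by
      rw [accPt_iff_nhds]
      push Not
      exact ⟨univ, univ_mem, by simp⟩) h0
    have h4 : 2 * inner ℝ (horizontal X) (horizontal v) -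
        2 * r (height X) * deriv r (height X) * height v = 0 := by
      simpa using h3
    rw [inner_smul_right, inner_eq, horizontal_point, height_point, inner_neg_right,
      inner_smul_right, real_inner_comm, h2]
    have : inner ℝ (horizontal X) (horizontal v) =
        r (height X) * deriv r (height X) * height v := by
      linarith
    rw [this]
    field_simp
    ring
  | zero => exact inner_zero_left _
  | add v w _ _ hv hw => rw [inner_add_left, hv, hw, add_zero]
  | smul c v _ hv => rw [inner_smul_left, hv, mul_zero]

lemma isUnitNormal (hr : IsRadius m r b a) (hm : 1 ≤ m) :
    IsUnitNormal (revolution n r (Ici a)) (revNormal r a) := by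
  have hne : ∀ X ∈ revolution n r (Ici a), ‖horizontal X‖ ≠ 0 := fun X hX => by
    obtain ⟨h1, h2⟩ := hr.mem_iff.1 hX
    rw [h2]
    exact (hr.pos _ (hr.lt.trans_le h1)).ne'
  refine ⟨?_, fun X hX => ?_, fun X hX v hv => hr.inner_revNormal_eq_zero hm hX hv⟩
  · have hd : ContinuousOn (deriv r) (Ioi b) :=
      (hr.contDiffOn.continuousOn_deriv_of_isOpen isOpen_Ioi (by exact_mod_cast hm))
    have hd' : ContinuousOn (fun X : Amb n => deriv r (height X)) (revolution n r (Ici a)) :=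
      hd.comp continuous_height.continuousOn fun X hX => hr.lt.trans_le (hr.mem_iff.1 hX).1
    have hc : ContinuousOn (fun X : Amb n => (√(1 + deriv r (height X) ^ 2))⁻¹ •
        point (-(‖horizontal X‖⁻¹ • horizontal X)) (deriv r (height X)))
        (revolution n r (Ici a)) := by
      refine ((continuousOn_const.add (hd'.pow 2)).sqrt.inv₀ fun X _ =>
        (Real.sqrt_pos.2 (by positivity : (0 : ℝ) < 1 + deriv r (height X) ^ 2)).ne').smul ?_
      refine (pointL n).continuous.comp_continuousOn (ContinuousOn.prodMk ?_ hd')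
      exact ((continuous_horizontal.norm.continuousOn.inv₀ hne).smul
        continuous_horizontal.continuousOn).neg
    exact hc.congr fun X hX => hr.revNormal_eq hm (hr.mem_iff.1 hX).1
  · obtain ⟨h1, h2⟩ := hr.mem_iff.1 hX
    rw [hr.revNormal_eq hm h1, norm_smul, ← sq_eq_sq₀ (by positivity) zero_le_one, mul_pow,
      norm_point_sq, norm_neg, norm_smul, norm_inv, norm_inv, norm_norm, inv_mul_cancel₀ (hne X hX),
      Real.norm_eq_abs, abs_of_nonneg (Real.sqrt_nonneg _), inv_pow,
      Real.sq_sqrt (by positivity)]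
    field_simp

end IsRadius

end

/-! ### Principal curvatures of hypersurfaces of revolution -/

section

/-- The velocity of a curve in `S` belongs to the tangent space. -/
lemma mem_tangentSpaceAt_of_curve {n : ℕ} {S : Set (Amb n)} {X v : Amb n} {γ : ℝ → Amb n}
    (hγ : HasDerivAt γ v 0) (h0 : γ 0 = X) (hS : ∀ t, 0 ≤ t → γ t ∈ S) :
    v ∈ tangentSpaceAt S X := by
  refine Submodule.subset_span ?_
  have h1 : (1 : ℝ) ∈ tangentConeAt ℝ (Ici (0 : ℝ)) 0 := by
    have := mem_tangentConeAt_of_segment_subset (s := Ici (0 : ℝ)) (x := 0) (y := 1) (by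
      rw [segment_eq_Icc zero_le_one]
      exact Icc_subset_Ici_self)
    simpa using this
  have h2 := (hγ.hasFDerivAt.hasFDerivWithinAt (s := Ici (0 : ℝ))).mapsTo_tangent_cone h1
  rw [h0] at h2
  have h3 : γ '' Ici 0 ⊆ S := by
    rintro _ ⟨t, ht, rfl⟩
    exact hS t ht
  simpa using tangentConeAt_mono h3 h2

/-- The principal directions of a hypersurface of revolution at `(r ν, s)`: the directions `b i` of
the parallel, where `b` is an orthonormal basis with last vector `ν`, and the direction `(p ν, 1)`
of the profile curve of slope `p`, which takes the last place. -/
noncomputable def revFrame {m : ℕ} (b : Fin (m + 1) → EuclideanSpace ℝ (Fin (m + 1))) (p : ℝ)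
    (i : Fin (m + 1)) : Amb (m + 1) :=
  if i = Fin.last m then (√(1 + p ^ 2))⁻¹ • point (p • b i) 1 else point (b i) 0

lemma orthonormal_revFrame {m : ℕ} {b : Fin (m + 1) → EuclideanSpace ℝ (Fin (m + 1))}
    (hb : Orthonormal ℝ b) (p : ℝ) : Orthonormal ℝ (revFrame b p) := by
  rw [orthonormal_iff_ite] at hb ⊢
  intro i j
  have hp : √(1 + p ^ 2) * √(1 + p ^ 2) = 1 + p ^ 2 := Real.mul_self_sqrt (by positivity)
  have hp0 : √(1 + p ^ 2) ≠ 0 := (Real.sqrt_pos.2 (by positivity)).ne'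
  unfold revFrame
  by_cases hi : i = Fin.last m <;> by_cases hj : j = Fin.last m
  · rw [if_pos hi, if_pos hj, inner_smul_left, inner_smul_right, inner_eq, horizontal_point,
      horizontal_point, height_point, height_point, inner_smul_left, inner_smul_right, hb]
    have : i = j := hi.trans hj.symm
    simp only [this, if_true]
    simp
    field_simp
    rw [sq √(1 + p ^ 2), hp]
    ring
  · have hij : i ≠ j := fun h => hj (h ▸ hi)
    rw [if_pos hi, if_neg hj, inner_smul_left, inner_eq, horizontal_point, horizontal_point,
      height_point, height_point, inner_smul_left, hb, if_neg hij]
    simp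
  · have hij : i ≠ j := fun h => hi (h ▸ hj)
    rw [if_neg hi, if_pos hj, inner_smul_right, inner_eq, horizontal_point, horizontal_point,
      height_point, height_point, inner_smul_right, hb, if_neg hij]
    simp
  · rw [if_neg hi, if_neg hj, inner_eq, horizontal_point, horizontal_point, height_point,
      height_point, hb]
    simp

/-- The principal curvatures of a hypersurface of revolution, in terms of the radius `r`, its slope
`p` and its second derivative `r₂`. -/
noncomputable def revCurvatures (m : ℕ) (r p r₂ : ℝ) (i : Fin (m + 1)) : ℝ :=
  if i = Fin.last m then -r₂ * (√(1 + p ^ 2))⁻¹ ^ 3 else (√(1 + p ^ 2))⁻¹ / r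

namespace IsRadius

variable {m k : ℕ} {r : ℝ → ℝ} {b a : ℝ}

lemma differentiableAt_deriv (hr : IsRadius k r b a) (hk : 2 ≤ k) {s : ℝ} (hs : b < s) :
    DifferentiableAt ℝ (deriv r) s := by
  have h2 : ContDiffOn ℝ (1 + 1) r (Ioi b) :=
    hr.contDiffOn.of_le (by norm_num; exact_mod_cast hk)
  exact (((contDiffOn_succ_iff_deriv_of_isOpen isOpen_Ioi).1 h2).2.2.contDiffAt
    (Ioi_mem_nhds hs)).differentiableAt one_ne_zero

/-- The curvatures are found by differentiating the unit normal along the profile curve and along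
great circles of the parallel. -/
lemma hasPrincipalCurvatures (hr : IsRadius k r b a) (hk : 2 ≤ k)
    {ν : EuclideanSpace ℝ (Fin (m + 1))} (hν : ‖ν‖ = 1) {s : ℝ} (hs : a ≤ s) :
    HasPrincipalCurvatures (revolution (m + 1) r (Ici a)) (revNormal r a) (point (r s • ν) s)
      (revCurvatures m (r s) (deriv r s) (deriv (deriv r) s)) := by
  have hbs : b < s := hr.lt.trans_le hs
  have hr0 := hr.pos s hbs
  have hk1 : 1 ≤ k := by omega
  set X := point (r s • ν) s with hX
  have hXS : X ∈ revolution (m + 1) r (Ici a) :=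
    ⟨ν, mem_sphere_zero_iff_norm.2 hν, s, hs, rfl⟩
  set p := deriv r s with hp
  set r₂ := deriv (deriv r) s with hr₂
  set A := (√(1 + p ^ 2))⁻¹ with hA
  have hA2 : A ^ 2 * (1 + p ^ 2) = 1 := by
    rw [hA, inv_pow, Real.sq_sqrt (by positivity)]
    exact inv_mul_cancel₀ (by positivity)
  have hA0 : 0 < A := by positivity
  obtain ⟨B, hB⟩ : ∃ B : OrthonormalBasis (Fin (m + 1)) ℝ (EuclideanSpace ℝ (Fin (m + 1))),
      B (Fin.last m) = ν := by
    have : Orthonormal ℝ (({Fin.last m} : Set (Fin (m + 1))).domRestrict fun _ => ν) := by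
      rw [orthonormal_iff_ite]
      rintro ⟨i, rfl⟩ ⟨j, rfl⟩
      simp [hν]
    obtain ⟨B, hB⟩ := this.exists_orthonormalBasis_extension_of_card_eq (by simp)
    exact ⟨B, hB _ rfl⟩
  have hhX : height X = s := height_point _ _
  have hxX : horizontal X = r s • ν := horizontal_point _ _
  -- the profile curve through `X`
  set γ : ℝ → Amb (m + 1) := fun t => point (r (s + t) • ν) (s + t) with hγ
  have hst : HasDerivAt (fun t : ℝ => s + t) 1 0 := by
    simpa using (hasDerivAt_id (0 : ℝ)).const_add s
  have hrt : HasDerivAt (fun t : ℝ => r (s + t)) p 0 := by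
    have h : HasDerivAt r p (s + 0) := by rw [add_zero]; exact hr.hasDerivAt hk1 hbs
    exact (h.comp 0 hst).congr_deriv (mul_one p)
  have hγd : HasDerivAt γ (point (p • ν) 1) 0 := hasDerivAt_point (hrt.smul_const ν) hst
  have hγ0 : γ 0 = X := by simp [hγ, hX]
  have hγS : ∀ t, 0 ≤ t → γ t ∈ revolution (m + 1) r (Ici a) := fun t ht =>
    ⟨ν, mem_sphere_zero_iff_norm.2 hν, s + t, by rw [mem_Ici]; linarith, rfl⟩
  -- the great circles of the parallel through `X`
  set c : Fin (m + 1) → ℝ → Amb (m + 1) := fun i t =>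
    point (r s • (Real.cos t • ν + Real.sin t • B i)) s with hc
  have hcν : ∀ i, HasDerivAt (fun t => Real.cos t • ν + Real.sin t • B i) (B i) 0 := fun i => by
    exact (((Real.hasDerivAt_cos 0).smul_const ν).add
      ((Real.hasDerivAt_sin 0).smul_const (B i))).congr_deriv (by simp)
  have hcd : ∀ i, HasDerivAt (c i) (point (r s • B i) 0) 0 := fun i =>
    hasDerivAt_point ((hcν i).const_smul (r s)) (hasDerivAt_const _ _)
  have hc0 : ∀ i, c i 0 = X := fun i => by simp [hc, hX]
  have hcn : ∀ i, i ≠ Fin.last m → ∀ t, ‖Real.cos t • ν + Real.sin t • B i‖ = 1 := by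
    intro i hi t
    have h1 : inner ℝ (Real.cos t • ν) (Real.sin t • B i) = 0 := by
      rw [inner_smul_left, inner_smul_right, ← hB, B.inner_eq_ite, if_neg (Ne.symm hi)]
      simp
    have h2 := norm_add_sq_eq_norm_sq_add_norm_sq_of_inner_eq_zero _ _ h1
    have h3 : ‖B i‖ = 1 := B.norm_eq_one i
    rw [← sq_eq_sq₀ (norm_nonneg _) zero_le_one, sq, h2, norm_smul, norm_smul, hν, h3,
      Real.norm_eq_abs, Real.norm_eq_abs, mul_one, mul_one, abs_mul_abs_self, abs_mul_abs_self,
      ← sq, ← sq, Real.cos_sq_add_sin_sq, one_pow]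
  have hcS : ∀ i, i ≠ Fin.last m → ∀ t, c i t ∈ revolution (m + 1) r (Ici a) := fun i hi t =>
    ⟨_, mem_sphere_zero_iff_norm.2 (hcn i hi t), s, hs, rfl⟩
  have hon : Orthonormal ℝ (revFrame B p) := orthonormal_revFrame B.orthonormal p
  have hspan : Submodule.span ℝ (Set.range (revFrame B p)) =
      tangentSpaceAt (revolution (m + 1) r (Ici a)) X := by
    have h1 : Submodule.span ℝ (Set.range (revFrame B p)) ≤
        tangentSpaceAt (revolution (m + 1) r (Ici a)) X := by
      rw [Submodule.span_le]
      rintro _ ⟨i, rfl⟩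
      rw [SetLike.mem_coe, revFrame]
      split_ifs with hi
      · rw [hi, hB]
        exact Submodule.smul_mem _ _ (mem_tangentSpaceAt_of_curve hγd hγ0 hγS)
      · have h := mem_tangentSpaceAt_of_curve (hcd i) (hc0 i) fun t _ => hcS i hi t
        have h2 := Submodule.smul_mem _ (r s)⁻¹ h
        rwa [← point_smul, smul_smul, inv_mul_cancel₀ hr0.ne', one_smul, mul_zero] at h2
    set N := revNormal r a X with hN
    have hN1 : ‖N‖ = 1 := (hr.isUnitNormal hk1).norm_eq_one X hXS
    have h2 : tangentSpaceAt (revolution (m + 1) r (Ici a)) X ≤ (ℝ ∙ N)ᗮ := fun v hv =>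
      Submodule.mem_orthogonal_singleton_iff_inner_left.2 (hr.inner_revNormal_eq_zero hk1 hXS hv)
    have hfact : Fact (Module.finrank ℝ (Amb (m + 1)) = m + 1 + 1) := ⟨by simp⟩
    have h3 : Module.finrank ℝ (ℝ ∙ N)ᗮ = m + 1 :=
      Submodule.finrank_orthogonal_span_singleton
        (norm_ne_zero_iff.1 (by rw [hN1]; exact one_ne_zero))
    have h4 : Module.finrank ℝ (Submodule.span ℝ (Set.range (revFrame B p))) = m + 1 := by
      rw [finrank_span_eq_card hon.linearIndependent, Fintype.card_fin]
    have h5 := Submodule.eq_of_le_of_finrank_le (h1.trans h2) (by rw [h3, h4])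
    exact le_antisymm h1 (by rw [h5]; exact h2)
  -- an extension of the unit normal to a neighbourhood of `X`, differentiable at `X`
  set E : Amb (m + 1) → Amb (m + 1) := fun Y => (√(1 + deriv r (height Y) ^ 2))⁻¹ •
    point (-(‖horizontal Y‖⁻¹ • horizontal Y)) (deriv r (height Y)) with hE
  have hEd : DifferentiableAt ℝ E X := by
    have d1 : DifferentiableAt ℝ (fun Y : Amb (m + 1) => deriv r (height Y)) X := by
      have h := hr.differentiableAt_deriv hk hbs
      rw [← hhX] at h
      exact h.comp X (heightL (m + 1)).differentiableAt
    have d2 : DifferentiableAt ℝ (fun Y : Amb (m + 1) => horizontal Y) X :=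
      (horizontalL (m + 1)).differentiableAt
    have hx0 : horizontal X ≠ 0 := by
      rw [hxX]
      exact smul_ne_zero hr0.ne' (norm_ne_zero_iff.1 (by rw [hν]; exact one_ne_zero))
    have d3 : DifferentiableAt ℝ (fun Y : Amb (m + 1) => ‖horizontal Y‖⁻¹) X :=
      (d2.norm ℝ hx0).inv (norm_ne_zero_iff.2 hx0)
    have d4 : DifferentiableAt ℝ (fun Y : Amb (m + 1) => (√(1 + deriv r (height Y) ^ 2))⁻¹) X := by
      have h0 : 0 < 1 + deriv r (height X) ^ 2 := by positivity
      exact (((d1.pow 2).const_add 1).sqrt h0.ne').inv (Real.sqrt_pos.2 h0).ne'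
    exact d4.smul ((pointL (m + 1)).differentiableAt.comp X ((d3.smul d2).neg.prodMk d1))
  have hEW := hEd.hasFDerivAt
  set W := fderiv ℝ E X with hW
  have hNW : HasFDerivWithinAt (revNormal r a) W (revolution (m + 1) r (Ici a)) X :=
    hEW.hasFDerivWithinAt.congr (fun Y hY => hr.revNormal_eq hk1 (hr.mem_iff.1 hY).1)
      (hr.revNormal_eq hk1 (hr.mem_iff.1 hXS).1)
  refine ⟨revFrame B p, W, hon, hspan, hNW, fun i => ?_⟩
  unfold revFrame revCurvatures
  have hEp : ∀ (q : ℝ) (w : EuclideanSpace ℝ (Fin (m + 1))) (t : ℝ), 0 < q → ‖w‖ = 1 →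
      E (point (q • w) t) = (√(1 + deriv r t ^ 2))⁻¹ • point (-w) (deriv r t) := by
    intro q w t hq hw
    simp only [hE, height_point, horizontal_point]
    rw [norm_smul, hw, mul_one, Real.norm_eq_abs, abs_of_pos hq, smul_smul,
      inv_mul_cancel₀ hq.ne', one_smul]
  split_ifs with hi
  · subst hi
    rw [hB]
    have hWγ : HasDerivAt (fun t => E (γ t)) (W (point (p • ν) 1)) 0 := by
      have h := hEW
      rw [← hγ0] at h
      exact h.comp_hasDerivAt 0 hγd
    have hpt : HasDerivAt (fun t => deriv r (s + t)) r₂ 0 := by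
      have h : HasDerivAt (deriv r) r₂ (s + 0) := by
        rw [add_zero]
        exact (hr.differentiableAt_deriv hk hbs).hasDerivAt
      exact (h.comp 0 hst).congr_deriv (mul_one r₂)
    have hAt : HasDerivAt (fun t => (√(1 + deriv r (s + t) ^ 2))⁻¹) (-(p * r₂ * A ^ 3)) 0 := by
      have h0 : 0 < 1 + deriv r (s + 0) ^ 2 := by positivity
      have h := (((hpt.fun_pow 2).const_add 1).sqrt h0.ne').fun_inv (Real.sqrt_pos.2 h0).ne'
      refine h.congr_deriv ?_
      simp only [add_zero, ← hp]
      rw [hA]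
      have : √(1 + p ^ 2) ≠ 0 := (Real.sqrt_pos.2 (by positivity)).ne'
      field_simp
      push_cast
      ring
    have hEγ : (fun t => E (γ t)) =ᶠ[𝓝 0] fun t =>
        (√(1 + deriv r (s + t) ^ 2))⁻¹ • point (-ν) (deriv r (s + t)) := by
      have : ∀ᶠ t in 𝓝 (0 : ℝ), b < s + t := by
        have : Tendsto (fun t : ℝ => s + t) (𝓝 0) (𝓝 (s + 0)) :=
          (continuous_const.add continuous_id).tendsto 0
        rw [add_zero] at this
        exact this.eventually_const_lt hbs
      exact this.mono fun t ht => hEp _ ν _ (hr.pos _ ht) hν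
    have h2 := (hAt.smul
      (hasDerivAt_point (hasDerivAt_const (0 : ℝ) (-ν)) hpt)).congr_of_eventuallyEq
      hEγ
    rw [map_smul, hWγ.unique h2]
    simp only [add_zero, ← hp, ← hA]
    rw [← point_smul, ← point_smul, ← point_add, ← point_smul, ← point_smul, ← point_smul]
    have e2 : A * (A * r₂ + -(p * r₂ * A ^ 3) * p) = -r₂ * A ^ 3 * (A * 1) * (-1) := by
      have : A * (A * r₂ + -(p * r₂ * A ^ 3) * p) =
        r₂ * A ^ 2 * (1 - A ^ 2 * p ^ 2) := by ring
      rw [this, show 1 - A ^ 2 * p ^ 2 = A ^ 2 by linarith]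
      ring
    have e3 : (A • (A • (0 : EuclideanSpace ℝ (Fin (m + 1))) + -(p * r₂ * A ^ 3) • -ν)) =
        -((-r₂ * A ^ 3) • A • p • ν) := by
      module
    rw [e2, e3]
    have : ∀ (x : EuclideanSpace ℝ (Fin (m + 1))) (t : ℝ), point (-x) (t * (-1)) = -point x t :=
      fun x t => by
        rw [← neg_one_smul ℝ x, mul_comm t, point_smul, neg_one_smul]
    rw [this]
  · have hWc : HasDerivAt (fun t => E (c i t)) (W (point (r s • B i) 0)) 0 := by
      have h := hEW
      rw [← hc0 i] at h
      exact h.comp_hasDerivAt 0 (hcd i)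
    have hEc : (fun t => E (c i t)) = fun t =>
        A • point (-(Real.cos t • ν + Real.sin t • B i)) p :=
      funext fun t => hEp _ _ _ hr0 (hcn i hi t)
    have h2 : HasDerivAt (fun t => E (c i t)) (A • point (-(B i)) 0) 0 := by
      rw [hEc]
      exact (hasDerivAt_point (hcν i).neg (hasDerivAt_const _ _)).const_smul A
    have h3 := hWc.unique h2
    have h4 : point (B i) 0 = (r s)⁻¹ • point (r s • B i) 0 := by
      rw [← point_smul, smul_smul, inv_mul_cancel₀ hr0.ne', one_smul, mul_zero]
    have h5 : point (-(B i)) 0 = -point (B i) 0 := by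
      have := point_smul (-1) (B i) 0
      rwa [neg_one_smul, mul_zero, neg_one_smul] at this
    rw [h4, map_smul, h3, ← h4, h5, smul_neg, smul_neg, smul_smul, div_eq_inv_mul]

end IsRadius

end

/-! ### Homotheties -/

section

/-- The radius function `τ r(s / τ)` of the homothetic image by `τ` of the hypersurface of
revolution with radius function `r`. -/
noncomputable def dilate (τ : ℝ) (r : ℝ → ℝ) (s : ℝ) : ℝ := τ * r (τ⁻¹ * s)

lemma dilate_mul {τ : ℝ} (hτ : 0 < τ) (r : ℝ → ℝ) (s : ℝ) : dilate τ r (τ * s) = τ * r s := by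
  rw [dilate, inv_mul_cancel_left₀ hτ.ne']

lemma deriv_dilate {τ : ℝ} (hτ : 0 < τ) (r : ℝ → ℝ) :
    deriv (dilate τ r) = fun s => deriv r (τ⁻¹ * s) := by
  funext s
  have h : dilate τ r = fun s => τ * (fun s => r (τ⁻¹ * s)) s := rfl
  rw [h, deriv_const_mul_field, deriv_comp_mul_left, smul_eq_mul, mul_inv_cancel_left₀ hτ.ne']

lemma deriv_deriv_dilate {τ : ℝ} (hτ : 0 < τ) (r : ℝ → ℝ) :
    deriv (deriv (dilate τ r)) = fun s => τ⁻¹ * deriv (deriv r) (τ⁻¹ * s) := by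
  rw [deriv_dilate hτ]
  funext s
  rw [deriv_comp_mul_left, smul_eq_mul]

lemma iteratedDeriv_dilate {τ : ℝ} (r : ℝ → ℝ) (j : ℕ) :
    iteratedDeriv j (dilate τ r) = fun s => τ * (τ⁻¹ ^ j * iteratedDeriv j r (τ⁻¹ * s)) := by
  induction j with
  | zero =>
    funext s
    simp [dilate]
  | succ j ih =>
    rw [iteratedDeriv_succ, ih]
    funext s
    rw [deriv_const_mul_field, deriv_const_mul_field, deriv_comp_mul_left, smul_eq_mul, pow_succ,
      iteratedDeriv_succ]
    ring

/-- Scale-invariant bounds for `u` at infinity become, for its dilations by `τ`, bounds with a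
power of `τ`. -/
lemma abs_iteratedDeriv_dilate_mul_le {τ : ℝ} (hτ : 0 < τ) {u : ℝ → ℝ} {j q : ℕ} {C s : ℝ}
    (h : |iteratedDeriv j u (τ⁻¹ * s)| * (τ⁻¹ * s) ^ (j + q) ≤ C) :
    |iteratedDeriv j (dilate τ u) s| * s ^ (j + q) ≤ C * τ ^ (q + 1) := by
  have e : |iteratedDeriv j (dilate τ u) s| * s ^ (j + q) =
      |iteratedDeriv j u (τ⁻¹ * s)| * (τ⁻¹ * s) ^ (j + q) * τ ^ (q + 1) := by
    have h1 : τ⁻¹ ^ q * τ ^ q = 1 := by rw [← mul_pow, inv_mul_cancel₀ hτ.ne', one_pow]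
    rw [iteratedDeriv_dilate, abs_mul, abs_mul, abs_of_pos hτ,
      abs_of_pos (by positivity : 0 < τ⁻¹ ^ j), mul_pow, pow_add τ⁻¹, pow_succ τ]
    linear_combination (-(|iteratedDeriv j u (τ⁻¹ * s)| * τ⁻¹ ^ j * s ^ (j + q) * τ)) * h1
  rw [e]
  gcongr

lemma smul_revolution {n : ℕ} {τ : ℝ} (hτ : 0 < τ) (r : ℝ → ℝ) (a : ℝ) :
    τ • revolution n r (Ici a) = revolution n (dilate τ r) (Ici (τ * a)) := by
  ext X
  constructor
  · rintro ⟨_, ⟨ν, hν, s, hs, rfl⟩, rfl⟩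
    refine ⟨ν, hν, τ * s, mul_le_mul_of_nonneg_left hs hτ.le, ?_⟩
    change τ • point (r s • ν) s = _
    rw [dilate_mul hτ, mul_smul, point_smul]
  · rintro ⟨ν, hν, s, hs, rfl⟩
    refine ⟨point (r (τ⁻¹ * s) • ν) (τ⁻¹ * s), ⟨ν, hν, τ⁻¹ * s, ?_, rfl⟩, ?_⟩
    · rw [mem_Ici, le_inv_mul_iff₀ hτ]
      exact hs
    · change τ • point (r (τ⁻¹ * s) • ν) (τ⁻¹ * s) = _
      rw [← point_smul, smul_smul, mul_inv_cancel_left₀ hτ.ne', dilate]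

lemma revCurvatures_dilate {m : ℕ} {τ : ℝ} (hτ : 0 < τ) (r : ℝ → ℝ) (s : ℝ) :
    revCurvatures m (dilate τ r (τ * s)) (deriv (dilate τ r) (τ * s))
        (deriv (deriv (dilate τ r)) (τ * s)) =
      τ⁻¹ • revCurvatures m (r s) (deriv r s) (deriv (deriv r) s) := by
  rw [dilate_mul hτ, deriv_deriv_dilate hτ, deriv_dilate hτ]
  funext i
  simp only [inv_mul_cancel_left₀ hτ.ne', revCurvatures, Pi.smul_apply, smul_eq_mul]
  split_ifs
  · ring
  · field_simp

namespace IsRadius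

variable {m k : ℕ} {r : ℝ → ℝ} {b a τ : ℝ}

lemma isRadius_dilate (hr : IsRadius k r b a) (hτ : 0 < τ) :
    IsRadius k (dilate τ r) (τ * b) (τ * a) where
  lt := mul_lt_mul_of_pos_left hr.lt hτ
  contDiffOn := contDiffOn_const.mul <|
    hr.contDiffOn.comp (contDiff_const.mul contDiff_id).contDiffOn fun _ hs =>
      (lt_inv_mul_iff₀ hτ).2 hs
  pos _ hs := mul_pos hτ (hr.pos _ ((lt_inv_mul_iff₀ hτ).2 hs))

variable {Ω : Set (Fin (m + 1) → ℝ)} {f : (Fin (m + 1) → ℝ) → ℝ}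

/-- The self-shrinker equation for a hypersurface of revolution, as an ordinary differential
equation for the radius. -/
def SolvesShrinker (Ω : Set (Fin (m + 1) → ℝ)) (f : (Fin (m + 1) → ℝ) → ℝ) (r : ℝ → ℝ) (a : ℝ) :
    Prop :=
  ∀ s, a ≤ s → revCurvatures m (r s) (deriv r s) (deriv (deriv r) s) ∈ Ω ∧
    f (revCurvatures m (r s) (deriv r s) (deriv (deriv r) s)) =
      (√(1 + deriv r s ^ 2))⁻¹ * (r s - s * deriv r s) / 2

lemma inner_point_revNormal (hr : IsRadius k r b a) (hk : 1 ≤ k)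
    {ν : EuclideanSpace ℝ (Fin (m + 1))} (hν : ‖ν‖ = 1) {s : ℝ} (hs : a ≤ s) :
    inner ℝ (point (r s • ν) s) (revNormal r a (point (r s • ν) s)) =
      -((√(1 + deriv r s ^ 2))⁻¹ * (r s - s * deriv r s)) := by
  rw [hr.revNormal_point hk hν hs, inner_smul_right, inner_eq, horizontal_point, horizontal_point,
    height_point, height_point, inner_smul_left, inner_neg_right, real_inner_self_eq_norm_sq, hν]
  simp
  ring

lemma isSelfShrinker (hr : IsRadius k r b a) (hk : 2 ≤ k) (h : SolvesShrinker Ω f r a) :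
    IsSelfShrinker k Ω f (revolution (m + 1) r (Ici a)) (revNormal r a) where
  isHypersurface := hr.isHypersurface (by omega)
  isUnitNormal := hr.isUnitNormal (by omega)
  equation := by
    rintro _ ⟨ν, hν, s, hs, rfl⟩
    rw [mem_sphere_zero_iff_norm] at hν
    refine ⟨_, hr.hasPrincipalCurvatures hk hν hs, (h s hs).1, ?_⟩
    rw [hr.inner_point_revNormal (by omega) hν hs, (h s hs).2]
    ring

lemma revNormal_dilate_smul (hr : IsRadius k r b a) (hk : 1 ≤ k) (hτ : 0 < τ)
    {ν : EuclideanSpace ℝ (Fin (m + 1))} (hν : ‖ν‖ = 1) {s : ℝ} (hs : a ≤ s) :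
    revNormal (dilate τ r) (τ * a) (τ • point (r s • ν) s) =
      revNormal r a (point (r s • ν) s) := by
  rw [← point_smul, smul_smul, ← dilate_mul hτ, (hr.isRadius_dilate hτ).revNormal_point hk hν
    (mul_le_mul_of_nonneg_left hs hτ.le), hr.revNormal_point hk hν hs, deriv_dilate hτ]
  simp only [inv_mul_cancel_left₀ hτ.ne']

/-- The homothetic images by `√(-t)` of a self-shrinker move by the curvature flow. The
parametrization is `X ↦ √(-t) X`. -/
lemma isCurvatureFlow (hr : IsRadius k r b a) (hk : 2 ≤ k) (h : SolvesShrinker Ω f r a)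
    (hf : IsCurvatureFunction Ω f) {I : Set ℝ} (hI : I ⊆ Iio 0) {ρ : ℝ → ℝ → ℝ}
    (hρ : ∀ t ∈ I, ρ t = dilate (√(-t)) r) :
    IsCurvatureFlow k Ω f I (fun t => √(-t) • revolution (m + 1) r (Ici a))
      (fun t => revNormal (ρ t) (√(-t) * a)) := by
  have hk1 : 1 ≤ k := by omega
  have hpos : ∀ t ∈ I, 0 < √(-t) := fun t ht => Real.sqrt_pos.2 (neg_pos.2 (hI ht))
  refine ⟨fun t ht => ?_, fun t ht => ?_, revolution (m + 1) r (Ici a),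
    fun p => √(-p.1) • p.2, hr.isHypersurface hk1, ?_, fun t ht => ⟨?_, ?_⟩⟩
  · simp only [smul_revolution (hpos t ht)]
    exact (hr.isRadius_dilate (hpos t ht)).isHypersurface hk1
  · simp only [smul_revolution (hpos t ht), hρ t ht]
    exact (hr.isRadius_dilate (hpos t ht)).isUnitNormal hk1
  · have h1 : ContDiffOn ℝ 1 (fun p : ℝ × Amb (m + 1) => -p.1)
        (I ×ˢ revolution (m + 1) r (Ici a)) := contDiff_fst.neg.contDiffOn
    exact (h1.sqrt fun p hp => (neg_pos.2 (hI hp.1)).ne').smul contDiff_snd.contDiffOn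
  · refine ⟨fun X hX => smul_mem_smul_set hX, fun X _ Y _ hXY => ?_, fun X hX => hX⟩
    exact smul_right_injective _ (hpos t ht).ne' hXY
  · rintro _ ⟨ν, hν, s, hs, rfl⟩
    rw [mem_sphere_zero_iff_norm] at hν
    have hτ := hpos t ht
    have hd : HasDerivAt (fun t => √(-t) • point (r s • ν) s)
        ((-1 / (2 * √(-t))) • point (r s • ν) s) t :=
      ((hasDerivAt_neg t).sqrt (neg_pos.2 (hI ht)).ne').smul_const (point (r s • ν) s)
    have hsτ : √(-t) * a ≤ √(-t) * s := mul_le_mul_of_nonneg_left hs hτ.le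
    have hpc := (hr.isRadius_dilate hτ).hasPrincipalCurvatures hk hν hsτ
    rw [revCurvatures_dilate hτ, dilate_mul hτ, mul_smul, point_smul, ← smul_revolution hτ] at hpc
    refine ⟨_, _, hd.hasDerivWithinAt, hρ t ht ▸ hpc, hf.smul_mem _ (h s hs).1 _ (inv_pos.2 hτ), ?_⟩
    rw [hf.homog _ (h s hs).1 _ (inv_pos.2 hτ), (h s hs).2, hρ t ht,
      hr.revNormal_dilate_smul hk1 hτ hν hs, inner_smul_left, hr.inner_point_revNormal hk1 hν hs]
    simp
    field_simp

end IsRadius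

end

/-! ### Asymptotics at infinity -/

section

variable {n k : ℕ}

lemma norm_iteratedFDeriv_comp_height_le {w : ℝ → ℝ} {J : Set ℝ} (hJ : IsOpen J)
    (hw : ContDiffOn ℝ k w J) {j : ℕ} (hj : j ≤ k) {X : Amb n} (hX : height X ∈ J) :
    ‖iteratedFDeriv ℝ j (fun Y : Amb n => w (height Y)) X‖ ≤
      |iteratedDeriv j w (height X)| * ‖heightL n‖ ^ j := by
  have hO : IsOpen (heightL n ⁻¹' J) := hJ.preimage (heightL n).continuous
  have h := (heightL n).iteratedFDerivWithin_comp_right hw hJ.uniqueDiffOn hO.uniqueDiffOn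
    (x := X) hX (i := j) (by exact_mod_cast hj)
  rw [iteratedFDerivWithin_of_isOpen j hO hX, heightL_apply,
    iteratedFDerivWithin_of_isOpen j hJ hX] at h
  change ‖iteratedFDeriv ℝ j (w ∘ heightL n) X‖ ≤ _
  rw [h, ← Real.norm_eq_abs, ← norm_iteratedFDeriv_eq_norm_iteratedDeriv]
  refine (ContinuousMultilinearMap.norm_compContinuousLinearMap_le _ _).trans_eq ?_
  simp

/-- Local convergence near a point that has a neighbourhood missing `C` and all `ϱ S`, for small
`ϱ`: the constant function `1` defines the empty set. -/
lemma exists_defining_functions_of_inter_eq_empty {m : ℕ} {S C U : Set (Amb n)} {P : Amb n}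
    (hU : IsOpen U) (hP : P ∈ U) (hC : C ∩ U = ∅)
    (hS : ∀ᶠ ϱ in 𝓝[>] (0 : ℝ), (ϱ • S) ∩ U = ∅) :
    ∃ (U : Set (Amb n)) (g : Amb n → ℝ) (G : ℝ → Amb n → ℝ),
    IsOpen U ∧ P ∈ U ∧ ContDiffOn ℝ m g U ∧
    (∀ Y ∈ U, g Y = 0 → fderiv ℝ g Y ≠ 0) ∧
    C ∩ U = {Y | Y ∈ U ∧ g Y = 0} ∧
    (∀ᶠ ϱ in 𝓝[>] (0 : ℝ), ContDiffOn ℝ m (G ϱ) U ∧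
      (ϱ • S) ∩ U = {Y | Y ∈ U ∧ G ϱ Y = 0}) ∧
    ∀ j ≤ m, TendstoUniformlyOn (fun ϱ => iteratedFDeriv ℝ j (G ϱ)) (iteratedFDeriv ℝ j g)
      (𝓝[>] (0 : ℝ)) U := by
  refine ⟨U, fun _ => 1, fun _ _ => 1, hU, hP, contDiffOn_const, by simp, by simpa using hC, ?_,
    fun j _ u hu => Eventually.of_forall fun _ _ _ => refl_mem_uniformity hu⟩
  filter_upwards [hS] with ϱ hϱ
  exact ⟨contDiffOn_const, by simpa using hϱ⟩

lemma mem_rotCone {σ : ℝ} (hσ : 0 < σ) {X : Amb n} :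
    X ∈ rotCone n σ ↔ 0 < height X ∧ ‖horizontal X‖ = σ * height X :=
  mem_revolution fun _ hs => mul_pos hσ hs

lemma contDiffOn_norm_horizontal :
    ContDiffOn ℝ k (fun X : Amb n => ‖horizontal X‖) {X | horizontal X ≠ 0} :=
  (horizontalL n).contDiff.contDiffOn.norm ℝ fun _ hX => hX

namespace IsRadius

variable {r : ℝ → ℝ} {b a σ C : ℝ}

/-- A hypersurface of revolution whose radius differs from `σ s` by a function that is
`O(1 / s)`, with corresponding bounds for its derivatives, is asymptotic to a cone. -/
lemma isAsymptoticTo (hr : IsRadius k r b a) (ha : 0 < a) (hσ : 0 < σ)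
    (hw : ∀ j ≤ k, ∀ s, a ≤ s → |iteratedDeriv j (fun s => r s - σ * s) s| * s ^ (j + 1) ≤ C) :
    IsAsymptoticTo k (revolution n r (Ici a)) (rotCone n σ) := by
  set w : ℝ → ℝ := fun s => r s - σ * s with hwdef
  have hmem : ∀ ϱ : ℝ, 0 < ϱ → ∀ Y : Amb n, Y ∈ ϱ • revolution n r (Ici a) ↔
      ϱ * a ≤ height Y ∧ ‖horizontal Y‖ = dilate ϱ r (height Y) := fun ϱ hϱ Y => by
    rw [smul_revolution hϱ, (hr.isRadius_dilate hϱ).mem_iff]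
  have hdil : ∀ ϱ : ℝ, 0 < ϱ → ∀ s, dilate ϱ r s = σ * s + dilate ϱ w s :=
    fun ϱ hϱ s => by
      simp only [dilate, hwdef]
      field_simp
      ring
  have hb : ∀ ϱ : ℝ, 0 < ϱ → ∀ j ≤ k, ∀ s, ϱ * a ≤ s →
      |iteratedDeriv j (dilate ϱ w) s| * s ^ (j + 1) ≤ C * ϱ ^ 2 := fun ϱ hϱ j hj s hs =>
    abs_iteratedDeriv_dilate_mul_le hϱ (hw j hj _ ((le_inv_mul_iff₀ hϱ).2 hs))
  have hb0 : ∀ ϱ : ℝ, 0 < ϱ → ∀ s, ϱ * a ≤ s → |dilate ϱ w s| * s ≤ C * ϱ ^ 2 :=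
    fun ϱ hϱ s hs => by simpa using hb ϱ hϱ 0 (Nat.zero_le _) s hs
  have hC : 0 ≤ C :=
    (mul_nonneg (abs_nonneg _) (by positivity)).trans (hw 0 (Nat.zero_le _) a le_rfl)
  have hpos : ∀ᶠ ϱ in 𝓝[>] (0 : ℝ), 0 < ϱ := eventually_mem_nhdsWithin
  have hsmall : ∀ ε : ℝ, 0 < ε → ∀ D : ℝ, ∀ i : ℕ, i ≠ 0 → ∀ᶠ ϱ in 𝓝[>] (0 : ℝ), D * ϱ ^ i < ε := by
    intro ε hε D i hi
    have h : Tendsto (fun ϱ : ℝ => D * ϱ ^ i) (𝓝[>] 0) (𝓝 (D * 0 ^ i)) :=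
      ((continuous_const.mul (continuous_pow i)).tendsto 0).mono_left nhdsWithin_le_nhds
    rw [zero_pow hi, mul_zero] at h
    exact h.eventually_lt_const hε
  intro P hP
  rcases lt_trichotomy (height P) 0 with hneg | hzero | hposP
  · refine exists_defining_functions_of_inter_eq_empty (U := {Y | height Y < 0})
      (isOpen_lt continuous_height continuous_const) hneg ?_ ?_
    · ext Y
      simp only [mem_inter_iff, mem_rotCone hσ, mem_ofPred_eq, mem_empty_iff_false, iff_false]
      rintro ⟨⟨h1, -⟩, h2⟩
      linarith
    · filter_upwards [hpos] with ϱ hϱ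
      ext Y
      simp only [mem_inter_iff, hmem ϱ hϱ, mem_ofPred_eq, mem_empty_iff_false, iff_false]
      rintro ⟨⟨h1, -⟩, h2⟩
      have : 0 < ϱ * a := by positivity
      linarith
  · have hx : horizontal P ≠ 0 := fun h => hP (by
      rw [← point_horizontal_height P, h, hzero]
      have := point_smul 0 (0 : EuclideanSpace ℝ (Fin n)) 0
      simpa using this)
    have hx0 : 0 < ‖horizontal P‖ := norm_pos_iff.2 hx
    refine exists_defining_functions_of_inter_eq_empty
      (U := {Y | 2 * σ * height Y < ‖horizontal Y‖} ∩ {Y | ‖horizontal P‖ / 2 < ‖horizontal Y‖})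
      ((isOpen_lt (continuous_const.mul continuous_height) continuous_horizontal.norm).inter
        (isOpen_lt continuous_const continuous_horizontal.norm))
      ⟨by rw [mem_ofPred_eq, hzero, mul_zero]; exact hx0, half_lt_self hx0⟩ ?_ ?_
    · ext Y
      simp only [mem_inter_iff, mem_rotCone hσ, mem_ofPred_eq, mem_empty_iff_false, iff_false]
      rintro ⟨⟨h1, h2⟩, h3, -⟩
      have : 0 < σ * height Y := by positivity
      linarith
    · filter_upwards [hpos, hsmall _ hx0 (4 * C / a) 1 one_ne_zero] with ϱ hϱ hϱ'
      ext Y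
      simp only [mem_inter_iff, hmem ϱ hϱ, mem_ofPred_eq, mem_empty_iff_false, iff_false]
      rintro ⟨⟨h1, h2⟩, h3, h4⟩
      have h5 : |dilate ϱ w (height Y)| ≤ C * ϱ / a := by
        have ha' : 0 < ϱ * a := by positivity
        have h6 := (mul_le_mul_of_nonneg_left h1 (abs_nonneg _)).trans (hb0 ϱ hϱ _ h1)
        rw [le_div_iff₀ ha]
        refine le_of_mul_le_mul_left ?_ hϱ
        linarith
      rw [hdil ϱ hϱ] at h2
      have h7 := (le_abs_self _).trans h5
      have h8 : 4 * C / a * ϱ ^ 1 = 4 * (C * ϱ / a) := by ring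
      linarith
  · by_cases hx : horizontal P = 0
    · have hs0 : 0 < height P / 2 := by positivity
      refine exists_defining_functions_of_inter_eq_empty
        (U := {Y | 2 * ‖horizontal Y‖ < σ * height Y} ∩ {Y | height P / 2 < height Y})
        ((isOpen_lt (continuous_const.mul continuous_horizontal.norm)
          (continuous_const.mul continuous_height)).inter
          (isOpen_lt continuous_const continuous_height))
        ⟨by rw [mem_ofPred_eq, hx, norm_zero, mul_zero]; positivity, half_lt_self hposP⟩ ?_ ?_
      · ext Y
        simp only [mem_inter_iff, mem_rotCone hσ, mem_ofPred_eq, mem_empty_iff_false, iff_false]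
        rintro ⟨⟨h1, h2⟩, h3, -⟩
        have : 0 < σ * height Y := by positivity
        linarith
      · filter_upwards [hpos, hsmall _ (by positivity : 0 < σ * (height P / 2) ^ 2) (2 * C) 2
          two_ne_zero] with ϱ hϱ hϱ'
        ext Y
        simp only [mem_inter_iff, hmem ϱ hϱ, mem_ofPred_eq, mem_empty_iff_false, iff_false]
        rintro ⟨⟨h1, h2⟩, h3, h4⟩
        have h5 := hb0 ϱ hϱ _ h1
        have h6 : (height P / 2) ^ 2 < height Y ^ 2 := pow_lt_pow_left₀ h4 hs0.le two_ne_zero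
        have h7 : σ * (height P / 2) ^ 2 < σ * height Y ^ 2 := mul_lt_mul_of_pos_left h6 hσ
        have hY : 0 < height Y := hs0.trans h4
        have h8 : 2 * |dilate ϱ w (height Y)| < σ * height Y := by
          refine lt_of_mul_lt_mul_right ?_ hY.le
          linarith
        rw [hdil ϱ hϱ] at h2
        have h9 := neg_abs_le (dilate ϱ w (height Y))
        linarith
    · have hs0 : 0 < height P / 2 := by positivity
      have hUo : IsOpen ({Y : Amb n | horizontal Y ≠ 0} ∩ {Y | height P / 2 < height Y}) :=
        (isOpen_ne_fun continuous_horizontal continuous_const).inter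
          (isOpen_lt continuous_const continuous_height)
      have hcone : ContDiffOn ℝ k (fun Y : Amb n => ‖horizontal Y‖ - σ * height Y)
          ({Y | horizontal Y ≠ 0} ∩ {Y | height P / 2 < height Y}) :=
        (contDiffOn_norm_horizontal.mono inter_subset_left).sub
          (contDiff_const.mul (heightL n).contDiff).contDiffOn
      have hG : ∀ ϱ : ℝ, 0 < ϱ → ϱ * a < height P / 2 →
          ContDiffOn ℝ k (fun Y : Amb n => ‖horizontal Y‖ - dilate ϱ r (height Y))
          ({Y | horizontal Y ≠ 0} ∩ {Y | height P / 2 < height Y}) := fun ϱ hϱ hϱ' =>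
        (contDiffOn_norm_horizontal.mono inter_subset_left).sub
          ((hr.isRadius_dilate hϱ).contDiffOn.comp (heightL n).contDiff.contDiffOn fun Y hY =>
            ((hr.isRadius_dilate hϱ).lt.trans hϱ').trans hY.2)
      have hϱa : ∀ᶠ ϱ in 𝓝[>] (0 : ℝ), ϱ * a < height P / 2 := by
        filter_upwards [hsmall _ hs0 a 1 one_ne_zero] with ϱ hϱ
        rwa [pow_one, mul_comm] at hϱ
      refine ⟨_, fun Y => ‖horizontal Y‖ - σ * height Y,
        fun ϱ Y => ‖horizontal Y‖ - dilate ϱ r (height Y), hUo, ⟨hx, half_lt_self hposP⟩,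
        hcone, fun Y hY _ h0 => ?_, ?_, ?_, fun j hj => ?_⟩
      · -- the differential does not vanish on the radial direction
        have hn : DifferentiableAt ℝ (fun x : EuclideanSpace ℝ (Fin n) => ‖x‖) (horizontal Y) :=
          differentiableAt_id.norm ℝ hY.1
        have h1 : HasFDerivAt (fun Y : Amb n => ‖horizontal Y‖ - σ * height Y)
            ((fderiv ℝ (fun x : EuclideanSpace ℝ (Fin n) => ‖x‖) (horizontal Y)).comp
              (horizontalL n) - σ • heightL n) Y :=
          (hn.hasFDerivAt.comp Y (horizontalL n).hasFDerivAt).sub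
            ((heightL n).hasFDerivAt.const_mul σ)
        rw [h1.fderiv] at h0
        have h2 := congrArg (fun L : Amb n →L[ℝ] ℝ => L (point (horizontal Y) 0)) h0
        simp [hn.fderiv_norm_self] at h2
        exact hY.1 h2
      · ext Y
        simp only [mem_inter_iff, mem_rotCone hσ, mem_ofPred_eq, sub_eq_zero]
        exact ⟨fun h => ⟨h.2, h.1.2⟩, fun h => ⟨⟨hs0.trans h.1.2, h.2⟩, h.1⟩⟩
      · filter_upwards [hpos, hϱa] with ϱ hϱ hϱ'
        refine ⟨hG ϱ hϱ hϱ', ?_⟩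
        ext Y
        simp only [mem_inter_iff, hmem ϱ hϱ, mem_ofPred_eq, sub_eq_zero]
        exact ⟨fun h => ⟨h.2, h.1.2⟩, fun h => ⟨⟨(hϱ'.trans h.1.2).le, h.2⟩, h.1⟩⟩
      · rw [Metric.tendstoUniformlyOn_iff]
        intro ε hε
        filter_upwards [hpos, hϱa, hsmall ε hε (C / (height P / 2) ^ (j + 1) * ‖heightL n‖ ^ j) 2
          two_ne_zero] with ϱ hϱ hϱ' hϱε Y hY
        have hYU := hUo.mem_nhds hY
        have hjk : (j : WithTop ℕ∞) ≤ k := by exact_mod_cast hj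
        have e : (fun Y : Amb n => ‖horizontal Y‖ - σ * height Y) -
            (fun Y => ‖horizontal Y‖ - dilate ϱ r (height Y)) =
            fun Y => dilate ϱ w (height Y) := by
          funext Y
          simp only [Pi.sub_apply, hdil ϱ hϱ]
          ring
        rw [dist_eq_norm, ← iteratedFDeriv_sub_apply ((hcone.contDiffAt hYU).of_le hjk)
          (((hG ϱ hϱ hϱ').contDiffAt hYU).of_le hjk), e]
        have hdw : ContDiffOn ℝ k (dilate ϱ w) (Ioi (ϱ * b)) := by
          have : dilate ϱ w = fun s => dilate ϱ r s - σ * s := by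
            funext s
            rw [hdil ϱ hϱ]
            ring
          rw [this]
          exact (hr.isRadius_dilate hϱ).contDiffOn.sub (contDiff_const.mul contDiff_id).contDiffOn
        have hYa : ϱ * a < height Y := hϱ'.trans hY.2
        refine (norm_iteratedFDeriv_comp_height_le isOpen_Ioi hdw hj
          ((hr.isRadius_dilate hϱ).lt.trans hYa)).trans_lt (lt_of_le_of_lt ?_ hϱε)
        have hY0 : 0 < height Y := hs0.trans hY.2
        have h1 : |iteratedDeriv j (dilate ϱ w) (height Y)| ≤
            C * ϱ ^ 2 / (height P / 2) ^ (j + 1) := by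
          rw [le_div_iff₀ (by positivity)]
          refine le_trans ?_ (hb ϱ hϱ j hj _ hYa.le)
          gcongr
          exact hY.2.le
        calc _ ≤ C * ϱ ^ 2 / (height P / 2) ^ (j + 1) * ‖heightL n‖ ^ j := by gcongr
          _ = _ := by ring

end IsRadius

end

/-! ### The remainder term -/

section

/-- `u` is `C^k` beyond `b`, where its derivatives of order at most `k` satisfy the
scale-invariant bounds `|u⁽ʲ⁾(s)| ≤ C s^{-(j + 3)}`. -/
structure IsRemainder (k : ℕ) (C b : ℝ) (u : ℝ → ℝ) : Prop where
  contDiffOn : ContDiffOn ℝ k u (Ioi b)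
  bound : ∀ s, b < s → ∀ j ≤ k, |iteratedDeriv j u s| * s ^ (j + 3) ≤ C

lemma rescaled_eq_dilate (u : ℝ → ℝ) (t : ℝ) : rescaled u t = dilate (√(-t)) u := by
  funext s
  rw [rescaled, dilate, div_eq_inv_mul]

lemma radius_rescaled {σ c t : ℝ} (ht : t < 0) (u : ℝ → ℝ) :
    radius σ (-t * c) (rescaled u t) = dilate (√(-t)) (radius σ c u) := by
  have hτ : 0 < √(-t) := Real.sqrt_pos.2 (neg_pos.2 ht)
  have h2 : -t = √(-t) * √(-t) := (Real.mul_self_sqrt (neg_pos.2 ht).le).symm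
  funext s
  rw [rescaled_eq_dilate]
  simp only [radius, dilate]
  generalize √(-t) = τ at *
  rw [h2]
  -- at `s = 0` both sides take the value `0` for the quotients with vanishing denominator
  rcases eq_or_ne s 0 with rfl | hs
  · simp
  rcases eq_or_ne σ 0 with rfl | hσ
  · simp
  field_simp

lemma weightedNorm_le {p j : ℕ} {a B : ℝ} {u : ℝ → ℝ}
    (h : ∀ s, a ≤ s → |s ^ p * iteratedDerivWithin j u (Ici a) s| ≤ B) :
    weightedNorm p j a u ≤ ENNReal.ofReal B := by
  rw [weightedNorm, eLpNorm_exponent_top]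
  exact eLpNormEssSup_le_of_ae_bound (ae_restrict_of_forall_mem measurableSet_Ici h)

namespace IsRemainder

variable {k : ℕ} {C b a : ℝ} {u : ℝ → ℝ}

lemma iteratedDerivWithin_eq (hu : ContDiffOn ℝ k u (Ioi b)) (hba : b < a) {j : ℕ} (hj : j ≤ k)
    {s : ℝ} (hs : a ≤ s) : iteratedDerivWithin j u (Ici a) s = iteratedDeriv j u s :=
  iteratedDerivWithin_eq_iteratedDeriv (uniqueDiffOn_Ici a)
    ((hu.contDiffAt (Ioi_mem_nhds (hba.trans_le hs))).of_le (by exact_mod_cast hj)) hs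

lemma memCZero (h : IsRemainder k C b u) (hba : b < a) : MemCZero k a u := by
  refine ⟨h.contDiffOn.mono fun s hs => hba.trans_le hs, fun j hj => ?_⟩
  refine squeeze_zero_norm' (a := fun s : ℝ => C / s) ?_ (tendsto_const_nhds.div_atTop tendsto_id)
  filter_upwards [eventually_ge_atTop a, eventually_ge_atTop 1] with s hs hs1
  rw [iteratedDerivWithin_eq h.contDiffOn hba hj hs, Real.norm_eq_abs,
    le_div_iff₀ (by positivity)]
  exact (mul_le_mul_of_nonneg_left (le_self_pow₀ hs1 (by omega)) (abs_nonneg _)).trans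
    (h.bound s (hba.trans_le hs) j hj)

/-- The weighted bounds for the rescaled remainder, with the powers `τ⁴` and `τ²` of
`τ = √(-t)`. -/
lemma weightedNorm_rescaled_le (h : IsRemainder k C b u) (hba : b < a) (ha : 1 ≤ a)
    {t : ℝ} (ht : t < 0) {j : ℕ} (hj : j ≤ k) :
    weightedNorm (j + 3) j (√(-t) * a) (rescaled u t) ≤ ENNReal.ofReal (C * (-t) ^ 2) ∧
      weightedNorm (j + 1) j (√(-t) * a) (rescaled u t) ≤ ENNReal.ofReal (C * (-t)) := by
  have hτ : 0 < √(-t) := Real.sqrt_pos.2 (neg_pos.2 ht)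
  have h2 : -t = √(-t) ^ 2 := (Real.sq_sqrt (neg_pos.2 ht).le).symm
  rw [rescaled_eq_dilate]
  generalize √(-t) = τ at *
  rw [h2]
  have hd : ContDiffOn ℝ k (dilate τ u) (Ioi (τ * b)) := contDiffOn_const.mul <|
    h.contDiffOn.comp (contDiff_const.mul contDiff_id).contDiffOn fun s hs =>
      (lt_inv_mul_iff₀ hτ).2 hs
  have hlt : τ * b < τ * a := mul_lt_mul_of_pos_left hba hτ
  have key : ∀ s, τ * a ≤ s → |iteratedDeriv j (dilate τ u) s| * s ^ (j + 3) ≤ C * τ ^ 4 :=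
    fun s hs => abs_iteratedDeriv_dilate_mul_le hτ
      (h.bound _ (hba.trans_le ((le_inv_mul_iff₀ hτ).2 hs)) j hj)
  have hs0 : ∀ s, τ * a ≤ s → τ ≤ s := fun s hs => by nlinarith
  constructor <;> refine weightedNorm_le fun s hs => ?_
  · have := hs0 s hs
    rw [iteratedDerivWithin_eq hd hlt hj hs, abs_mul, abs_of_pos (pow_pos (by linarith) _),
      mul_comm, ← pow_mul]
    exact key s hs
  · have h3 := hs0 s hs
    have hs1 : 0 < s := hτ.trans_le h3
    rw [iteratedDerivWithin_eq hd hlt hj hs, abs_mul, abs_of_pos (pow_pos hs1 _), mul_comm]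
    refine le_of_mul_le_mul_right ?_ (pow_pos hτ 2)
    calc |iteratedDeriv j (dilate τ u) s| * s ^ (j + 1) * τ ^ 2
        ≤ |iteratedDeriv j (dilate τ u) s| * s ^ (j + 1) * s ^ 2 := by gcongr
      _ = |iteratedDeriv j (dilate τ u) s| * s ^ (j + 3) := by ring
      _ ≤ C * τ ^ 4 := key s hs
      _ = C * τ ^ 2 * τ ^ 2 := by ring

lemma iteratedDeriv_const_mul_inv (c : ℝ) (j : ℕ) (s : ℝ) :
    iteratedDeriv j (fun s : ℝ => c * s⁻¹) s = c * ((-1) ^ j * j.factorial * s ^ (-1 - j : ℤ)) := by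
  rw [iteratedDeriv_const_mul_field, iteratedDeriv_eq_iterate, iter_deriv_inv]

/-- The term `c / (σ s)` and the remainder together are `O(1 / s)`. -/
lemma abs_iteratedDeriv_radius_sub_le (h : IsRemainder k C b u) (hba : b < a) (ha : 1 ≤ a)
    {σ : ℝ} (c : ℝ) {j : ℕ} (hj : j ≤ k) {s : ℝ} (hs : a ≤ s) :
    |iteratedDeriv j (fun s => radius σ c u s - σ * s) s| * s ^ (j + 1) ≤
      |c / σ| * k.factorial + C := by
  have hs1 : 1 ≤ s := ha.trans hs
  have hs0 : 0 < s := by linarith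
  have e : (fun s => radius σ c u s - σ * s) = (fun s => c / σ * s⁻¹) + u := by
    funext s
    simp only [radius, Pi.add_apply, div_eq_mul_inv]
    ring
  have hu := (h.contDiffOn.contDiffAt (Ioi_mem_nhds (hba.trans_le hs))).of_le
    (by exact_mod_cast hj : (j : WithTop ℕ∞) ≤ k)
  have hc : ContDiffAt ℝ j (fun s : ℝ => c / σ * s⁻¹) s :=
    contDiffAt_const.mul (contDiffAt_inv ℝ hs0.ne')
  rw [e, iteratedDeriv_add hc hu, iteratedDeriv_const_mul_inv]
  have h1 : |c / σ * ((-1) ^ j * j.factorial * s ^ (-1 - j : ℤ))| * s ^ (j + 1) =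
      |c / σ| * j.factorial := by
    rw [abs_mul, abs_mul, abs_mul, abs_pow, abs_neg, abs_one, one_pow, one_mul, Nat.abs_cast,
      abs_of_pos (zpow_pos hs0 _), mul_assoc, mul_assoc, ← zpow_natCast, ← zpow_add₀ hs0.ne']
    have : (-1 : ℤ) - j + ((j + 1 : ℕ) : ℤ) = 0 := by push_cast; ring
    rw [this, zpow_zero, mul_one]
  have h2 : |iteratedDeriv j u s| * s ^ (j + 1) ≤ C :=
    (mul_le_mul_of_nonneg_left (pow_le_pow_right₀ hs1 (by omega)) (abs_nonneg _)).trans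
      (h.bound s (hba.trans_le hs) j hj)
  have h3 : (j.factorial : ℝ) ≤ k.factorial := by exact_mod_cast Nat.factorial_le hj
  have h4 : |c / σ| * j.factorial ≤ |c / σ| * k.factorial := by gcongr
  refine (mul_le_mul_of_nonneg_right (abs_add_le _ _) (by positivity)).trans ?_
  rw [add_mul, h1]
  linarith

end IsRemainder

namespace ProfileSolution

variable {σ M : ℝ} {k : ℕ} (i : ProfileSolution σ M k)

lemma radius_remainder : radius σ (i.F 0 0) i.remainder = i.rad := by
  funext s
  rw [radius, remainder]
  ring

lemma mem_farRegion {b s : ℝ} (hb : 0 ≤ b) (hX : 1 < i.X * b ^ 2) (hs : b < s) :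
    s ∈ EulerClass.farRegion i.X := by
  refine ⟨hb.trans_lt hs, hX.trans ?_⟩
  exact mul_lt_mul_of_pos_left (pow_lt_pow_left₀ hs hb two_ne_zero) i.X_pos

lemma isRadius {b a : ℝ} (hσ : 0 < σ) (hb : 0 ≤ b) (hX : 1 < i.X * b ^ 2) (hba : b < a) :
    IsRadius k i.rad b a where
  lt := hba
  contDiffOn := (i.contDiffOn_rad hσ).mono fun _ hs => i.mem_farRegion hb hX hs
  pos _ hs := i.rad_pos hσ (i.mem_farRegion hb hX hs)

/-- The principal curvatures of the hypersurface generated by a solution of the profile system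
are proportional to `(1, …, 1, y)`. -/
lemma revCurvatures_rad {m : ℕ} (hσ : 0 < σ) (hk : 1 ≤ k) {s : ℝ}
    (hs : s ∈ EulerClass.farRegion i.X) :
    revCurvatures m (i.rad s) (deriv i.rad s) (deriv (deriv i.rad) s) =
      ((√(1 + i.radDeriv s ^ 2))⁻¹ / i.rad s) •
        (oneZero (m + 1) + i.y (s ^ 2)⁻¹ • Pi.single (Fin.last m) 1) := by
  have hev : deriv i.rad =ᶠ[𝓝 s] i.radDeriv := by
    filter_upwards [(EulerClass.isOpen_farRegion i.X).mem_nhds hs] with t ht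
    exact (i.hasDerivAt_rad hσ ht).deriv
  rw [hev.deriv_eq, (i.hasDerivAt_radDeriv hσ hk hs).deriv, (i.hasDerivAt_rad hσ hs).deriv]
  have hr := (i.rad_pos hσ hs).ne'
  have hA : (√(1 + i.radDeriv s ^ 2))⁻¹ ^ 2 * (1 + i.radDeriv s ^ 2) = 1 := by
    rw [inv_pow, Real.sq_sqrt (by positivity)]
    exact inv_mul_cancel₀ (by positivity)
  funext l
  simp only [revCurvatures, oneZero, Pi.smul_apply, Pi.add_apply, smul_eq_mul]
  by_cases hl : l = Fin.last m
  · subst hl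
    simp only [if_true, Fin.val_last, Pi.single_eq_same, zero_add, mul_one]
    generalize (√(1 + i.radDeriv s ^ 2))⁻¹ = A at *
    linear_combination (A * i.y (s ^ 2)⁻¹ / i.rad s) * hA
  · have : (l : ℕ) + 1 ≠ m + 1 := fun h => hl (Fin.ext (by simpa using h))
    rw [if_neg hl, if_neg this, Pi.single_eq_of_ne hl, mul_zero, add_zero, mul_one]

lemma solvesShrinker {m : ℕ} {Ω : Set (Fin (m + 1) → ℝ)} {f : (Fin (m + 1) → ℝ) → ℝ}
    (hf : IsCurvatureFunction Ω f) (hσ : 0 < σ) (hk : 1 ≤ k) {b a : ℝ} (hb : 0 ≤ b)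
    (hX : 1 < i.X * b ^ 2) (hba : b < a)
    (hmem : ∀ v, |v| < i.δ → oneZero (m + 1) + v • Pi.single (Fin.last m) (1 : ℝ) ∈ Ω)
    (hF : ∀ v, i.F 0 v = f (oneZero (m + 1) + v • Pi.single (Fin.last m) (1 : ℝ))) :
    IsRadius.SolvesShrinker Ω f i.rad a := by
  intro s hs
  have hs' := i.mem_farRegion hb hX (hba.trans_le hs)
  have hy := hmem _ (i.abs_y_lt _ (EulerClass.inv_sq_mem_of_farRegion hs'))
  have hr := i.rad_pos hσ hs'
  have hA : 0 < (√(1 + i.radDeriv s ^ 2))⁻¹ := inv_pos.2 (Real.sqrt_pos.2 (by positivity))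
  rw [i.revCurvatures_rad hσ hk hs', (i.hasDerivAt_rad hσ hs').deriv]
  refine ⟨hf.smul_mem _ hy _ (by positivity), ?_⟩
  rw [hf.homog _ hy _ (by positivity), ← hF, i.F_y_eq hσ hs']
  field_simp

end ProfileSolution

end

/-! ### The curvature function near `(1, …, 1, 0)` -/

section

/-- The derivatives `dˡ/dvˡ f(x + v e)` of `f` along a line. -/
noncomputable def lineJet {E : Type*} [NormedAddCommGroup E] [NormedSpace ℝ E] (f : E → ℝ)
    (x e : E) (l : ℕ) (v : ℝ) : ℝ :=
  iteratedFDeriv ℝ l f (x + v • e) fun _ => e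

lemma norm_iteratedFDeriv_le_of_cNorm_le {n m : ℕ} {f : (Fin n → ℝ) → ℝ} {K : Set (Fin n → ℝ)}
    {M : ℝ≥0} (h : cNorm m f K ≤ M) {l : ℕ} (hl : l ≤ m) {x : Fin n → ℝ} (hx : x ∈ K) :
    ‖iteratedFDeriv ℝ l f x‖ ≤ M := by
  have h1 : ‖iteratedFDeriv ℝ l f x‖ₑ ≤ M :=
    (le_iSup₂ (f := fun x (_ : x ∈ K) => ‖iteratedFDeriv ℝ l f x‖ₑ) x hx).trans
      ((le_iSup₂ (f := fun j (_ : j ∈ Iic m) => ⨆ x ∈ K, ‖iteratedFDeriv ℝ j f x‖ₑ) l hl).trans h)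
  rw [enorm_le_coe] at h1
  exact_mod_cast h1

lemma cNorm_mono {n m m' : ℕ} (h : m ≤ m') (f : (Fin n → ℝ) → ℝ) (K : Set (Fin n → ℝ)) :
    cNorm m f K ≤ cNorm m' f K :=
  biSup_mono fun _ hj => le_trans (mem_Iic.1 hj) h

lemma isIncreasingJet_lineJet {n k : ℕ} {f : (Fin n → ℝ) → ℝ} {K : Set (Fin n → ℝ)}
    (hK : IsOpen K) (hf : ContDiffOn ℝ k f K) {x : Fin n → ℝ} {i : Fin n} {δ : ℝ}
    (hδ : Metric.ball x δ ⊆ K) (hpos : ∀ y ∈ K, 0 < fderiv ℝ f y (Pi.single i 1)) {M : ℝ≥0}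
    (hM : cNorm k f K ≤ M) : IsIncreasingJet (lineJet f x (Pi.single i 1)) δ M k := by
  have he : ‖(Pi.single i 1 : Fin n → ℝ)‖ = 1 := by rw [Pi.norm_single, norm_one]
  have hmem : ∀ v : ℝ, |v| < δ → x + v • Pi.single i 1 ∈ K := fun v hv => hδ <| by
    rwa [mem_ball_iff_norm, add_sub_cancel_left, norm_smul, he, mul_one, Real.norm_eq_abs]
  refine ⟨fun l hl v hv => ?_, fun l hl v hv => ?_, fun v hv => ?_⟩
  · have hd : DifferentiableAt ℝ (iteratedFDeriv ℝ l f) (x + v • Pi.single i 1) :=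
      (hf.contDiffAt (hK.mem_nhds (hmem v hv))).differentiableAt_iteratedFDeriv
        (by exact_mod_cast hl)
    have hline :
        HasDerivAt (fun v : ℝ => x + v • (Pi.single i 1 : Fin n → ℝ)) (Pi.single i 1) v := by
      simpa using ((hasDerivAt_id v).smul_const (Pi.single i 1 : Fin n → ℝ)).const_add x
    have h := hd.hasFDerivAt.comp_hasDerivAt v hline
    have h2 := (ContinuousMultilinearMap.apply ℝ (fun _ : Fin l => Fin n → ℝ) ℝ
      (fun _ => Pi.single i 1)).hasFDerivAt.comp_hasDerivAt v h
    refine h2.congr_deriv ?_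
    rw [lineJet, iteratedFDeriv_succ_apply_left]
    rfl
  · refine ((iteratedFDeriv ℝ l f _).le_opNorm _).trans ?_
    simp only [he, Finset.prod_const_one, mul_one]
    exact norm_iteratedFDeriv_le_of_cNorm_le hM hl (hmem v hv)
  · rw [lineJet, iteratedFDeriv_one_apply]
    exact hpos _ (hmem v hv)

end

/-! ### The asymptotically conical self-shrinker -/

theorem theorem1 (n k : ℕ) (hn : 1 ≤ n) (hk : 3 ≤ k) (σ : ℝ) (hσ : 0 < σ) :
    ∃ C : ℝ≥0 → ℝ,
      ∀ K : Set (Fin n → ℝ), IsOpen K → Bornology.IsBounded K → oneZero n ∈ K →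
      ∀ M' : ℝ≥0, ∃ R : ℝ, 1 ≤ R ∧
        ∀ (Ω : Set (Fin n → ℝ)) (f : (Fin n → ℝ) → ℝ), IsCurvatureFunction Ω f → K ⊆ Ω →
          ContDiffOn ℝ ((k + 1 : ℕ) : WithTop ℕ∞) f K →
          (∀ x ∈ K, ∀ i : Fin n, 0 < fderiv ℝ f x (Pi.single i 1)) →
          cNorm (k + 1) f K ≤ M' →
          ∃ u : ℝ → ℝ, MemCZero k R u ∧
            (∀ s ∈ Ici R, 0 < radius σ (f (oneZero n)) u s) ∧
            IsSelfShrinker k Ω f (revolution n (radius σ (f (oneZero n)) u) (Ici R))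
              (revNormal (radius σ (f (oneZero n)) u) R) ∧
            IsAsymptoticTo k (revolution n (radius σ (f (oneZero n)) u) (Ici R)) (rotCone n σ) ∧
            (∀ t ∈ Ico (-1 : ℝ) 0,
              Real.sqrt (-t) • revolution n (radius σ (f (oneZero n)) u) (Ici R) =
                revolution n (radius σ (-t * f (oneZero n)) (rescaled u t))
                  (Ici (Real.sqrt (-t) * R))) ∧
            IsCurvatureFlow k Ω f (Ico (-1 : ℝ) 0)
              (fun t => Real.sqrt (-t) • revolution n (radius σ (f (oneZero n)) u) (Ici R))
              (fun t => revNormal (radius σ (-t * f (oneZero n)) (rescaled u t))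
                (Real.sqrt (-t) * R)) ∧
            ∀ M : ℝ≥0, cNorm k f K ≤ M → ∀ t ∈ Ico (-1 : ℝ) 0,
              ∑ j ∈ Finset.range k,
                  weightedNorm (j + 3) j (Real.sqrt (-t) * R) (rescaled u t) ≤
                ENNReal.ofReal (C M * (-t) ^ 2) ∧
              weightedNorm (k + 1) k (Real.sqrt (-t) * R) (rescaled u t) ≤
                ENNReal.ofReal (C M * (-t)) := by
  obtain ⟨m, rfl⟩ : ∃ m, n = m + 1 := ⟨n - 1, by omega⟩
  have hk2 : 2 ≤ k := by omega
  choose C₀ ε hε hC₀ using fun N : ℕ => ProfileSolution.exists_remainder_bound σ (N : ℝ) k hσ hk2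
  refine ⟨fun M => k * ∑ N ∈ Finset.range (⌈M⌉₊ + 1), |C₀ N|, fun K hK _ hKmem M' => ?_⟩
  obtain ⟨δ, hδ, hδK⟩ := Metric.isOpen_iff.1 hK _ hKmem
  have hM1 : (0 : ℝ) < M' + 1 := by positivity
  obtain ⟨X, hX⟩ := exists_isSmallInterval hσ hM1 hδ
  have hX0 := hX.pos
  have hlarge : ∀ c : ℝ, 0 < c → ∀ᶠ b in atTop, 1 < c * b ^ 2 := fun c hc =>
    ((tendsto_pow_atTop two_ne_zero).const_mul_atTop hc).eventually_gt_atTop 1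
  -- `b` has to serve all integral bounds up to `⌈M'⌉₊`, because `C M` must not depend on `M'`
  obtain ⟨b, hb0, hbX, hbε⟩ := ((eventually_ge_atTop (0 : ℝ)).and ((hlarge X hX0).and
    ((Finset.range (⌈M'⌉₊ + 1)).eventually_all.2 fun N _ => hlarge _ (hε N)))).exists
  have hbR : b < b + 1 := lt_add_one b
  have hR1 : 1 ≤ b + 1 := by linarith
  refine ⟨b + 1, hR1, fun Ω f hf hKΩ hfK hfpos hfM' => ?_⟩
  set e : Fin (m + 1) → ℝ := Pi.single (Fin.last m) 1 with he
  set F := lineJet f (oneZero (m + 1)) e with hF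
  have hfk : ContDiffOn ℝ k f K := hfK.of_le (by exact_mod_cast Nat.le_succ k)
  have hjet : ∀ M : ℝ≥0, cNorm k f K ≤ M → IsIncreasingJet F δ M k := fun M hM =>
    isIncreasingJet_lineJet hK hfk hδK (fun y hy => hfpos y hy _) hM
  have hM'k : cNorm k f K ≤ M' := (cNorm_mono (Nat.le_succ k) f K).trans hfM'
  obtain ⟨w, hw⟩ := exists_isBarrierSolution_zero
    (hjet (M' + 1) (hM'k.trans (by exact_mod_cast le_self_add))) hk hσ hδ hM1 hX
  set i := hw.toProfileSolution (hjet M' hM'k) hk hσ hδ hM1 hX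
  have hFf : ∀ v, i.F 0 v = f (oneZero (m + 1) + v • e) := fun v => rfl
  have hF0 : f (oneZero (m + 1)) = i.F 0 0 := by rw [hFf, zero_smul, add_zero]
  have hmem : ∀ v, |v| < i.δ → oneZero (m + 1) + v • e ∈ Ω := fun v hv => hKΩ <| hδK <| by
    rw [mem_ball_iff_norm, add_sub_cancel_left, norm_smul, he, Pi.norm_single, norm_one, mul_one]
    exact hv
  have hrem : ∀ M : ℝ≥0, cNorm k f K ≤ M →
      IsRemainder k (∑ N ∈ Finset.range (⌈M⌉₊ + 1), |C₀ N|) b i.remainder := by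
    intro M hM
    refine ⟨(i.contDiffOn_remainder hσ).mono fun s hs => i.mem_farRegion hb0 hbX hs,
      fun s hs j hj => ?_⟩
    set N := ⌈min M M'⌉₊ with hN
    have hNM : N ≤ ⌈M⌉₊ := Nat.ceil_mono (min_le_left _ _)
    have hNM' : N ≤ ⌈M'⌉₊ := Nat.ceil_mono (min_le_right _ _)
    have hcN : cNorm k f K ≤ (N : ℝ≥0) := by
      refine (le_min hM hM'k).trans ?_
      exact_mod_cast Nat.le_ceil (min M M')
    have hs1 : 1 < ε N * s ^ 2 :=
      (hbε N (Finset.mem_range.2 (by omega))).trans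
        (mul_lt_mul_of_pos_left (pow_lt_pow_left₀ hs hb0 two_ne_zero) (hε N))
    -- the same solution, seen as one for the bound `N` on `f`
    have hjN : IsIncreasingJet F δ N k := by simpa using hjet N hcN
    have h := hC₀ N (hw.toProfileSolution hjN hk hσ hδ hM1 hX) s
      (i.mem_farRegion hb0 hbX hs) hs1 j hj
    refine (le_trans h (le_abs_self _)).trans ?_
    exact Finset.single_le_sum (f := fun N => |C₀ N|) (fun _ _ => abs_nonneg _)
      (Finset.mem_range.2 (by omega))
  have hrad : radius σ (f (oneZero (m + 1))) i.remainder = i.rad := by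
    rw [hF0, i.radius_remainder]
  have hr : IsRadius k i.rad b (b + 1) := i.isRadius hσ hb0 hbX hbR
  have hsol : IsRadius.SolvesShrinker Ω f i.rad (b + 1) :=
    i.solvesShrinker hf hσ (by omega) hb0 hbX hbR hmem hFf
  have hresc : ∀ t ∈ Ico (-1 : ℝ) 0,
      radius σ (-t * f (oneZero (m + 1))) (rescaled i.remainder t) = dilate (√(-t)) i.rad :=
    fun t ht => by rw [radius_rescaled ht.2, hrad]
  refine ⟨i.remainder, (hrem M' hM'k).memCZero hbR, ?_, ?_, ?_, fun t ht => ?_, ?_,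
    fun M hM t ht => ⟨?_, ?_⟩⟩
  · rw [hrad]
    exact fun s hs => hr.pos s (hbR.trans_le hs)
  · rw [hrad]
    exact hr.isSelfShrinker hk2 hsol
  · rw [hrad]
    have hw := fun j (hj : j ≤ k) s (hs : b + 1 ≤ s) =>
      (hrem M' hM'k).abs_iteratedDeriv_radius_sub_le (σ := σ) hbR hR1 (f (oneZero (m + 1))) hj hs
    rw [hrad] at hw
    exact hr.isAsymptoticTo (by linarith) hσ hw
  · rw [hresc t ht, hrad, smul_revolution (Real.sqrt_pos.2 (neg_pos.2 ht.2))]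
  · simp only [hrad]
    exact hr.isCurvatureFlow hk2 hsol hf (fun t ht => ht.2) hresc
  · refine (Finset.sum_le_card_nsmul _ _ _ fun j hj =>
      ((hrem M hM).weightedNorm_rescaled_le hbR hR1 ht.2 (Finset.mem_range.1 hj).le).1).trans ?_
    rw [Finset.card_range, ← ENNReal.ofReal_nsmul, nsmul_eq_mul, mul_assoc]
  · refine ((hrem M hM).weightedNorm_rescaled_le hbR hR1 ht.2 le_rfl).2.trans ?_
    refine ENNReal.ofReal_le_ofReal (mul_le_mul_of_nonneg_right ?_ (neg_pos.2 ht.2).le)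
    exact le_mul_of_one_le_left (Finset.sum_nonneg fun _ _ => abs_nonneg _)
      (by exact_mod_cast (by omega : 1 ≤ k))
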